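/- **Setting.** Let $d\ge 2$, $\gamma>0$, $R_0>0$, let $\Gamma:=\overline B(0,R_0)\subset\mathbb R^d$ and let $V_0\ge 0$ be a constant. Let $u(x)=u(|x|)$ be a bounded, Lebesgue-measurable radial function on $\mathbb R^d$ with $\int_{\mathbb R^d\setminus\Gamma}(1+u(x))^-\,dx<\infty$. Write $a^\pm$ for the positive and negative parts of $a$, $\partial_*\Gamma$ for the measure theoretic boundary of $\Gamma$, and $\mathcal H^{d-1}$ for the Hausdorff measure (normalized to agree with Lebesgue measure on $\mathbb R^{d-1}$). **Equilibria.** Let $\mathcal Y$ be the set of $1$-Lipschitz paths $y:[0,\infty)\to\mathbb R^d$ such that $\theta:=\inf\{t\ge0: y_t\in\overline\Gamma\}<\infty$ and $y_t=y_\theta$ for $t\ge\theta$, with the metric $\|y-\hat y\|_\infty+|\theta-\hat\theta|$. An *equilibrium capped at* $T\in(0,\infty)$ is a triple $(\kappa,\mathbb Q,L)$ of a number $\kappa\in(0,\infty)$, a Borel probability measure $\mathbb Q$ on $\mathcal Y\times[0,\infty)=\{(y,\beta)\}$, and an upper semicontinuous, locally integrable function $L:\mathbb R^d\to\mathbb R\setminus\{0\}$,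 such that * $\mathbb Q$ minimizes $\mathbb E^{\hat{\mathbb Q}}\big[\int_0^\theta L^+(y_t)\,dt\big]$ over all Borel probability measures $\hat{\mathbb Q}$ with $\hat{\mathbb Q}\circ y_0^{-1}=\mathbb Q\circ y_0^{-1}$; * $\mathbb Q$-a.s., $\int_0^\theta L^+(y_t)\,dt\le T$ and $\beta\le\theta$, and $y_\theta\in\partial_*\Gamma$ holds $\mathbb Q$-a.s. on $\{\beta=\theta\}$; * for all $\phi\in C_c^\infty(\mathbb R^d)$, $$\kappa\,\mathbb E^{\mathbb Q}\Big[\int_0^\beta\phi(y_t)L^+(y_t)\,dt\Big]=\int_{\mathbb R^d}\phi(x)(1+\gamma L(x))\,dx,\qquad \mathbb E^{\mathbb Q}\Big[\int_0^\beta\phi(y_t)L^-(y_t)\,dt\Big]=0.$$ An *equilibrium* is an equilibrium capped at some $T\in(0,\infty)$. For an equilibrium and $t\ge0$ put $\iota_t:=\inf\{r\in[0,\theta]:\int_r^\theta L^+(y_z)\,dz<t\}$ (with $\inf\emptyset:=\infty$), $\overline{\mathbb Q}_t(dx):=\mathbb E^{\mathbb Q}\big[\int_{\iota_t}^{\beta\vee\iota_t}\mathbf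 1_{\{y_r\in dx\}}\,dr\big]$, where the inner integral is $0$ if $\iota_t=\infty$, $D_t:=\Gamma\cup\operatorname{supp}\overline{\mathbb Q}_t$ and $$w^{\mathbb Q,L}(x):=\inf\{t\ge0:\ x\in D_t\}\in[0,\infty].$$ The excess energy loss and its cumulative version are $$\mathbf e^{\kappa,\mathbb Q,L}(dx):=\kappa\,\mathbb Q(y_0\in dx,\theta=0)+\mathbf 1_{\{w^{\mathbb Q,L}<\infty\}\setminus\overline\Gamma}(x)\big(\kappa\,\mathbb Q(y_0\in dx)-\kappa\,\mathbb Q(y_\beta\in dx)-(1+u(x))\,dx\big),$$ $$\mathbf E^{\kappa,\mathbb Q,L}_t:=\mathbf e^{\kappa,\mathbb Q,L}(\{w^{\mathbb Q,L}\le t\}).$$ **Minimal solutions.** A function $w:\mathbb R^d\to[0,\infty]$ is a *minimal solution* of $$\mathrm{div}\Big(\frac{\nabla w}{|\nabla w|}\Big(\frac1{|\nabla w|}+\gamma\Big)\Big)=-1-u$$ with initial domain $\Gamma$ and initial velocity $V_0$ if there are equilibria $(\kappa^n,\mathbb Q^n,L^n)_{n\in\mathbb N}$ such that, for every $T>0$: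 1. $\kappa^n\mathbb Q^n(y_\theta\in dx,\beta=\theta)>(\gamma+V_0)\mathbf 1_{\partial_*\Gamma}(x)\,\mathcal H^{d-1}(dx)$ for all $n$ (where $\mu>\nu$ means $\mu(A)>\nu(A)$ for every measurable $A$ with $\mu(A)>0$), $\mathbf e^{\kappa^n,\mathbb Q^n,L^n}\ge0$ for all $n$, $w^{\mathbb Q^n,L^n}\wedge T\to w\wedge T$ in $L^1_{\rm loc}(\mathbb R^d)$, and $\kappa^n\mathbb Q^n(\beta=\theta)\to\int_{\partial_*\Gamma}(\gamma+V_0)\,d\mathcal H^{d-1}$; 2. for every sequence of equilibria $(\hat\kappa^n,\hat{\mathbb Q}^n,\hat L^n)_{n\in\mathbb N}$ such that, for all $n$, $\hat\kappa^n\hat{\mathbb Q}^n(y_\theta\in dx,\beta=\theta)=\kappa^n\mathbb Q^n(y_\theta\in dx,\beta=\theta)$, $\mathbf e^{\hat\kappa^n,\hat{\mathbb Q}^n,\hat L^n}\ge0$ and $\mathbf E^{\hat\kappa^n,\hat{\mathbb Q}^n,\hat L^n}_t\le\mathbf E^{\kappa^n,\mathbb Q^n,L^n}_t$ for all $t\in[0,T]$,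 one has $$\liminf_{n\to\infty}\big(\mathbf E^{\hat\kappa^n,\hat{\mathbb Q}^n,\hat L^n}_t-\mathbf E^{\kappa^n,\mathbb Q^n,L^n}_r\big)\ge0\qquad\text{for all }0\le r<t<T.$$ **Proposition.** Let $$R^*:=\inf\Big\{r>R_0:\ \int_{R_0}^r(1+u(z))z^{d-1}\,dz>(\gamma+V_0)R_0^{d-1}-\gamma r^{d-1}\Big\}\in[R_0,\infty].$$ Then the function $w:\mathbb R^d\to[0,\infty]$ given by $$w(x)=\int_{R_0}^{|x|}\frac{r^{d-1}}{(\gamma+V_0)R_0^{d-1}-\int_{R_0}^r(1+u(z))z^{d-1}\,dz-\gamma r^{d-1}}\,dr\;\mathbf 1_{\{R_0<|x|\le R^*\}}(x)+\infty\,\mathbf 1_{\{|x|>R^*\}}(x)$$ (the integral is taken in $[0,\infty]$, and its integrand is $+\infty$ where the denominator vanishes) is a minimal solution of this equation with initial domain $\Gamma$ and initial velocity $V_0$. -/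

import Mathlib

open MeasureTheory Filter Topology
open scoped NNReal ENNReal

noncomputable section

/-- The Euclidean space of dimension `d`. -/
abbrev Eu (d : ℕ) : Type := EuclideanSpace ℝ (Fin d)

/-- The measure theoretic boundary of `A`: the points at which neither `A` nor its complement has
zero upper density. -/
def mtBoundary {d : ℕ} (A : Set (Eu d)) : Set (Eu d) :=
  {x | 0 < limsup (fun r : ℝ => volume (Metric.closedBall x r ∩ A) / ENNReal.ofReal (r ^ d))
        (𝓝[>] 0) ∧
       0 < limsup (fun r : ℝ => volume (Metric.closedBall x r \ A) / ENNReal.ofReal (r ^ d))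
        (𝓝[>] 0)}

/-- Admissible paths for the target set `Γ`: `1`-Lipschitz paths `y : [0, ∞) → ℝᵈ` which hit the
closure of `Γ` and are constant from the hitting time on. -/
structure StoppedPath {d : ℕ} (Γ : Set (Eu d)) where
  /-- the position at a given time -/
  pos : ℝ≥0 → Eu d
  lipschitz : LipschitzWith 1 pos
  hits : ∃ t, pos t ∈ closure Γ
  stops : ∀ t, sInf {s | pos s ∈ closure Γ} ≤ t → pos t = pos (sInf {s | pos s ∈ closure Γ})

namespace StoppedPath

variable {d : ℕ} {Γ : Set (Eu d)}

/-- The hitting time `θ` of the closure of `Γ`. -/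
def hit (y : StoppedPath Γ) : ℝ≥0 := sInf {s | y.pos s ∈ closure Γ}

theorem pos_min_hit (y : StoppedPath Γ) (t : ℝ≥0) : y.pos (min t y.hit) = y.pos t := by
  rcases le_total t y.hit with h | h
  · rw [min_eq_left h]
  · rw [min_eq_right h]; exact (y.stops t h).symm

theorem dist_pos_le (y : StoppedPath Γ) (s t : ℝ≥0) : dist (y.pos s) (y.pos t) ≤ y.hit := by
  rw [← y.pos_min_hit s, ← y.pos_min_hit t]
  refine (y.lipschitz.dist_le_mul _ _).trans ?_
  rw [NNReal.coe_one, one_mul, NNReal.dist_eq, abs_le]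
  have h1 : ((min s y.hit : ℝ≥0) : ℝ) ≤ y.hit := NNReal.coe_le_coe.2 (min_le_right _ _)
  have h2 : ((min t y.hit : ℝ≥0) : ℝ) ≤ y.hit := NNReal.coe_le_coe.2 (min_le_right _ _)
  have h3 := (min s y.hit).coe_nonneg
  have h4 := (min t y.hit).coe_nonneg
  constructor <;> linarith

/-- The path as a bounded continuous function of time. -/
def toBCF (y : StoppedPath Γ) : BoundedContinuousFunction ℝ≥0 (Eu d) :=
  BoundedContinuousFunction.mkOfBound ⟨y.pos, y.lipschitz.continuous⟩ y.hit y.dist_pos_le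

/-- The path together with its hitting time, in the `ℓ¹` product of the two metric spaces. -/
def toProd (y : StoppedPath Γ) : WithLp 1 (BoundedContinuousFunction ℝ≥0 (Eu d) × ℝ) :=
  WithLp.toLp 1 (y.toBCF, (y.hit : ℝ))

theorem toProd_injective : Function.Injective (toProd (Γ := Γ)) := by
  intro y z h
  have h1 : y.toBCF = z.toBCF := congrArg (fun q => (WithLp.ofLp q).1) h
  have h2 : y.pos = z.pos := funext fun t => DFunLike.congr_fun h1 t
  cases y; cases z; cases h2; rfl

/-- The metric `‖y - z‖_∞ + |θ_y - θ_z|`. -/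
instance : MetricSpace (StoppedPath Γ) := MetricSpace.induced toProd toProd_injective inferInstance

theorem dist_eq (y z : StoppedPath Γ) :
    dist y z = (⨆ t, dist (y.pos t) (z.pos t)) + |(y.hit : ℝ) - z.hit| := by
  change dist y.toProd z.toProd = _
  rw [WithLp.prod_dist_eq_of_L1, BoundedContinuousFunction.dist_eq_iSup]
  rfl

instance : MeasurableSpace (StoppedPath Γ) := borel _

instance : BorelSpace (StoppedPath Γ) := ⟨rfl⟩

end StoppedPath

/-- The space of pairs `(y, β)` of an admissible path and a killing time. The path space and
`[0, ∞)` are separable metric spaces, so that the product `σ`-algebra is the Borel one. -/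
abbrev KilledPath {d : ℕ} (Γ : Set (Eu d)) : Type := StoppedPath Γ × ℝ≥0

/-- The data `(κ, Q, L)` of a candidate equilibrium. -/
structure Triplet {d : ℕ} (Γ : Set (Eu d)) where
  κ : ℝ≥0
  Q : Measure (KilledPath Γ)
  L : Eu d → ℝ

/-- `∫_r^θ L⁺(y_z) dz`, the running cost of a path from the time `r` until it is stopped. -/
def runningCost {d : ℕ} {Γ : Set (Eu d)} (L : Eu d → ℝ) (y : StoppedPath Γ) (r : ℝ≥0) : ℝ≥0∞ :=
  ∫⁻ z in Set.Icc (r : ℝ) y.hit, ENNReal.ofReal (L (y.pos z.toNNReal))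

/-- `(κ, Q, L)` is an equilibrium capped at `T`. The local integrability of `L` and the
integrability under `Q` in the fixed-point condition say that the two sides of its equation are
well defined; the absolute value of the test function in the last condition plays the same role. -/
structure IsEquilibrium {d : ℕ} (γ : ℝ) {Γ : Set (Eu d)} (T : ℝ) (q : Triplet Γ) : Prop where
  κ_pos : 0 < q.κ
  isProbabilityMeasure : IsProbabilityMeasure q.Q
  upperSemicontinuous : UpperSemicontinuous q.L
  L_ne_zero : ∀ x, q.L x ≠ 0
  /-- `Q` minimizes the expected running cost, given the law of the initial position. -/
  optimal : ∀ Q' : Measure (KilledPath Γ), IsProbabilityMeasure Q' →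
    Q'.map (fun p => p.1.pos 0) = q.Q.map (fun p => p.1.pos 0) →
    ∫⁻ p, runningCost q.L p.1 0 ∂q.Q ≤ ∫⁻ p, runningCost q.L p.1 0 ∂Q'
  capped : ∀ᵐ p ∂q.Q, runningCost q.L p.1 0 ≤ ENNReal.ofReal T ∧ p.2 ≤ p.1.hit
  /-- Given `β = θ`, the terminal position is a.s. in the measure theoretic boundary of `Γ`. -/
  terminal : ∀ᵐ p ∂q.Q, p.2 = p.1.hit → p.1.pos p.1.hit ∈ mtBoundary Γ
  locallyIntegrable : LocallyIntegrable q.L volume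
  fixedPoint : ∀ φ : Eu d → ℝ, ContDiff ℝ (⊤ : ℕ∞) φ → HasCompactSupport φ →
    Integrable (fun p : KilledPath Γ => ∫ t in (0 : ℝ)..p.2,
      φ (p.1.pos t.toNNReal) * max (q.L (p.1.pos t.toNNReal)) 0) q.Q ∧
    (q.κ : ℝ) * ∫ p, (∫ t in (0 : ℝ)..p.2,
      φ (p.1.pos t.toNNReal) * max (q.L (p.1.pos t.toNNReal)) 0) ∂q.Q =
      ∫ x, φ x * (1 + γ * q.L x)
  negPart : ∀ φ : Eu d → ℝ, ContDiff ℝ (⊤ : ℕ∞) φ → HasCompactSupport φ →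
    ∫⁻ p, (∫⁻ t in Set.Icc (0 : ℝ) p.2,
      ‖φ (p.1.pos t.toNNReal)‖ₑ * ENNReal.ofReal (-q.L (p.1.pos t.toNNReal))) ∂q.Q = 0

namespace Triplet

variable {d : ℕ} {Γ : Set (Eu d)}

/-- `ι(L, t) = inf {r ∈ [0, θ] : ∫_r^θ L⁺(y_z) dz < t}`, with `inf ∅ = ∞`. -/
def entry (L : Eu d → ℝ) (t : ℝ≥0) (y : StoppedPath Γ) : ℝ≥0∞ :=
  ⨅ (r : ℝ≥0) (_ : r ≤ y.hit ∧ runningCost L y r < t), (r : ℝ≥0∞)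

/-- The occupation measure `A ↦ E^Q[∫_ι^{β ∨ ι} 1_A(y_r) dr]` with `ι = ι(L, t)`. -/
def occupation (q : Triplet Γ) (t : ℝ≥0) : Measure (Eu d) :=
  ((q.Q.prod (volume : Measure ℝ)).restrict
    {z | 0 ≤ z.2 ∧ entry q.L t z.1.1 ≤ ENNReal.ofReal z.2 ∧ z.2 ≤ z.1.2}).map
    (fun z => z.1.1.pos z.2.toNNReal)

/-- The cascade aggregate `D_t` at time `t`. -/
def aggregate (q : Triplet Γ) (t : ℝ≥0) : Set (Eu d) := Γ ∪ (q.occupation t).support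

/-- The arrival time function `w^{Q,L}`, with `inf ∅ = ∞`. -/
def arrival (q : Triplet Γ) (x : Eu d) : ℝ≥0∞ :=
  ⨅ (t : ℝ≥0) (_ : x ∈ q.aggregate t), (t : ℝ≥0∞)

/-- The region `{w^{Q,L} < ∞}` without the closure of `Γ`. -/
def newRegion (q : Triplet Γ) : Set (Eu d) := {x | q.arrival x < ⊤} \ closure Γ

/-- The terms with a positive sign of the excess energy loss
`e = κ Q(y₀ ∈ dx, θ = 0) + 1_{newRegion} (κ Q(y₀ ∈ dx) - κ Q(y_β ∈ dx) - (1 + u) dx)`,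
where `(1 + u) dx` is split into its positive and its negative part. -/
def excessPos (u : Eu d → ℝ) (q : Triplet Γ) : Measure (Eu d) :=
  q.κ • (q.Q.restrict {p | p.1.hit = 0}).map (fun p => p.1.pos 0) +
    (q.κ • q.Q.map (fun p => p.1.pos 0) +
      volume.withDensity (fun x => ENNReal.ofReal (-(1 + u x)))).restrict q.newRegion

/-- The terms with a negative sign of the excess energy loss. -/
def excessNeg (u : Eu d → ℝ) (q : Triplet Γ) : Measure (Eu d) :=
  (q.κ • q.Q.map (fun p => p.1.pos p.2) +
    volume.withDensity (fun x => ENNReal.ofReal (1 + u x))).restrict q.newRegion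

/-- The excess energy loss `e` is a non-negative measure. -/
def Admissible (u : Eu d → ℝ) (q : Triplet Γ) : Prop := q.excessNeg u ≤ q.excessPos u

/-- The cumulative excess energy loss `E_t = e({w^{Q,L} ≤ t})`. If `e ≥ 0` and `(1 + u)⁻` is
integrable outside `Γ`, both terms are finite. -/
def cumulativeLoss (u : Eu d → ℝ) (q : Triplet Γ) (t : ℝ) : ℝ :=
  (q.excessPos u {x | q.arrival x ≤ ENNReal.ofReal t}).toReal -
    (q.excessNeg u {x | q.arrival x ≤ ENNReal.ofReal t}).toReal

/-- The measure `κ Q(y_θ ∈ dx, β = θ)`. -/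
def boundaryEnergy (q : Triplet Γ) : Measure (Eu d) :=
  q.κ • (q.Q.restrict {p | p.2 = p.1.hit}).map (fun p => p.1.pos p.1.hit)

end Triplet

/-- The measure `(γ + V₀(x)) 1_{∂_* Γ}(x) H^{d-1}(dx)`, where the Hausdorff measure is normalized
to agree with Lebesgue measure on `ℝ^{d-1}`. -/
def initialEnergy {d : ℕ} (γ : ℝ) (Γ : Set (Eu d)) (V₀ : Eu d → ℝ) : Measure (Eu d) :=
  ((Measure.euclideanHausdorffMeasure (d - 1) : Measure (Eu d)).restrict (mtBoundary Γ)).withDensity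
    (fun x => ENNReal.ofReal (γ + V₀ x))

/-- `μ > ν`, in the sense that `μ E > ν E` for all measurable `E` with `μ E > 0`. -/
def StrictlyDominates {α : Type*} [MeasurableSpace α] (μ ν : Measure α) : Prop :=
  ∀ A, MeasurableSet A → 0 < μ A → ν A < μ A

/-- The real-valued function `w ∧ T`. -/
def truncate {α : Type*} (w : α → ℝ≥0∞) (T : ℝ) (x : α) : ℝ := (min (w x) (ENNReal.ofReal T)).toReal

/-- Convergence in `L¹_loc(ℝᵈ)`. -/
def TendstoL1Loc {d : ℕ} (f : ℕ → Eu d → ℝ) (g : Eu d → ℝ) : Prop :=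
  (∀ n, LocallyIntegrable (f n) volume) ∧ LocallyIntegrable g volume ∧
    ∀ K : Set (Eu d), IsCompact K →
      Tendsto (fun n => eLpNorm (f n - g) 1 (volume.restrict K)) atTop (𝓝 0)

/-- `w` is a minimal solution of the cascade equation
`div ((∇w / |∇w|) (1 / |∇w| + γ)) = -1 - u`
with initial domain `Γ` and initial velocity `V₀`. -/
def IsMinimalSolution {d : ℕ} (γ : ℝ) (u : Eu d → ℝ) (Γ : Set (Eu d)) (V₀ : Eu d → ℝ)
    (w : Eu d → ℝ≥0∞) : Prop :=
  ∃ q : ℕ → Triplet Γ, (∀ n, ∃ T : ℝ, 0 < T ∧ IsEquilibrium γ T (q n)) ∧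
    ∀ T : ℝ, 0 < T →
      ((∀ n, StrictlyDominates (q n).boundaryEnergy (initialEnergy γ Γ V₀)) ∧
        (∀ n, (q n).Admissible u) ∧
        TendstoL1Loc (fun n => truncate (q n).arrival T) (truncate w T) ∧
        Tendsto (fun n => ((q n).κ : ℝ≥0∞) * (q n).Q {p | p.2 = p.1.hit}) atTop
          (𝓝 (∫⁻ x in mtBoundary Γ, ENNReal.ofReal (γ + V₀ x)
            ∂(Measure.euclideanHausdorffMeasure (d - 1))))) ∧
      ∀ q' : ℕ → Triplet Γ, (∀ n, ∃ T' : ℝ, 0 < T' ∧ IsEquilibrium γ T' (q' n)) →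
        (∀ n, (q' n).boundaryEnergy = (q n).boundaryEnergy) →
        (∀ n, (q' n).Admissible u) →
        (∀ n, ∀ t ∈ Set.Icc 0 T, (q' n).cumulativeLoss u t ≤ (q n).cumulativeLoss u t) →
        ∀ r t : ℝ, 0 ≤ r → r < t → t < T →
          0 ≤ liminf (fun n =>
            (((q' n).cumulativeLoss u t - (q n).cumulativeLoss u r : ℝ) : EReal)) atTop

/-- `(γ + V₀) R₀^{d-1} - ∫_{R₀}^r (1 + u(z)) z^{d-1} dz - γ r^{d-1}`, for a radial profile `u`. -/
def ballEnergy (d : ℕ) (γ R₀ V₀ : ℝ) (u : ℝ → ℝ) (r : ℝ) : ℝ :=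
  (γ + V₀) * R₀ ^ (d - 1) - (∫ z in R₀..r, (1 + u z) * z ^ (d - 1)) - γ * r ^ (d - 1)

/-- `R^* = inf {r > R₀ : ∫_{R₀}^r (1 + u(z)) z^{d-1} dz > (γ + V₀) R₀^{d-1} - γ r^{d-1}}`,
an element of `[R₀, ∞]`, with `inf ∅ = ∞`. -/
def ballMaxRadius (d : ℕ) (γ R₀ V₀ : ℝ) (u : ℝ → ℝ) : ℝ≥0∞ :=
  ⨅ (r : ℝ) (_ : R₀ < r ∧
    (γ + V₀) * R₀ ^ (d - 1) - γ * r ^ (d - 1) < ∫ z in R₀..r, (1 + u z) * z ^ (d - 1)),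
    ENNReal.ofReal r

/-- The arrival time function of the growing ball. The integral is taken in `[0, ∞]` and its
integrand is `∞` where the denominator vanishes; the denominator is non-negative on `(R₀, R^*)`. -/
def ballArrival (d : ℕ) (γ R₀ V₀ : ℝ) (u : ℝ → ℝ) (x : Eu d) : ℝ≥0∞ :=
  if ‖x‖ ≤ R₀ then 0
  else if ENNReal.ofReal ‖x‖ ≤ ballMaxRadius d γ R₀ V₀ u then
    ∫⁻ r in Set.Ioc R₀ ‖x‖,
      ENNReal.ofReal (r ^ (d - 1)) / ENNReal.ofReal (ballEnergy d γ R₀ V₀ u r)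
  else ⊤

end

/-! As long as the initial velocity V is positive, the energy balance of the growing ball can be
solved exactly on rays. Per unit of solid angle, put a(r) = (γ+V)R₀^{d-1} - ∫_{R₀}^r (1+u(z))z^{d-1}
dz. Let particles run inwards with unit speed, killed at an exponential rate q, with starting
density (1+u(r))r^{d-1} + q a(r) on (R₀,ρ] and an additional mass a(ρ) on the outer sphere.
Integrating this balance shows that a(r) is precisely the flux of surviving particles through radius
r (`integral_source`, `lintegral_startLaw_exp`). With L = r^{d-1}/(a(r) - γr^{d-1}) on the closed
shell and L = -1/γ elsewhere, the occupation density a(r)/r^{d-1} satisfies (a/r^{d-1}) L = 1 + γL,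
which is the fixed-point equation. Radial paths are optimal because the norm along a 1-Lipschitz
path cannot cross a level interval faster than with unit speed (`time_le_runningCost`). Hence this
is an equilibrium whose arrival time is the integral of L in the radius.

On the shell, sources and killing cancel against (1+u)dx, so that the whole excess energy loss sits
on the sphere of radius ρ (`excessPos_eq`). The denominator a(r) - γr^{d-1} has a first zero Z,
since (1+u)⁻ is integrable and γr^{d-1} tends to infinity. It is bounded by C(Z-r) to the left of Z,
so the arrival time diverges there, and ρ < Z can be chosen with arrival time above any prescribed n
(`exists_le_ballTime`). The cumulative loss then vanishes up to time n.

Take V = V₀ + 1/(n+1). The boundary energy strictly dominates the prescribed one and converges to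
it, and monotone convergence in n identifies the limit of the arrival times. Minimality costs
nothing: the losses to be compared with are eventually zero, while admissible competitors have
non-negative losses (`Triplet.cumulativeLoss_nonneg`).

The boundary condition is expressed by a Hausdorff measure, whereas the particles are described in
polar coordinates. The two surface measures are identified in `unitSurface_eq_restrict`, by
flattening thin cones over small pieces of the sphere into cylinders. -/

open scoped Pointwise

/-! ### Flattening the unit sphere; cylinders and polar coordinates. -/

section Sphere

variable {E : Type*} [NormedAddCommGroup E] [InnerProductSpace ℝ E]

/-- A local straightening of the unit sphere near the point `p`: the normalized vector is projected
along `p`, and the norm becomes the coordinate in the direction of `p`. -/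
noncomputable def sphereChart (p x : E) : E :=
  ‖x‖⁻¹ • x - inner ℝ p (‖x‖⁻¹ • x) • p + (‖x‖ - 1) • p

/-- At `p`, normalization differentiates to the projection onto the complement of `p`, and the norm
to the component along `p`. The two add up to the identity, so the chart almost preserves volumes
and distances near `p`. -/
theorem hasStrictFDerivAt_sphereChart {p : E} (hp : ‖p‖ = 1) :
    HasStrictFDerivAt (sphereChart p) (ContinuousLinearMap.id ℝ E) p := by
  have hn : HasStrictFDerivAt (fun x : E => ‖x‖) (innerSL ℝ p) p := by
    have h := (hasStrictFDerivAt_norm_sq p).sqrt (by simp [hp])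
    simp only [Real.sqrt_sq (norm_nonneg _), hp] at h
    convert h using 1
    ext v
    simp
  have hi : HasStrictFDerivAt (fun x : E => ‖x‖⁻¹) (-innerSL ℝ p) p := by
    have h := (hasStrictDerivAt_inv (x := ‖p‖) (by simp [hp])).comp_hasStrictFDerivAt p hn
    refine h.congr_fderiv ?_
    ext v
    simp [hp]
  have h1 := hi.smul (hasStrictFDerivAt_id p)
  have h2 := ((innerSL ℝ p).hasStrictFDerivAt.comp p h1).smul_const p
  have h3 := (hn.sub_const 1).smul_const p
  have h4 : HasStrictFDerivAt (sphereChart p) _ p := (h1.sub h2).add h3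
  refine h4.congr_fderiv ?_
  ext v
  simp [hp, inner_smul_right]

/-- Direction and radius separate: the direction determines the base point, the radius the height. A
cone over a piece of the sphere thus becomes a cylinder over its projection. -/
theorem sphereChart_smul {p a : E} (ha : ‖a‖ = 1) {r : ℝ} (hr : 0 < r) :
    sphereChart p (r • a) = (a - inner ℝ p a • p) + (r - 1) • p := by
  have : ‖r • a‖ = r := by rw [norm_smul, ha, Real.norm_of_nonneg hr.le, mul_one]
  rw [sphereChart, this, smul_smul, inv_mul_cancel₀ hr.ne', one_smul]

variable [FiniteDimensional ℝ E] [MeasurableSpace E] [BorelSpace E]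

/-- The volume of an orthogonal cylinder. -/
theorem volume_cylinder {p : E} (hp : ‖p‖ = 1) {B : Set E} (hB : ∀ b ∈ B, inner ℝ p b = 0)
    (h : ℝ) :
    volume {x : E | ∃ b ∈ B, ∃ t ∈ Set.Ioo 0 h, x = b + t • p} =
      ENNReal.ofReal h * (Measure.euclideanHausdorffMeasure (Module.finrank ℝ E - 1) : Measure E) B := by
  set s : Submodule ℝ E := ℝ ∙ p with hs
  have hp0 : p ≠ 0 := by rintro rfl; simp at hp
  have hmp := s.measurePreserving_measurableEquivProd (0 : E)
  rw [InnerProductSpace.euclideanHausdorffMeasure_eq_volume] at hmp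
  let j : ℝ ≃ₗᵢ[ℝ] s := LinearIsometryEquiv.toSpanUnitSingleton p hp
  -- The splitting of `E` into the line of `p` and its complement preserves measure, and turns the
  -- cylinder into a product.
  have hset : {x : E | ∃ b ∈ B, ∃ t ∈ Set.Ioo 0 h, x = b + t • p} =
      s.measurableEquivProd (0 : E) ⁻¹' ((j '' Set.Ioo 0 h) ×ˢ ((↑) ⁻¹' B : Set sᗮ)) := by
    rw [← MeasurableEquiv.image_symm]
    ext x
    simp only [Set.mem_ofPred_eq, Set.mem_image, Prod.exists, Set.mem_prod, Set.mem_preimage,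
      Submodule.measurableEquivProd_symm_apply]
    constructor
    · rintro ⟨b, hb, t, ht, rfl⟩
      have hbs : b ∈ sᗮ := by
        rw [Submodule.mem_orthogonal_singleton_iff_inner_right]; exact hB b hb
      refine ⟨j t, ⟨b, hbs⟩, ⟨⟨t, ht, rfl⟩, hb⟩, ?_⟩
      have : ((j t : s) : E) = t • p := rfl
      simp [this, add_comm]
    · rintro ⟨_, b, ⟨⟨t, ht, rfl⟩, hb⟩, rfl⟩
      have : ((j t : s) : E) = t • p := rfl
      exact ⟨b, hb, t, ht, by simp [this, add_comm]⟩
  rw [hset, hmp.measure_preimage_equiv, Measure.volume_eq_prod, Measure.prod_prod]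
  congr 1
  · rw [← LinearIsometryEquiv.coe_toMeasurableEquiv, MeasurableEquiv.image_eq_preimage_symm]
    have : MeasurePreserving (j.toMeasurableEquiv.symm) volume volume := j.symm.measurePreserving
    rw [this.measure_preimage_equiv]
    simp
  · have hrank : Module.finrank ℝ E - 1 = Module.finrank ℝ sᗮ := by
      have := s.finrank_add_finrank_orthogonal
      rw [finrank_span_singleton hp0] at this
      omega
    rw [hrank, ← InnerProductSpace.euclideanHausdorffMeasure_eq_volume,
      ← isometry_subtype_coe.euclideanHausdorffMeasure_image]
    congr 1
    ext b
    constructor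
    · rintro ⟨c, hc, rfl⟩
      exact hc
    · intro hb
      exact ⟨⟨b, Submodule.mem_orthogonal_singleton_iff_inner_right.2 (hB b hb)⟩, hb, rfl⟩

variable [Nontrivial E]

/-- Integration in polar coordinates for the Lebesgue integral. -/
theorem lintegral_polar {f : E → ℝ≥0∞} (hf : Measurable f) :
    ∫⁻ x, f x = ∫⁻ ω, (∫⁻ r in Set.Ioi (0 : ℝ),
      ENNReal.ofReal (r ^ (Module.finrank ℝ E - 1)) * f (r • (ω : E)))
        ∂(volume : Measure E).toSphere := by
  have hmp := (volume : Measure E).measurePreserving_homeomorphUnitSphereProd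
  have h1 : ∫⁻ x, f x = ∫⁻ x : ({(0 : E)}ᶜ : Set E), f x ∂((volume : Measure E).comap (↑)) := by
    rw [lintegral_subtype_comap (measurableSet_singleton _).compl, restrict_compl_singleton]
  have h2 := hmp.symm (homeomorphUnitSphereProd E).toMeasurableEquiv |>.lintegral_comp
    (f := fun x : ({(0 : E)}ᶜ : Set E) => f x) (hf.comp measurable_subtype_coe)
  rw [h1, ← h2, lintegral_prod]
  · refine lintegral_congr fun ω => ?_
    rw [Measure.volumeIoiPow, lintegral_withDensity_eq_lintegral_mul]
    · rw [← lintegral_subtype_comap measurableSet_Ioi]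
      rfl
    · fun_prop
    · exact hf.comp (by
        have := (homeomorphUnitSphereProd E).symm.continuous
        exact (continuous_subtype_val.comp (this.comp (Continuous.prodMk_right ω))).measurable)
  · exact (hf.comp (measurable_subtype_coe.comp
      (homeomorphUnitSphereProd E).symm.continuous.measurable)).aemeasurable

end Sphere

/-! ### The surface measure of polar coordinates is the normalized Hausdorff measure. -/

section SphereMeasure

variable {E : Type*} [NormedAddCommGroup E] [InnerProductSpace ℝ E]

theorem norm_sub_inner_smul_le {p : E} (hp : ‖p‖ = 1) (v : E) : ‖v - inner ℝ p v • p‖ ≤ ‖v‖ := by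
  have h : ‖v - inner ℝ p v • p‖ ^ 2 = ‖v‖ ^ 2 - (inner ℝ p v) ^ 2 := by
    rw [norm_sub_sq_real, inner_smul_right, norm_smul, hp, real_inner_comm, Real.norm_eq_abs,
      mul_one, sq_abs]
    ring
  refine le_of_sq_le_sq ?_ (norm_nonneg _)
  rw [h]
  nlinarith [sq_nonneg (inner ℝ p v)]

variable [MeasurableSpace E] [BorelSpace E]

theorem euclideanHausdorffMeasure_image_sub_inner_smul_le {p : E} (hp : ‖p‖ = 1) (N : ℕ)
    (A : Set E) :
    (Measure.euclideanHausdorffMeasure N : Measure E) ((fun a => a - inner ℝ p a • p) '' A) ≤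
      Measure.euclideanHausdorffMeasure N A := by
  have hl : LipschitzWith 1 (fun a : E => a - inner ℝ p a • p) := by
    refine LipschitzWith.of_dist_le_mul fun a b => ?_
    have := norm_sub_inner_smul_le hp (a - b)
    rw [inner_sub_right, sub_smul] at this
    rw [dist_eq_norm, dist_eq_norm, NNReal.coe_one, one_mul]
    rwa [sub_sub_sub_comm]
  rw [Measure.euclideanHausdorffMeasure_def, Measure.smul_apply, Measure.smul_apply]
  have := hl.hausdorffMeasure_image_le (d := N) (by positivity) A
  simp only [ENNReal.coe_one, ENNReal.one_rpow, one_mul] at this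
  gcongr

theorem euclideanHausdorffMeasure_le_image {X Y : Type*} [MetricSpace X] [MeasurableSpace X]
    [BorelSpace X] [MetricSpace Y] [MeasurableSpace Y] [BorelSpace Y] {f : X → Y} {A : Set X} {t : ℝ≥0}
    (h : ∀ a ∈ A, ∀ b ∈ A, dist a b ≤ t * dist (f a) (f b)) (N : ℕ) :
    (Measure.euclideanHausdorffMeasure N : Measure X) A ≤
      (t : ℝ≥0∞) ^ N * (Measure.euclideanHausdorffMeasure N : Measure Y) (f '' A) := by
  have ha : AntilipschitzWith t (fun a : A => f a) :=
    AntilipschitzWith.of_le_mul_dist fun a b => h a a.2 b b.2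
  have h1 := ha.le_hausdorffMeasure_image (d := N) (by positivity) Set.univ
  have h2 : (Measure.euclideanHausdorffMeasure N : Measure X) A =
      (Measure.euclideanHausdorffMeasure N : Measure A) Set.univ := by
    rw [← (isometry_subtype_coe (s := A)).euclideanHausdorffMeasure_image, Set.image_univ,
      Subtype.range_coe]
  have h3 : f '' A = (fun a : A => f a) '' Set.univ := by
    ext x; simp
  rw [h2, h3, Measure.euclideanHausdorffMeasure_def, Measure.euclideanHausdorffMeasure_def,
    Measure.smul_apply, Measure.smul_apply, ENNReal.smul_def, ENNReal.smul_def, smul_eq_mul,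
    smul_eq_mul, mul_left_comm]
  rw [ENNReal.rpow_natCast] at h1
  gcongr

variable [FiniteDimensional ℝ E]

/-- The surface measure of the unit sphere, as a measure on the ambient space. -/
noncomputable def unitSurface (E : Type*) [NormedAddCommGroup E] [InnerProductSpace ℝ E]
    [MeasurableSpace E] [BorelSpace E] [FiniteDimensional ℝ E] : Measure E :=
  (volume : Measure E).toSphere.map (↑)

variable [Nontrivial E]

/-- In polar coordinates a truncated cone is a product of its base and a radial interval. Its volume
is what connects the surface measure with Lebesgue measure. -/
theorem volume_cone {A : Set E} (hA : MeasurableSet A) (hA1 : A ⊆ Metric.sphere 0 1) {h : ℝ} :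
    volume {x : E | ∃ a ∈ A, ∃ r ∈ Set.Ioo 1 (1 + h), x = r • a} =
      unitSurface E A *
        ∫⁻ r in Set.Ioo 1 (1 + h), ENNReal.ofReal (r ^ (Module.finrank ℝ E - 1)) := by
  have hset : {x : E | ∃ a ∈ A, ∃ r ∈ Set.Ioo 1 (1 + h), x = r • a} =
      {x : E | ‖x‖ ∈ Set.Ioo 1 (1 + h)} ∩ {x | ‖x‖⁻¹ • x ∈ A} := by
    ext x
    constructor
    · rintro ⟨a, ha, r, hr, rfl⟩
      have h0 : 0 < r := one_pos.trans hr.1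
      have : ‖r • a‖ = r := by
        rw [norm_smul, mem_sphere_zero_iff_norm.1 (hA1 ha), Real.norm_of_nonneg h0.le, mul_one]
      refine ⟨by simpa only [Set.mem_ofPred_eq, this] using hr, ?_⟩
      simp only [Set.mem_ofPred_eq, this]
      rwa [smul_smul, inv_mul_cancel₀ h0.ne', one_smul]
    · rintro ⟨h1, h2⟩
      have h0 : ‖x‖ ≠ 0 := (one_pos.trans h1.1).ne'
      exact ⟨_, h2, _, h1, by rw [smul_smul, mul_inv_cancel₀ h0, one_smul]⟩
  have hm1 : MeasurableSet {x : E | ‖x‖ ∈ Set.Ioo 1 (1 + h)} := measurable_norm measurableSet_Ioo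
  have hm2 : MeasurableSet {x : E | ‖x‖⁻¹ • x ∈ A} :=
    (by fun_prop : Measurable fun x : E => ‖x‖⁻¹ • x) hA
  rw [hset, ← lintegral_indicator_one (hm1.inter hm2),
    lintegral_polar (measurable_one.indicator (hm1.inter hm2)), unitSurface,
    Measure.map_apply measurable_subtype_coe hA, ← lintegral_indicator_one (measurable_subtype_coe hA),
    ← lintegral_mul_const _ (measurable_one.indicator (measurable_subtype_coe hA))]
  refine lintegral_congr fun ω => ?_
  have hω : ‖(ω : E)‖ = 1 := mem_sphere_zero_iff_norm.1 ω.2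
  have hsub : Set.Ioo 1 (1 + h) ⊆ Set.Ioi 0 := fun r hr => one_pos.trans hr.1
  rw [← lintegral_indicator measurableSet_Ioi, ← lintegral_indicator measurableSet_Ioo,
    ← lintegral_const_mul _ (by
      refine Measurable.indicator ?_ measurableSet_Ioo
      fun_prop)]
  refine lintegral_congr fun r => ?_
  by_cases hr : 0 < r
  · have hn : ‖r • (ω : E)‖ = r := by rw [norm_smul, hω, Real.norm_of_nonneg hr.le, mul_one]
    have hq : (r • (ω : E) ∈ {x : E | ‖x‖ ∈ Set.Ioo 1 (1 + h)} ∩ {x | ‖x‖⁻¹ • x ∈ A}) ↔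
        r ∈ Set.Ioo 1 (1 + h) ∧ (ω : E) ∈ A := by
      simp only [Set.mem_inter_iff, Set.mem_ofPred_eq, hn]
      rw [smul_smul, inv_mul_cancel₀ hr.ne', one_smul]
    by_cases h1 : r ∈ Set.Ioo 1 (1 + h) <;> by_cases h2 : (ω : E) ∈ A <;>
      simp only [Set.indicator, Set.mem_Ioi, hr, hq, h1, h2, Set.mem_preimage, if_true, if_false,
        and_self, and_false, false_and, Pi.one_apply, one_mul, mul_one, mul_zero, zero_mul]
  · have : r ∉ Set.Ioo 1 (1 + h) := fun h' => hr (hsub h')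
    rw [Set.indicator_of_notMem (show r ∉ Set.Ioi 0 from hr), Set.indicator_of_notMem this, mul_zero]

/-- Near each of its points, the surface measure of the sphere and the Hausdorff measure are
comparable with a constant that is arbitrarily close to one. -/
theorem exists_ball_surface_comparable {p : E} (hp : ‖p‖ = 1) {t : ℝ≥0} (ht : 1 < t) :
    ∃ η > 0, ∀ A ⊆ Metric.ball p η, MeasurableSet A → A ⊆ Metric.sphere 0 1 →
      (Measure.euclideanHausdorffMeasure (Module.finrank ℝ E - 1) : Measure E) A ≤
        (t : ℝ≥0∞) ^ (2 * (Module.finrank ℝ E - 1) + 1) * unitSurface E A ∧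
      unitSurface E A ≤
        t * (Measure.euclideanHausdorffMeasure (Module.finrank ℝ E - 1) : Measure E) A := by
  set N := Module.finrank ℝ E - 1 with hN
  have ht0 : 0 < t := one_pos.trans ht
  have hdet : ENNReal.ofReal |(ContinuousLinearMap.id ℝ E).det| = 1 := by
    simp [ContinuousLinearMap.det]
  have e1 := addHaar_image_le_mul_of_det_lt (volume : Measure E) (ContinuousLinearMap.id ℝ E)
    (m := t) (by rw [hdet]; exact_mod_cast ht)
  have e2 := mul_le_addHaar_image_of_lt_det (volume : Measure E) (ContinuousLinearMap.id ℝ E)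
    (m := t⁻¹) (by rw [hdet]; exact_mod_cast inv_lt_one_of_one_lt₀ ht)
  -- With this bound the linear approximation gives |a - b| ≤ t |f a - f b| for the chart f.
  have e3 : ∀ᶠ δ in 𝓝[>] (0 : ℝ≥0), δ < 1 - t⁻¹ := by
    refine eventually_nhdsWithin_of_eventually_nhds (eventually_lt_nhds ?_)
    exact tsub_pos_of_lt (inv_lt_one_of_one_lt₀ ht)
  obtain ⟨δ, ⟨⟨⟨h1, h2⟩, h3⟩, hδ⟩⟩ := (((e1.and e2).and e3).and self_mem_nhdsWithin).exists
  obtain ⟨s, hs, hap⟩ := (hasStrictFDerivAt_sphereChart hp).approximates_deriv_on_nhds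
    (c := δ) (Or.inr hδ)
  obtain ⟨η, hη, hηs⟩ := Metric.mem_nhds_iff.1 hs
  replace hap := hap.mono_set hηs
  refine ⟨η / 2, by positivity, fun A hAb hAm hA1 => ?_⟩
  -- The first bound keeps the radial weight `r ^ N` below `t ^ N`; the second keeps the cone inside
  -- the ball where the linear approximation holds.
  set h : ℝ := min ((t : ℝ) - 1) (η / 2) with hh
  have hh0 : 0 < h := lt_min (sub_pos.2 (by exact_mod_cast ht)) (by positivity)
  set C := {x : E | ∃ a ∈ A, ∃ r ∈ Set.Ioo 1 (1 + h), x = r • a} with hC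
  set B := (fun a => a - inner ℝ p a • p) '' A with hB
  have hCs : C ⊆ Metric.ball p η := by
    rintro _ ⟨a, ha, r, hr, rfl⟩
    have ha' := mem_sphere_zero_iff_norm.1 (hA1 ha)
    have : dist (r • a) a < η / 2 := by
      rw [dist_eq_norm, show r • a - a = (r - 1) • a by rw [sub_smul, one_smul], norm_smul, ha',
        mul_one, Real.norm_of_nonneg (by linarith [hr.1])]
      linarith [hr.2, min_le_right ((t : ℝ) - 1) (η / 2)]
    have h4 : dist a p < η / 2 := hAb ha
    calc dist (r • a) p ≤ dist (r • a) a + dist a p := dist_triangle _ _ _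
      _ < η := by linarith
  have himg : sphereChart p '' C = {x : E | ∃ b ∈ B, ∃ r ∈ Set.Ioo 0 h, x = b + r • p} := by
    ext x
    constructor
    · rintro ⟨_, ⟨a, ha, r, hr, rfl⟩, rfl⟩
      exact ⟨_, ⟨a, ha, rfl⟩, r - 1, ⟨by linarith [hr.1], by linarith [hr.2]⟩,
        sphereChart_smul (mem_sphere_zero_iff_norm.1 (hA1 ha)) (by linarith [hr.1])⟩
    · rintro ⟨_, ⟨a, ha, rfl⟩, r, hr, rfl⟩
      refine ⟨(1 + r) • a, ⟨a, ha, 1 + r, ⟨by linarith [hr.1], by linarith [hr.2]⟩, rfl⟩, ?_⟩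
      rw [sphereChart_smul (mem_sphere_zero_iff_norm.1 (hA1 ha)) (by linarith [hr.1]),
        add_sub_cancel_left]
  have hvol := volume_cylinder hp (B := B) (by
    rintro _ ⟨a, ha, rfl⟩
    rw [inner_sub_right, inner_smul_right, real_inner_self_eq_norm_sq, hp]
    ring) h
  rw [← himg, ← hN] at hvol
  have hcone := volume_cone hAm hA1 (h := h)
  rw [← hC, ← hN] at hcone
  have hlow : ENNReal.ofReal h ≤ ∫⁻ r in Set.Ioo 1 (1 + h), ENNReal.ofReal (r ^ N) := by
    calc ENNReal.ofReal h = ∫⁻ r in Set.Ioo 1 (1 + h), 1 := by simp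
      _ ≤ _ := setLIntegral_mono' measurableSet_Ioo fun r hr => by
        rw [← ENNReal.ofReal_one]
        exact ENNReal.ofReal_le_ofReal (one_le_pow₀ hr.1.le)
  have hupp : ∫⁻ r in Set.Ioo 1 (1 + h), ENNReal.ofReal (r ^ N) ≤
      (t : ℝ≥0∞) ^ N * ENNReal.ofReal h := by
    calc _ ≤ ∫⁻ r in Set.Ioo 1 (1 + h), (t : ℝ≥0∞) ^ N :=
          setLIntegral_mono' measurableSet_Ioo fun r hr => by
            rw [ENNReal.ofReal_pow (by linarith [hr.1])]
            gcongr
            rw [← ENNReal.ofReal_coe_nnreal]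
            exact ENNReal.ofReal_le_ofReal
              (by linarith [hr.2, min_le_left ((t : ℝ) - 1) (η / 2)])
      _ = _ := by simp
  have hBle := euclideanHausdorffMeasure_image_sub_inner_smul_le hp N A
  -- On the sphere the chart is just the projection along `p`, so the linear approximation bounds
  -- its contraction.
  have hAle : (Measure.euclideanHausdorffMeasure N : Measure E) A ≤
      (t : ℝ≥0∞) ^ N * (Measure.euclideanHausdorffMeasure N : Measure E) B := by
    refine euclideanHausdorffMeasure_le_image (fun a ha b hb => ?_) N
    have ha1 := mem_sphere_zero_iff_norm.1 (hA1 ha)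
    have hb1 := mem_sphere_zero_iff_norm.1 (hA1 hb)
    have hball : Metric.ball p (η / 2) ⊆ Metric.ball p η := Metric.ball_subset_ball (by linarith)
    have key := hap a (hball (hAb ha)) b (hball (hAb hb))
    have ca := sphereChart_smul (p := p) ha1 one_pos
    have cb := sphereChart_smul (p := p) hb1 one_pos
    rw [one_smul, sub_self, zero_smul, add_zero] at ca cb
    rw [ca, cb, ContinuousLinearMap.id_apply] at key
    have h5 := norm_sub_norm_le (a - b) ((a - inner ℝ p a • p) - (b - inner ℝ p b • p))
    rw [norm_sub_rev (a - b)] at h5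
    have h6 : (δ : ℝ) ≤ 1 - (t : ℝ)⁻¹ := by
      have := h3.le
      rw [← NNReal.coe_le_coe, NNReal.coe_sub (inv_lt_one_of_one_lt₀ ht).le] at this
      simpa using this
    rw [dist_eq_norm, dist_eq_norm]
    have h7 : (t : ℝ)⁻¹ * ‖a - b‖ ≤ ‖(a - inner ℝ p a • p) - (b - inner ℝ p b • p)‖ := by
      nlinarith [norm_nonneg (a - b)]
    rwa [inv_mul_le_iff₀ (by exact_mod_cast ht0)] at h7
  have hh1 : ENNReal.ofReal h ≠ 0 := by simpa using hh0
  have hh2 : ENNReal.ofReal h ≠ ⊤ := ENNReal.ofReal_ne_top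
  constructor
  -- The exponent `2 * N + 1` collects `t ^ N` from the projection, `t` from the volume distortion
  -- of the chart and `t ^ N` from the radial weight.
  · rw [← ENNReal.mul_le_mul_iff_right hh1 hh2]
    calc ENNReal.ofReal h * (Measure.euclideanHausdorffMeasure N : Measure E) A
        ≤ ENNReal.ofReal h *
          ((t : ℝ≥0∞) ^ N * (Measure.euclideanHausdorffMeasure N : Measure E) B) := by gcongr
      _ = (t : ℝ≥0∞) ^ N * volume (sphereChart p '' C) := by rw [hvol]; ring
      _ ≤ (t : ℝ≥0∞) ^ N * (t * volume C) := by gcongr; exact h1 _ _ (hap.mono_set hCs)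
      _ ≤ (t : ℝ≥0∞) ^ N * (t * (unitSurface E A * ((t : ℝ≥0∞) ^ N * ENNReal.ofReal h))) := by
        rw [hcone]; gcongr
      _ = _ := by ring
  · rw [← ENNReal.mul_le_mul_iff_right hh1 hh2]
    have h8 : volume C ≤ t * volume (sphereChart p '' C) := by
      have := h2 _ _ (hap.mono_set hCs)
      calc volume C = t * ((t⁻¹ : ℝ≥0) * volume C) := by
            rw [← mul_assoc, ← ENNReal.coe_mul, mul_inv_cancel₀ ht0.ne', ENNReal.coe_one, one_mul]
        _ ≤ _ := by gcongr
    calc ENNReal.ofReal h * unitSurface E A ≤ volume C := by rw [hcone, mul_comm]; gcongr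
      _ ≤ t * (ENNReal.ofReal h * (Measure.euclideanHausdorffMeasure N : Measure E) B) := by
        rw [← hvol]; exact h8
      _ ≤ t * (ENNReal.ofReal h * (Measure.euclideanHausdorffMeasure N : Measure E) A) := by
        gcongr
      _ = _ := by ring

end SphereMeasure

/-- A local inequality between measures is global. -/
theorem measure_le_of_locally_le {X : Type*} [TopologicalSpace X] [SecondCountableTopology X]
    [MeasurableSpace X] [OpensMeasurableSpace X] {μ ν : Measure X}
    (h : ∀ x, ∃ U, IsOpen U ∧ x ∈ U ∧ ∀ A ⊆ U, MeasurableSet A → μ A ≤ ν A) : μ ≤ ν := by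
  choose U hUo hxU hU using h
  obtain ⟨T, hTc, hT⟩ := TopologicalSpace.isOpen_iUnion_countable U hUo
  have hcov : ⋃ i ∈ T, U i = Set.univ := by
    rw [hT]; exact Set.eq_univ_of_forall fun x => Set.mem_iUnion.2 ⟨x, hxU x⟩
  rcases isEmpty_or_nonempty X with hX | hX
  · exact le_of_eq (Subsingleton.elim _ _)
  have hTne : T.Nonempty := by
    by_contra hne
    rw [Set.not_nonempty_iff_eq_empty] at hne
    rw [hne] at hcov
    simp at hcov
    exact (Set.empty_ne_univ hcov).elim
  obtain ⟨f, rfl⟩ := hTc.exists_eq_range hTne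
  refine Measure.le_iff.2 fun A hA => ?_
  -- Making the countable subcover disjoint allows the local inequalities to be summed.
  set D := disjointed fun n => U (f n)
  have hDm : ∀ n, MeasurableSet (D n) := fun n =>
    MeasurableSet.disjointed (fun n => (hUo (f n)).measurableSet) n
  have hDu : ⋃ n, D n = Set.univ := by
    rw [iUnion_disjointed, ← hcov, Set.biUnion_range]
  have hA' : A = ⋃ n, A ∩ D n := by rw [← Set.inter_iUnion, hDu, Set.inter_univ]
  have hdis : Pairwise (Function.onFun Disjoint fun n => A ∩ D n) := fun i j hij =>
    (disjoint_disjointed (fun n => U (f n)) hij).mono Set.inter_subset_right Set.inter_subset_right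
  rw [hA', measure_iUnion hdis fun n => hA.inter (hDm n),
    measure_iUnion hdis fun n => hA.inter (hDm n)]
  exact ENNReal.tsum_le_tsum fun n => hU (f n) _
    (Set.inter_subset_right.trans (disjointed_subset _ n)) (hA.inter (hDm n))

section SphereMeasure

variable {E : Type*} [NormedAddCommGroup E] [InnerProductSpace ℝ E] [FiniteDimensional ℝ E]
  [MeasurableSpace E] [BorelSpace E]

variable [Nontrivial E]

/-- The surface measure of the unit sphere is its normalized Hausdorff measure. -/
theorem unitSurface_eq_restrict :
    unitSurface E = (Measure.euclideanHausdorffMeasure (Module.finrank ℝ E - 1) :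
      Measure E).restrict (Metric.sphere 0 1) := by
  set N := Module.finrank ℝ E - 1
  set H := (Measure.euclideanHausdorffMeasure N : Measure E).restrict (Metric.sphere 0 1)
  have hsm : MeasurableSet (Metric.sphere (0 : E) 1) := Metric.isClosed_sphere.measurableSet
  have hS : ∀ A, MeasurableSet A → unitSurface E A = unitSurface E (A ∩ Metric.sphere 0 1) := by
    intro A hA
    rw [unitSurface, Measure.map_apply measurable_subtype_coe hA,
      Measure.map_apply measurable_subtype_coe (hA.inter hsm)]
    congr 1
    ext ω
    simp
  have hloc : ∀ t : ℝ≥0, 1 < t → ∀ x : E, ∃ U, IsOpen U ∧ x ∈ U ∧ ∀ A ⊆ U, MeasurableSet A →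
      H A ≤ (t : ℝ≥0∞) ^ (2 * N + 1) * unitSurface E A ∧ unitSurface E A ≤ t * H A := by
    intro t ht x
    by_cases hx : x ∈ Metric.sphere (0 : E) 1
    · obtain ⟨η, hη, h⟩ := exists_ball_surface_comparable (mem_sphere_zero_iff_norm.1 hx) ht
      refine ⟨Metric.ball x η, Metric.isOpen_ball, Metric.mem_ball_self hη, fun A hAU hA => ?_⟩
      have := h (A ∩ Metric.sphere 0 1) (Set.inter_subset_left.trans hAU) (hA.inter hsm)
        Set.inter_subset_right
      rwa [← hS A hA, ← Measure.restrict_apply hA] at this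
    · refine ⟨(Metric.sphere (0 : E) 1)ᶜ, Metric.isClosed_sphere.isOpen_compl, hx,
        fun A hAU hA => ?_⟩
      have h0 : A ∩ Metric.sphere 0 1 = ∅ := (Set.disjoint_left.2 hAU).inter_eq
      rw [hS A hA, Measure.restrict_apply hA, h0]
      simp
  -- The local comparisons become global for each `t > 1`; letting `t` decrease to one gives
  -- equality.
  have hlim : Tendsto (fun t : ℝ≥0 => (t : ℝ≥0∞)) (𝓝[>] 1) (𝓝 1) := by
    have : Tendsto (fun t : ℝ≥0 => (t : ℝ≥0∞)) (𝓝 1) (𝓝 ((1 : ℝ≥0) : ℝ≥0∞)) :=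
      ENNReal.continuous_coe.tendsto 1
    exact this.mono_left nhdsWithin_le_nhds
  have h1 : ∀ t : ℝ≥0, 1 < t → unitSurface E ≤ (t : ℝ≥0∞) • H := fun t ht =>
    measure_le_of_locally_le fun x => by
      obtain ⟨U, hU, hx, h⟩ := hloc t ht x
      exact ⟨U, hU, hx, fun A hAU hA => by simpa using (h A hAU hA).2⟩
  have h2 : ∀ t : ℝ≥0, 1 < t → H ≤ ((t : ℝ≥0∞) ^ (2 * N + 1)) • unitSurface E := fun t ht =>
    measure_le_of_locally_le fun x => by
      obtain ⟨U, hU, hx, h⟩ := hloc t ht x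
      exact ⟨U, hU, hx, fun A hAU hA => by simpa using (h A hAU hA).1⟩
  refine le_antisymm (Measure.le_iff.2 fun A hA => ?_) (Measure.le_iff.2 fun A hA => ?_)
  · have ht : Tendsto (fun t : ℝ≥0 => (t : ℝ≥0∞) * H A) (𝓝[>] 1) (𝓝 (1 * H A)) :=
      ENNReal.Tendsto.mul_const hlim (Or.inl one_ne_zero)
    rw [one_mul] at ht
    exact ge_of_tendsto ht (eventually_nhdsWithin_of_forall fun t ht => h1 t ht A)
  · have ht : Tendsto (fun t : ℝ≥0 => (t : ℝ≥0∞) ^ (2 * N + 1) * unitSurface E A) (𝓝[>] 1)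
        (𝓝 (1 * unitSurface E A)) := by
      refine ENNReal.Tendsto.mul_const ?_ (Or.inl one_ne_zero)
      have := (ENNReal.continuous_pow (2 * N + 1)).tendsto 1 |>.comp hlim
      rwa [one_pow] at this
    rw [one_mul] at ht
    exact ge_of_tendsto ht (eventually_nhdsWithin_of_forall fun t ht => h2 t ht A)

end SphereMeasure

section Scaled

variable {E : Type*} [NormedAddCommGroup E] [InnerProductSpace ℝ E] [FiniteDimensional ℝ E]
  [MeasurableSpace E] [BorelSpace E] [Nontrivial E]

/-- The Hausdorff measure on the sphere of radius `R`. -/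
theorem euclideanHausdorffMeasure_restrict_sphere {R : ℝ} (hR : 0 < R) :
    (Measure.euclideanHausdorffMeasure (Module.finrank ℝ E - 1) : Measure E).restrict
      (Metric.sphere 0 R) =
    ENNReal.ofReal (R ^ (Module.finrank ℝ E - 1)) •
      (volume : Measure E).toSphere.map (fun ω : Metric.sphere (0 : E) 1 => R • (ω : E)) := by
  set N := Module.finrank ℝ E - 1
  ext A hA
  have hmap : (volume : Measure E).toSphere.map (fun ω : Metric.sphere (0 : E) 1 => R • (ω : E)) =
      (unitSurface E).map (fun x => R • x) := by
    rw [unitSurface, Measure.map_map (by fun_prop) (by fun_prop)]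
    rfl
  rw [Measure.restrict_apply hA, Measure.smul_apply, hmap, Measure.map_apply (by fun_prop) hA,
    unitSurface_eq_restrict,
    Measure.restrict_apply ((by fun_prop : Measurable fun x : E => R • x) hA)]
  have hset : A ∩ Metric.sphere 0 R = R • ((fun x : E => R • x) ⁻¹' A ∩ Metric.sphere 0 1) := by
    ext x
    rw [Set.mem_smul_set_iff_inv_smul_mem₀ hR.ne']
    simp only [Set.mem_inter_iff, Set.mem_preimage, mem_sphere_zero_iff_norm, norm_smul,
      smul_inv_smul₀ hR.ne', norm_inv, Real.norm_of_nonneg hR.le]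
    rw [inv_mul_eq_one₀ hR.ne', eq_comm (a := ‖x‖)]
  rw [hset, Measure.euclideanHausdorffMeasure_smul₀ N hR.ne', smul_eq_mul, ENNReal.smul_def,
    smul_eq_mul]
  congr 1
  rw [ENNReal.coe_pow, ← enorm_eq_nnnorm, Real.enorm_eq_ofReal hR.le, ENNReal.ofReal_pow hR.le]

end Scaled

/-! ### The measure theoretic boundary of a ball. -/

/-- A ball of half the radius occupies a fixed fraction of `r ^ d`, which bounds the upper density
from below. -/
theorem limsup_volume_div_pos {d : ℕ} {S : Set (Eu d)} {x : Eu d} {r₀ : ℝ} (hr₀ : 0 < r₀)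
    (h : ∀ r, 0 < r → r < r₀ → ∃ c, Metric.ball c (r / 2) ⊆ S ∩ Metric.closedBall x r) :
    0 < limsup (fun r : ℝ => volume (Metric.closedBall x r ∩ S) / ENNReal.ofReal (r ^ d))
      (𝓝[>] 0) := by
  have hv : 0 < volume (Metric.ball (0 : Eu d) (1 / 2)) :=
    Metric.measure_ball_pos _ _ (by norm_num)
  refine hv.trans_le ?_
  refine le_limsup_of_frequently_le (Eventually.frequently ?_)
  filter_upwards [Ioo_mem_nhdsGT hr₀] with r hr
  obtain ⟨c, hc⟩ := h r hr.1 hr.2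
  have hr0 := hr.1
  rw [ENNReal.le_div_iff_mul_le (Or.inl (by simpa using pow_pos hr0 d)) (Or.inl ENNReal.ofReal_ne_top)]
  calc volume (Metric.ball (0 : Eu d) (1 / 2)) * ENNReal.ofReal (r ^ d)
      = volume (Metric.ball c (r / 2)) := by
        rw [Measure.addHaar_ball_of_pos volume c (by positivity : 0 < r / 2),
          Measure.addHaar_ball_of_pos volume (0 : Eu d) (by norm_num : (0 : ℝ) < 1 / 2),
          finrank_euclideanSpace_fin, mul_right_comm, ← ENNReal.ofReal_mul (by positivity),
          ← mul_pow, show (1 / 2 * r : ℝ) = r / 2 by ring]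
    _ ≤ _ := measure_mono (hc.trans (Set.inter_comm _ _).subset)

theorem limsup_volume_div_eq_zero {d : ℕ} {S : Set (Eu d)} {x : Eu d} {r₀ : ℝ} (hr₀ : 0 < r₀)
    (h : Disjoint (Metric.closedBall x r₀) S) :
    limsup (fun r : ℝ => volume (Metric.closedBall x r ∩ S) / ENNReal.ofReal (r ^ d))
      (𝓝[>] 0) = 0 := by
  have : (fun r : ℝ => volume (Metric.closedBall x r ∩ S) / ENNReal.ofReal (r ^ d)) =ᶠ[𝓝[>] 0]
      fun _ => 0 := by
    filter_upwards [Ioo_mem_nhdsGT hr₀] with r hr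
    have h1 : Metric.closedBall x r ∩ S = ∅ :=
      (h.mono_left (Metric.closedBall_subset_closedBall hr.2.le)).inter_eq
    rw [h1, measure_empty, ENNReal.zero_div]
  rw [limsup_congr this, limsup_const]

/-- The measure theoretic boundary of a ball is the sphere. -/
theorem mtBoundary_closedBall {d : ℕ} {R : ℝ} (hR : 0 < R) :
    mtBoundary (Metric.closedBall (0 : Eu d) R) = Metric.sphere 0 R := by
  ext x
  rw [mem_sphere_zero_iff_norm]
  constructor
  · rintro ⟨h1, h2⟩
    rcases lt_trichotomy ‖x‖ R with h | h | h
    · exfalso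
      have : Disjoint (Metric.closedBall x (R - ‖x‖)) (Metric.closedBall (0 : Eu d) R)ᶜ := by
        rw [Set.disjoint_compl_right_iff_subset]
        exact Metric.closedBall_subset_closedBall' (by rw [dist_zero_right]; linarith)
      have h0 := limsup_volume_div_eq_zero (sub_pos.2 h) this
      simp only [Set.sdiff_eq] at h2
      exact h2.ne' h0
    · exact h
    · exfalso
      have : Disjoint (Metric.closedBall x ((‖x‖ - R) / 2)) (Metric.closedBall (0 : Eu d) R) := by
        refine Metric.closedBall_disjoint_closedBall ?_
        rw [dist_zero_right]
        linarith
      exact h1.ne' (limsup_volume_div_eq_zero (by linarith) this)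
  · intro hx
    have hx0 : x ≠ 0 := by rintro rfl; rw [norm_zero] at hx; exact hR.ne hx
    have key : ∀ s : ℝ, dist ((1 + s) • x) x = |s| * R := by
      intro s
      rw [dist_eq_norm, show (1 + s) • x - x = s • x by module, norm_smul, hx, Real.norm_eq_abs]
    constructor
    -- Moving `x` inwards by `r / 2` gives the centre of a ball of radius `r / 2` that touches the
    -- sphere from inside at `x`. The complement is treated by moving outwards.
    · refine limsup_volume_div_pos hR fun r hr hrR => ⟨(1 + -(r / (2 * R))) • x, ?_⟩
      have hs : r / (2 * R) < 1 := by rw [div_lt_one (by positivity)]; linarith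
      have hs0 : 0 < r / (2 * R) := by positivity
      have hs1 : r / (2 * R) * R = r / 2 := by field_simp
      refine Set.subset_inter ?_ ?_
      · refine Metric.ball_subset_closedBall.trans (Metric.closedBall_subset_closedBall' ?_)
        rw [dist_zero_right, norm_smul, hx, Real.norm_of_nonneg (by linarith)]
        nlinarith
      · refine Metric.ball_subset_closedBall.trans (Metric.closedBall_subset_closedBall' ?_)
        rw [key, abs_neg, abs_of_pos hs0, hs1]
        linarith
    · simp only [Set.sdiff_eq]
      refine limsup_volume_div_pos hR fun r hr hrR => ⟨(1 + r / (2 * R)) • x, ?_⟩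
      have hs0 : 0 < r / (2 * R) := by positivity
      have hs1 : r / (2 * R) * R = r / 2 := by field_simp
      refine Set.subset_inter ?_ ?_
      · intro y hy hy'
        rw [Metric.mem_ball, dist_eq_norm] at hy
        rw [mem_closedBall_zero_iff] at hy'
        have h3 : ‖(1 + r / (2 * R)) • x‖ = R + r / 2 := by
          rw [norm_smul, hx, Real.norm_of_nonneg (by linarith)]
          linarith
        have h4 := norm_sub_norm_le ((1 + r / (2 * R)) • x) y
        rw [norm_sub_rev] at h4
        linarith
      · refine Metric.ball_subset_closedBall.trans (Metric.closedBall_subset_closedBall' ?_)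
        rw [key, abs_of_pos hs0, hs1]
        linarith

/-! ### Exponential life times. -/

/-- The exponential law with rate `q`. -/
noncomputable def killingLaw (q : ℝ) : Measure ℝ :=
  (volume.restrict (Set.Ioi 0)).withDensity fun τ => ENNReal.ofReal (q * Real.exp (-q * τ))

theorem killingLaw_Ioi {q : ℝ} (hq : 0 < q) {x : ℝ} (hx : 0 ≤ x) :
    killingLaw q (Set.Ioi x) = ENNReal.ofReal (Real.exp (-q * x)) := by
  rw [killingLaw, withDensity_apply _ measurableSet_Ioi, Measure.restrict_restrict measurableSet_Ioi,
    Set.inter_eq_left.2 (Set.Ioi_subset_Ioi hx), ← ofReal_integral_eq_lintegral_ofReal]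
  · rw [integral_const_mul, integral_exp_mul_Ioi (by linarith)]
    congr 1
    field_simp
  · exact (integrableOn_exp_mul_Ioi (by linarith) x).const_mul q
  · exact Eventually.of_forall fun τ => by positivity

theorem killingLaw_Ici {q : ℝ} (hq : 0 < q) {x : ℝ} (hx : 0 ≤ x) :
    killingLaw q (Set.Ici x) = ENNReal.ofReal (Real.exp (-q * x)) := by
  rw [← killingLaw_Ioi hq hx]
  have : killingLaw q ≪ volume :=
    (withDensity_absolutelyContinuous _ _).trans Measure.restrict_le_self.absolutelyContinuous
  exact measure_congr (this.ae_eq Ioi_ae_eq_Ici).symm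

theorem isProbabilityMeasure_killingLaw {q : ℝ} (hq : 0 < q) :
    IsProbabilityMeasure (killingLaw q) := by
  constructor
  have h : killingLaw q Set.univ = killingLaw q (Set.Ioi 0) := by
    rw [killingLaw, withDensity_apply _ .univ, withDensity_apply _ measurableSet_Ioi,
      Measure.restrict_univ, Measure.restrict_restrict measurableSet_Ioi, Set.inter_self]
  rw [h, killingLaw_Ioi hq le_rfl]
  simp

/-! ### The energy balance along one ray. -/

/-- The one-dimensional data of a radial equilibrium: particles move on the rays from the sphere of
radius `ρ` to the sphere of radius `R`, with sources of net density `g` and an outgoing flux `a₀`,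
all per unit of solid angle. They are killed at the rate `q`. -/
structure RadialProfile (d : ℕ) where
  γ : ℝ
  R : ℝ
  ρ : ℝ
  a₀ : ℝ
  q : ℝ
  g : ℝ → ℝ
  two_le : 2 ≤ d
  γ_pos : 0 < γ
  R_pos : 0 < R
  R_lt : R < ρ
  q_pos : 0 < q
  g_meas : Measurable g
  g_int : ∀ a b, IntervalIntegrable g volume a b
  lt_flux : ∀ r ∈ Set.Icc R ρ, γ * r ^ (d - 1) < a₀ - ∫ z in R..r, g z
  source_nonneg : ∀ r ∈ Set.Icc R ρ, 0 ≤ g r + q * (a₀ - ∫ z in R..r, g z)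

namespace RadialProfile

variable {d : ℕ} (P : RadialProfile d)

/-- The flux through the sphere of radius `r`. -/
noncomputable def flux (r : ℝ) : ℝ := P.a₀ - ∫ z in P.R..r, P.g z

/-- The flux without the contribution of the surface tension. -/
noncomputable def den (r : ℝ) : ℝ := P.flux r - P.γ * r ^ (d - 1)

/-- The slope of the arrival time. -/
noncomputable def slope (r : ℝ) : ℝ := r ^ (d - 1) / P.den r

/-- The density of the starting positions. -/
noncomputable def source (r : ℝ) : ℝ := P.g r + P.q * P.flux r

/-- The arrival time at the radius `r`. -/
noncomputable def time (r : ℝ) : ℝ≥0∞ :=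
  ∫⁻ z in Set.Ioc P.R r, ENNReal.ofReal (z ^ (d - 1)) / ENNReal.ofReal (P.den z)

/-- The law of the starting radius. -/
noncomputable def startLaw : Measure ℝ :=
  (volume.restrict (Set.Ioc P.R P.ρ)).withDensity (fun s => ENNReal.ofReal (P.source s)) +
    ENNReal.ofReal (P.flux P.ρ) • Measure.dirac P.ρ

theorem ρ_pos : 0 < P.ρ := P.R_pos.trans P.R_lt

theorem continuous_flux : Continuous P.flux :=
  continuous_const.sub (intervalIntegral.continuous_primitive P.g_int _)

theorem continuous_den : Continuous P.den := by
  have := P.continuous_flux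
  unfold den
  fun_prop

theorem flux_R : P.flux P.R = P.a₀ := by simp [flux]

variable {P}

theorem den_pos {r : ℝ} (hr : r ∈ Set.Icc P.R P.ρ) : 0 < P.den r := sub_pos.2 (P.lt_flux r hr)

theorem pow_pos_of_mem {r : ℝ} (hr : r ∈ Set.Icc P.R P.ρ) : 0 < r ^ (d - 1) :=
  pow_pos (P.R_pos.trans_le hr.1) _

theorem flux_pos {r : ℝ} (hr : r ∈ Set.Icc P.R P.ρ) : 0 < P.flux r :=
  (mul_pos P.γ_pos (pow_pos_of_mem hr)).trans (P.lt_flux r hr)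

theorem slope_pos {r : ℝ} (hr : r ∈ Set.Icc P.R P.ρ) : 0 < P.slope r :=
  div_pos (pow_pos_of_mem hr) (den_pos hr)

/-- This is the pointwise fixed-point equation: `flux r / r ^ (d - 1)` is the spatial occupation
density, and `slope` is the value of L. -/
theorem slope_mul_flux {r : ℝ} (hr : r ∈ Set.Icc P.R P.ρ) :
    P.slope r * (P.flux r / r ^ (d - 1)) = 1 + P.γ * P.slope r := by
  have h1 := (den_pos hr).ne'
  have h2 := (pow_pos_of_mem hr).ne'
  rw [slope]
  field_simp
  rw [den]
  ring

variable (P)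

theorem continuousOn_slope : ContinuousOn P.slope (Set.Icc P.R P.ρ) :=
  (continuous_pow _).continuousOn.div P.continuous_den.continuousOn fun _ hr => (den_pos hr).ne'

theorem measurable_flux : Measurable P.flux := P.continuous_flux.measurable

theorem measurable_den : Measurable P.den := P.continuous_den.measurable

theorem measurable_source : Measurable P.source := by
  have := P.g_meas
  have := P.measurable_flux
  unfold source
  fun_prop

theorem time_mono : Monotone P.time := fun _ _ h =>
  lintegral_mono_set (Set.Ioc_subset_Ioc_right h)

theorem time_of_le {r : ℝ} (hr : r ≤ P.R) : P.time r = 0 := by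
  simp [time, Set.Ioc_eq_empty_of_le hr]

theorem time_eq_slope {r : ℝ} (hr : r ≤ P.ρ) :
    P.time r = ∫⁻ z in Set.Ioc P.R r, ENNReal.ofReal (P.slope z) := by
  refine setLIntegral_congr_fun measurableSet_Ioc fun z hz => ?_
  have hz' : z ∈ Set.Icc P.R P.ρ := ⟨hz.1.le, hz.2.trans hr⟩
  rw [slope, ENNReal.ofReal_div_of_pos (den_pos hz')]

/-- The slope is bounded on `[R, ρ]`. -/
theorem exists_slope_le : ∃ C > 0, ∀ r ∈ Set.Icc P.R P.ρ, P.slope r ≤ C := by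
  obtain ⟨x, hx, h⟩ := isCompact_Icc.exists_isMaxOn ⟨P.R, Set.left_mem_Icc.2 P.R_lt.le⟩
    P.continuousOn_slope
  exact ⟨P.slope x, slope_pos hx, fun r hr => h hr⟩

/-- A bounded slope makes the arrival time Lipschitz; finiteness up to `ρ` and left continuity both
come from this. -/
theorem time_le_add {C : ℝ} (hC : ∀ r ∈ Set.Icc P.R P.ρ, P.slope r ≤ C) {r r' : ℝ} (hr : r ≤ r')
    (hr' : r' ≤ P.ρ) : P.time r' ≤ P.time r + ENNReal.ofReal C * ENNReal.ofReal (r' - r) := by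
  rw [P.time_eq_slope hr', P.time_eq_slope (hr.trans hr')]
  calc ∫⁻ z in Set.Ioc P.R r', ENNReal.ofReal (P.slope z)
      ≤ ∫⁻ z in Set.Ioc P.R r ∪ (Set.Ioc r r' ∩ Set.Ioc P.R r'), ENNReal.ofReal (P.slope z) := by
        refine lintegral_mono_set fun z hz => ?_
        rcases le_or_gt z r with h | h
        · exact Or.inl ⟨hz.1, h⟩
        · exact Or.inr ⟨⟨h, hz.2⟩, hz⟩
    _ ≤ _ := lintegral_union_le _ _ _
    _ ≤ _ := by
      gcongr
      calc ∫⁻ z in Set.Ioc r r' ∩ Set.Ioc P.R r', ENNReal.ofReal (P.slope z)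
          ≤ ∫⁻ z in Set.Ioc r r' ∩ Set.Ioc P.R r', ENNReal.ofReal C :=
            setLIntegral_mono' (measurableSet_Ioc.inter measurableSet_Ioc) fun z hz =>
              ENNReal.ofReal_le_ofReal (hC z ⟨hz.2.1.le, hz.2.2.trans hr'⟩)
        _ ≤ ENNReal.ofReal C * ENNReal.ofReal (r' - r) := by
          rw [setLIntegral_const]
          gcongr
          exact (measure_mono Set.inter_subset_left).trans (by simp)

theorem time_lt_top {r : ℝ} (hr : r ≤ P.ρ) : P.time r < ⊤ := by
  obtain ⟨C, -, hC⟩ := P.exists_slope_le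
  refine (P.time_mono hr).trans_lt ?_
  refine (P.time_le_add hC P.R_lt.le le_rfl).trans_lt ?_
  rw [P.time_of_le le_rfl, zero_add]
  exact ENNReal.mul_lt_top ENNReal.ofReal_lt_top ENNReal.ofReal_lt_top

/-- Left continuity of the arrival time. -/
theorem time_le_of_forall_lt {r : ℝ} (hR : P.R < r) (hr : r ≤ P.ρ) {t : ℝ≥0∞}
    (h : ∀ r', P.R < r' → r' < r → P.time r' ≤ t) : P.time r ≤ t := by
  obtain ⟨C, -, hC⟩ := P.exists_slope_le
  have hlim : Tendsto (fun r' : ℝ => t + ENNReal.ofReal C * ENNReal.ofReal (r - r')) (𝓝[<] r)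
      (𝓝 (t + ENNReal.ofReal C * ENNReal.ofReal (r - r))) := by
    refine Tendsto.mono_left (Continuous.tendsto ?_ r) nhdsWithin_le_nhds
    refine continuous_const.add (ENNReal.continuous_const_mul ENNReal.ofReal_ne_top |>.comp ?_)
    exact ENNReal.continuous_ofReal.comp (by fun_prop)
  rw [sub_self, ENNReal.ofReal_zero, mul_zero, add_zero] at hlim
  refine ge_of_tendsto hlim ?_
  filter_upwards [Ioo_mem_nhdsLT hR] with r' hr'
  exact (P.time_le_add hC hr'.2.le hr).trans (by gcongr; exact h r' hr'.1 hr'.2)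

/-- The balance of the sources and the killing along a ray. -/
theorem integral_source {r : ℝ} (hr : r ∈ Set.Icc P.R P.ρ) :
    ∫ s in r..P.ρ, P.source s * Real.exp (-P.q * s) =
      P.flux r * Real.exp (-P.q * r) - P.flux P.ρ * Real.exp (-P.q * P.ρ) := by
  have hsub : Set.uIcc r P.ρ ⊆ Set.uIcc P.R P.ρ := by
    rw [Set.uIcc_of_le hr.2, Set.uIcc_of_le P.R_lt.le]
    exact Set.Icc_subset_Icc_left hr.1
  -- The derivative of flux(s) e^{-qs} is -source(s) e^{-qs}. As `g` is merely integrable, this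
  -- holds almost everywhere, and absolute continuity is needed to integrate it.
  have hf : AbsolutelyContinuousOnInterval P.flux r P.ρ := by
    have h1 : AbsolutelyContinuousOnInterval (fun _ : ℝ => P.a₀) P.R P.ρ :=
      ((LipschitzWith.const P.a₀).lipschitzOnWith).absolutelyContinuousOnInterval
    have h2 := (P.g_int P.R P.ρ).absolutelyContinuousOnInterval_intervalIntegral
      (c := P.R) (by simp)
    exact (h1.sub h2).mono hsub
  have hcd : ContDiff ℝ 1 fun s : ℝ => Real.exp (-P.q * s) := by fun_prop
  have hg : AbsolutelyContinuousOnInterval (fun s => Real.exp (-P.q * s)) r P.ρ :=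
    hcd.contDiffOn.absolutelyContinuousOnInterval
  have key := hf.integral_deriv_mul_eq_sub hg
  have hder : ∀ᵐ s, s ∈ Set.uIoc r P.ρ →
      deriv P.flux s * Real.exp (-P.q * s) + P.flux s * deriv (fun s => Real.exp (-P.q * s)) s =
        -(P.source s * Real.exp (-P.q * s)) := by
    filter_upwards [(P.g_int P.R P.ρ).ae_hasDerivAt_integral] with s hs hsm
    have h3 : HasDerivAt P.flux (-P.g s) s := by
      have := (hs (hsub (Set.uIoc_subset_uIcc hsm)) P.R (by simp)).const_sub P.a₀
      exact this
    have h4 : HasDerivAt (fun s => Real.exp (-P.q * s)) (Real.exp (-P.q * s) * (-P.q * 1)) s :=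
      ((hasDerivAt_id s).const_mul (-P.q)).exp
    rw [h3.deriv, h4.deriv, source]
    ring
  rw [intervalIntegral.integral_congr_ae hder, intervalIntegral.integral_neg] at key
  linarith

/-- A particle started at `s ≥ r` reaches radius `r` alive with probability e^{-q(s-r)}, so the left
side counts the particles passing `r`. The absolutely continuous part of `startLaw` yields the
balance of `integral_source`, and the atom at `ρ` supplies exactly the missing outer boundary term.
-/
theorem lintegral_startLaw_exp {r : ℝ} (hr : r ∈ Set.Icc P.R P.ρ) :
    ∫⁻ s in Set.Ici r, ENNReal.ofReal (Real.exp (-P.q * (s - r))) ∂P.startLaw =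
      ENNReal.ofReal (P.flux r) := by
  have hm : Measurable fun s : ℝ => ENNReal.ofReal (Real.exp (-P.q * (s - r))) := by fun_prop
  rw [startLaw, Measure.restrict_add, lintegral_add_measure, restrict_withDensity measurableSet_Ici,
    Measure.restrict_restrict measurableSet_Ici, Measure.restrict_smul, lintegral_smul_measure,
    restrict_dirac' measurableSet_Ici, if_pos (show P.ρ ∈ Set.Ici r from hr.2), lintegral_dirac' _ hm,
    lintegral_withDensity_eq_lintegral_mul _ (by have := P.measurable_source; fun_prop) hm]
  have hae : (Set.Ici r ∩ Set.Ioc P.R P.ρ : Set ℝ) =ᵐ[volume] Set.Ioc r P.ρ := by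
    have h1 : (Set.Ici r ∩ Set.Ioc P.R P.ρ : Set ℝ) =ᵐ[volume]
      (Set.Ioi r ∩ Set.Ioc P.R P.ρ : Set ℝ) := Ioi_ae_eq_Ici.symm.inter (ae_eq_refl _)
    have h2 : Set.Ioi r ∩ Set.Ioc P.R P.ρ = Set.Ioc r P.ρ := by
      ext s
      simp only [Set.mem_inter_iff, Set.mem_Ioi, Set.mem_Ioc]
      exact ⟨fun h => ⟨h.1, h.2.2⟩, fun h => ⟨h.1, hr.1.trans_lt h.1, h.2⟩⟩
    rwa [h2] at h1
  rw [Measure.restrict_congr_set hae]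
  have hint : IntervalIntegrable (fun s => P.source s * Real.exp (-P.q * s)) volume r P.ρ := by
    refine IntervalIntegrable.mul_continuousOn ?_ (by fun_prop)
    exact (P.g_int r P.ρ).add ((P.continuous_flux.intervalIntegrable r P.ρ).const_mul P.q)
  have hint2 : IntegrableOn (fun s => P.source s * Real.exp (-P.q * (s - r)))
      (Set.Ioc r P.ρ) := by
    have h := ((intervalIntegrable_iff_integrableOn_Ioc_of_le hr.2).1 hint).mul_const
      (Real.exp (P.q * r))
    refine h.congr (Eventually.of_forall fun s => ?_)
    beta_reduce
    rw [mul_assoc, ← Real.exp_add]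
    ring_nf
  have hpos : 0 ≤ᵐ[volume.restrict (Set.Ioc r P.ρ)]
      fun s => P.source s * Real.exp (-P.q * (s - r)) := by
    filter_upwards [ae_restrict_mem measurableSet_Ioc] with s hs
    exact mul_nonneg (P.source_nonneg s ⟨hr.1.trans hs.1.le, hs.2⟩) (Real.exp_pos _).le
  have hcongr : ∫⁻ s in Set.Ioc r P.ρ, ((fun s => ENNReal.ofReal (P.source s)) *
      fun s => ENNReal.ofReal (Real.exp (-P.q * (s - r)))) s =
      ∫⁻ s in Set.Ioc r P.ρ, ENNReal.ofReal (P.source s * Real.exp (-P.q * (s - r))) := by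
    refine lintegral_congr fun s => ?_
    rw [Pi.mul_apply, ENNReal.ofReal_mul' (Real.exp_pos _).le]
  rw [hcongr, ← ofReal_integral_eq_lintegral_ofReal hint2 hpos, smul_eq_mul,
    ← ENNReal.ofReal_mul (flux_pos (Set.right_mem_Icc.2 P.R_lt.le)).le,
    ← ENNReal.ofReal_add (integral_nonneg_of_ae hpos)
      (mul_nonneg (flux_pos (Set.right_mem_Icc.2 P.R_lt.le)).le (Real.exp_pos _).le)]
  congr 1
  have hI : ∫ s in Set.Ioc r P.ρ, P.source s * Real.exp (-P.q * (s - r)) =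
      (∫ s in r..P.ρ, P.source s * Real.exp (-P.q * s)) * Real.exp (P.q * r) := by
    rw [intervalIntegral.integral_of_le hr.2, ← integral_mul_const]
    refine integral_congr_ae (Eventually.of_forall fun s => ?_)
    beta_reduce
    rw [mul_assoc, ← Real.exp_add]
    ring_nf
  rw [hI, P.integral_source hr, sub_mul, mul_assoc, mul_assoc, ← Real.exp_add, ← Real.exp_add,
    show -P.q * r + P.q * r = 0 by ring, Real.exp_zero,
    show -P.q * P.ρ + P.q * r = -P.q * (P.ρ - r) by ring]
  ring

theorem startLaw_compl : P.startLaw (Set.Ioc P.R P.ρ)ᶜ = 0 := by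
  have hm : MeasurableSet (Set.Ioc P.R P.ρ)ᶜ := measurableSet_Ioc.compl
  rw [startLaw, Measure.add_apply, withDensity_apply _ hm, Measure.restrict_restrict hm,
    Set.compl_inter_self, Measure.restrict_empty, lintegral_zero_measure, Measure.smul_apply,
    Measure.dirac_apply' _ hm, Set.indicator_of_notMem (by simp [P.R_lt])]
  simp

theorem ae_startLaw : ∀ᵐ s ∂P.startLaw, s ∈ Set.Ioc P.R P.ρ :=
  mem_ae_iff.2 P.startLaw_compl

instance : IsFiniteMeasure P.startLaw := by
  constructor
  have hint : IntegrableOn P.source (Set.Ioc P.R P.ρ) :=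
    ((P.g_int P.R P.ρ).add
      ((P.continuous_flux.intervalIntegrable P.R P.ρ).const_mul P.q)).1
  rw [startLaw, Measure.add_apply, withDensity_apply _ .univ, Measure.restrict_univ,
    Measure.smul_apply, measure_univ, smul_eq_mul, mul_one]
  exact ENNReal.add_lt_top.2 ⟨hint.lintegral_lt_top, ENNReal.ofReal_lt_top⟩

theorem startLaw_univ_pos : 0 < P.startLaw Set.univ := by
  rw [startLaw, Measure.add_apply, Measure.smul_apply, measure_univ (μ := Measure.dirac P.ρ),
    smul_eq_mul, mul_one]
  exact (ENNReal.ofReal_pos.2 (flux_pos (Set.right_mem_Icc.2 P.R_lt.le))).trans_le le_add_self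

/-- The occupation measure of a particle on a ray that is killed at the rate `q`. -/
theorem lintegral_startLaw_occupation {f : ℝ → ℝ≥0∞} (hf : Measurable f) :
    ∫⁻ s, (∫⁻ r in Set.Ioc P.R s, ENNReal.ofReal (Real.exp (-P.q * (s - r))) * f r) ∂P.startLaw =
      ∫⁻ r in Set.Ioc P.R P.ρ, ENNReal.ofReal (P.flux r) * f r := by
  -- With the constraint `r ≤ s` written as an indicator, Tonelli exchanges radius and starting
  -- point, and the inner integral is the flux.
  have h1 : ∀ s, ∫⁻ r in Set.Ioc P.R s, ENNReal.ofReal (Real.exp (-P.q * (s - r))) * f r =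
      ∫⁻ r in Set.Ioi P.R, (Set.Ici r).indicator
        (fun s => ENNReal.ofReal (Real.exp (-P.q * (s - r)))) s * f r := by
    intro s
    rw [← lintegral_indicator measurableSet_Ioc, ← lintegral_indicator measurableSet_Ioi]
    refine lintegral_congr fun r => ?_
    by_cases hr : P.R < r <;> by_cases hs : r ≤ s <;> simp [Set.indicator, hr, hs]
  have hmeas : Measurable (Function.uncurry fun s r : ℝ => (Set.Ici r).indicator
        (fun s => ENNReal.ofReal (Real.exp (-P.q * (s - r)))) s * f r) := by
    have h2 : (Function.uncurry fun s r : ℝ => (Set.Ici r).indicator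
        (fun s => ENNReal.ofReal (Real.exp (-P.q * (s - r)))) s * f r) =
        {p : ℝ × ℝ | p.2 ≤ p.1}.indicator
          (fun p => ENNReal.ofReal (Real.exp (-P.q * (p.1 - p.2))) * f p.2) := by
      ext ⟨s, r⟩
      by_cases hs : r ≤ s <;> simp [Function.uncurry, Set.indicator, hs]
    rw [h2]
    exact Measurable.indicator (by fun_prop) (measurableSet_le measurable_snd measurable_fst)
  simp_rw [h1]
  rw [lintegral_lintegral_swap hmeas.aemeasurable, ← lintegral_indicator measurableSet_Ioi,
    ← lintegral_indicator measurableSet_Ioc]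
  refine lintegral_congr fun r => ?_
  by_cases hR : P.R < r
  · have h3 : ∫⁻ s, (Set.Ici r).indicator
        (fun s => ENNReal.ofReal (Real.exp (-P.q * (s - r)))) s * f r ∂P.startLaw =
        (∫⁻ s in Set.Ici r, ENNReal.ofReal (Real.exp (-P.q * (s - r))) ∂P.startLaw) * f r := by
      rw [lintegral_mul_const _ (Measurable.indicator (by fun_prop) measurableSet_Ici),
        lintegral_indicator measurableSet_Ici]
    rw [Set.indicator_of_mem (show r ∈ Set.Ioi P.R from hR), h3]
    by_cases hρ : r ≤ P.ρ
    · rw [P.lintegral_startLaw_exp ⟨hR.le, hρ⟩,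
        Set.indicator_of_mem (show r ∈ Set.Ioc P.R P.ρ from ⟨hR, hρ⟩)]
    · have hsub : Set.Ici r ⊆ (Set.Ioc P.R P.ρ)ᶜ := fun s (hs : r ≤ s) hs' => hρ (hs.trans hs'.2)
      have h0 : P.startLaw (Set.Ici r) = 0 := measure_mono_null hsub P.startLaw_compl
      have h4 : ∫⁻ s in Set.Ici r, ENNReal.ofReal (Real.exp (-P.q * (s - r))) ∂P.startLaw = 0 :=
        setLIntegral_measure_zero _ _ h0
      have h5 : r ∉ Set.Ioc P.R P.ρ := fun h => hρ h.2
      rw [h4, zero_mul, Set.indicator_of_notMem h5]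
  · rw [Set.indicator_of_notMem (show r ∉ Set.Ioi P.R from hR),
      Set.indicator_of_notMem (show r ∉ Set.Ioc P.R P.ρ from fun h => hR h.1)]

end RadialProfile

/-! ### Continuity on the path space, and the radial paths. -/

namespace StoppedPath

variable {d : ℕ} {Γ : Set (Eu d)}

theorem dist_eq_toBCF (y z : StoppedPath Γ) :
    dist y z = dist y.toBCF z.toBCF + |(y.hit : ℝ) - z.hit| := by
  change dist y.toProd z.toProd = _
  rw [WithLp.prod_dist_eq_of_L1]
  rfl

theorem dist_pos_le_dist (y z : StoppedPath Γ) (t : ℝ≥0) : dist (y.pos t) (z.pos t) ≤ dist y z := by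
  rw [dist_eq_toBCF]
  have h1 := BoundedContinuousFunction.dist_coe_le_dist (f := y.toBCF) (g := z.toBCF) t
  have h2 := abs_nonneg ((y.hit : ℝ) - z.hit)
  exact h1.trans (by linarith)

theorem continuous_pos : Continuous fun p : StoppedPath Γ × ℝ≥0 => p.1.pos p.2 := by
  have h : LipschitzWith 2 fun p : StoppedPath Γ × ℝ≥0 => p.1.pos p.2 := by
    refine LipschitzWith.of_dist_le_mul fun p p' => ?_
    have h1 : dist (p.1.pos p.2) (p.1.pos p'.2) ≤ dist p.2 p'.2 := by
      simpa using p.1.lipschitz.dist_le_mul p.2 p'.2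
    have h2 := dist_pos_le_dist p.1 p'.1 p'.2
    have h3 : dist p.1 p'.1 ≤ dist p p' := le_max_left _ _
    have h4 : dist p.2 p'.2 ≤ dist p p' := le_max_right _ _
    have h5 := dist_triangle (p.1.pos p.2) (p.1.pos p'.2) (p'.1.pos p'.2)
    rw [NNReal.coe_ofNat]
    linarith
  exact h.continuous

theorem continuous_hit : Continuous (hit : StoppedPath Γ → ℝ≥0) := by
  have h : LipschitzWith 1 (hit : StoppedPath Γ → ℝ≥0) := by
    refine LipschitzWith.of_dist_le_mul fun y z => ?_
    rw [dist_eq_toBCF, NNReal.coe_one, one_mul, NNReal.dist_eq]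
    linarith [dist_nonneg (x := y.toBCF) (y := z.toBCF)]
  exact h.continuous

theorem pos_hit_mem (y : StoppedPath Γ) : y.pos y.hit ∈ closure Γ := by
  have hc : IsClosed {s | y.pos s ∈ closure Γ} :=
    isClosed_closure.preimage y.lipschitz.continuous
  exact hc.csInf_mem y.hits (OrderBot.bddBelow _)

section Radial

variable {R : ℝ}

theorem radial_mem_iff (hR : 0 ≤ R) (ω : Metric.sphere (0 : Eu d) 1) (s : ℝ) :
    {t : ℝ≥0 | max (s - t) R • (ω : Eu d) ∈ closure (Metric.closedBall (0 : Eu d) R)} =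
      Set.Ici (s - R).toNNReal := by
  ext t
  rw [Set.mem_ofPred_eq, Metric.isClosed_closedBall.closure_eq, mem_closedBall_zero_iff, norm_smul,
    mem_sphere_zero_iff_norm.1 ω.2, mul_one, Real.norm_of_nonneg (hR.trans (le_max_right _ _)),
    Set.mem_Ici, Real.toNNReal_le_iff_le_coe, max_le_iff]
  constructor
  · rintro ⟨h, -⟩; linarith
  · intro h; exact ⟨by linarith, le_rfl⟩

theorem norm_radial_sub_le (ω ω' : Metric.sphere (0 : Eu d) 1) (s s' : ℝ) (hR : 0 ≤ R) :
    ‖max s R • (ω : Eu d) - max s' R • (ω' : Eu d)‖ ≤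
      |s - s'| + max s' R * ‖(ω : Eu d) - ω'‖ := by
  have h : max s R • (ω : Eu d) - max s' R • (ω' : Eu d) =
      (max s R - max s' R) • (ω : Eu d) + max s' R • ((ω : Eu d) - ω') := by module
  rw [h]
  refine (norm_add_le _ _).trans ?_
  rw [norm_smul, norm_smul, mem_sphere_zero_iff_norm.1 ω.2, mul_one,
    Real.norm_of_nonneg (hR.trans (le_max_right s' R)), Real.norm_eq_abs]
  exact add_le_add (abs_max_sub_max_le_abs s s' R) le_rfl

/-- The path that moves with unit speed from `s • ω` to the ball of radius `R`. -/
noncomputable def radial (hR : 0 ≤ R) (ω : Metric.sphere (0 : Eu d) 1) (s : ℝ) :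
    StoppedPath (Metric.closedBall (0 : Eu d) R) where
  pos t := max (s - t) R • (ω : Eu d)
  lipschitz := LipschitzWith.of_dist_le_mul fun t t' => by
    have := norm_radial_sub_le ω ω (s - t) (s - t') hR
    rw [dist_eq_norm, NNReal.coe_one, one_mul, NNReal.dist_eq, abs_sub_comm]
    simpa using this
  hits := ⟨(s - R).toNNReal, by
    have := radial_mem_iff hR ω s
    exact (Set.ext_iff.1 this _).2 Set.self_mem_Ici⟩
  stops := by
    rw [radial_mem_iff hR ω s, csInf_Ici]
    intro t ht
    rw [Real.toNNReal_le_iff_le_coe] at ht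
    rw [max_eq_right (by linarith), max_eq_right]
    have := Real.le_coe_toNNReal (s - R)
    linarith

theorem radial_pos (hR : 0 ≤ R) (ω : Metric.sphere (0 : Eu d) 1) (s : ℝ) (t : ℝ≥0) :
    (radial hR ω s).pos t = max (s - t) R • (ω : Eu d) := rfl

theorem radial_hit (hR : 0 ≤ R) (ω : Metric.sphere (0 : Eu d) 1) (s : ℝ) :
    (radial hR ω s).hit = (s - R).toNNReal := by
  have := radial_mem_iff hR ω s
  rw [hit]
  exact (congrArg sInf this).trans csInf_Ici

/-- Hitting times are part of the metric, so they must be controlled too. Continuity yields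
measurability of the particle map and compactness of the set of radial paths. -/
theorem continuous_radial (hR : 0 ≤ R) :
    Continuous fun p : Metric.sphere (0 : Eu d) 1 × ℝ => radial hR p.1 p.2 := by
  refine continuous_iff_continuousAt.2 fun p' => ?_
  rw [ContinuousAt, tendsto_iff_dist_tendsto_zero]
  have hle : ∀ p : Metric.sphere (0 : Eu d) 1 × ℝ, dist (radial hR p.1 p.2) (radial hR p'.1 p'.2) ≤
      (|p.2 - p'.2| + max p'.2 R * ‖(p.1 : Eu d) - p'.1‖) + |p.2 - p'.2| := by
    intro p
    rw [dist_eq]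
    refine add_le_add (ciSup_le fun t => ?_) ?_
    · rw [dist_eq_norm, radial_pos, radial_pos]
      refine (norm_radial_sub_le _ _ _ _ hR).trans ?_
      rw [sub_sub_sub_cancel_right]
      gcongr
      simp
    · rw [radial_hit, radial_hit, Real.coe_toNNReal', Real.coe_toNNReal']
      refine (abs_max_sub_max_le_abs _ _ _).trans ?_
      rw [sub_sub_sub_cancel_right]
  have hlim : Tendsto (fun p : Metric.sphere (0 : Eu d) 1 × ℝ =>
      (|p.2 - p'.2| + max p'.2 R * ‖(p.1 : Eu d) - p'.1‖) + |p.2 - p'.2|) (𝓝 p') (𝓝 0) := by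
    have hc : Continuous (fun p : Metric.sphere (0 : Eu d) 1 × ℝ =>
      (|p.2 - p'.2| + max p'.2 R * ‖(p.1 : Eu d) - p'.1‖) + |p.2 - p'.2|) := by fun_prop
    have := hc.tendsto p'
    simpa using this
  exact squeeze_zero (fun _ => dist_nonneg) hle hlim

end Radial

end StoppedPath

/-! ### Optimality of the radial paths. -/

/-- The Lebesgue measure dominates the image of a set under a `1`-Lipschitz real function. -/
theorem volume_image_le_of_lipschitzOnWith {f : ℝ → ℝ} {S : Set ℝ} (hf : LipschitzOnWith 1 f S) :
    volume (f '' S) ≤ volume S := by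
  have := hf.hausdorffMeasure_image_le (d := 1) zero_le_one
  simpa [hausdorffMeasure_real] using this

/-- A `1`-Lipschitz function spends at every level at least the time that is needed to cross it
with unit speed. -/
theorem lintegral_le_lintegral_comp_of_lipschitz {f : ℝ → ℝ} (hf : LipschitzWith 1 f) {a b T : ℝ}
    (hT : 0 ≤ T) (h0 : b ≤ f 0) (h1 : f T ≤ a) {h : ℝ → ℝ≥0∞} (hh : Measurable h) :
    ∫⁻ r in Set.Ioc a b, h r ≤ ∫⁻ t in Set.Icc 0 T, h (f t) := by
  have hfm := hf.continuous.measurable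
  rw [← lintegral_map hh hfm]
  -- It suffices that the occupation measure of `f` dominates Lebesgue measure on `(a, b]`. Every
  -- level there is attained by the intermediate value theorem, and `f` does not increase the
  -- measure of the times spent in a set of levels.
  refine lintegral_mono' (Measure.le_iff.2 fun B hB => ?_) le_rfl
  rw [Measure.restrict_apply hB, Measure.map_apply hfm hB, Measure.restrict_apply (hfm hB)]
  refine (measure_mono fun r hr => ?_).trans
    (volume_image_le_of_lipschitzOnWith (f := f) hf.lipschitzOnWith)
  have : r ∈ f '' Set.Icc 0 T :=
    intermediate_value_Icc' hT hf.continuous.continuousOn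
      ⟨h1.trans hr.2.1.le, hr.2.2.trans h0⟩
  obtain ⟨t, ht, rfl⟩ := this
  exact ⟨t, ⟨hr.1, ht⟩, rfl⟩

namespace RadialProfile

variable {d : ℕ} (P : RadialProfile d)

/-- The function `L` of the radial equilibrium. -/
noncomputable def level (x : Eu d) : ℝ :=
  if P.R ≤ ‖x‖ ∧ ‖x‖ ≤ P.ρ then P.slope ‖x‖ else -1 / P.γ

theorem level_of_mem {x : Eu d} (h : ‖x‖ ∈ Set.Icc P.R P.ρ) : P.level x = P.slope ‖x‖ :=
  if_pos h

theorem level_of_notMem {x : Eu d} (h : ‖x‖ ∉ Set.Icc P.R P.ρ) : P.level x = -1 / P.γ :=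
  if_neg h

theorem level_ne_zero (x : Eu d) : P.level x ≠ 0 := by
  by_cases h : ‖x‖ ∈ Set.Icc P.R P.ρ
  · rw [P.level_of_mem h]; exact (slope_pos h).ne'
  · rw [P.level_of_notMem h]
    exact div_ne_zero (by norm_num) P.γ_pos.ne'

theorem neg_one_div_γ_neg : -1 / P.γ < 0 := div_neg_of_neg_of_pos (by norm_num) P.γ_pos

/-- The positive values are taken on the closed shell and the constant outside is negative, so the
only jumps are upwards onto the shell. -/
theorem upperSemicontinuous_level : UpperSemicontinuous (P.level : Eu d → ℝ) := by
  intro x y hy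
  by_cases h : ‖x‖ ∈ Set.Icc P.R P.ρ
  · rw [P.level_of_mem h] at hy
    have h1 : ContinuousWithinAt P.slope (Set.Icc P.R P.ρ) ‖x‖ := P.continuousOn_slope _ h
    have h2 : ∀ᶠ x' : Eu d in 𝓝 x, ‖x'‖ ∈ Set.Icc P.R P.ρ → P.slope ‖x'‖ < y :=
      (continuous_norm.tendsto x).eventually
        (eventually_nhdsWithin_iff.1 (h1.eventually_lt_const hy))
    filter_upwards [h2] with x' hx'
    by_cases h' : ‖x'‖ ∈ Set.Icc P.R P.ρ
    · rw [P.level_of_mem h']; exact hx' h'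
    · rw [P.level_of_notMem h']
      exact P.neg_one_div_γ_neg.trans ((slope_pos h).trans hy)
  · rw [P.level_of_notMem h] at hy
    have hopen : IsOpen {x' : Eu d | ‖x'‖ ∉ Set.Icc P.R P.ρ} :=
      (isClosed_Icc.preimage continuous_norm).isOpen_compl
    filter_upwards [hopen.mem_nhds h] with x' hx'
    rwa [P.level_of_notMem hx']

theorem measurable_level : Measurable (P.level : Eu d → ℝ) :=
  P.upperSemicontinuous_level.measurable

theorem exists_abs_level_le : ∃ C, ∀ x : Eu d, |P.level x| ≤ C := by
  obtain ⟨C, hC0, hC⟩ := P.exists_slope_le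
  refine ⟨max C (1 / P.γ), fun x => ?_⟩
  by_cases h : ‖x‖ ∈ Set.Icc P.R P.ρ
  · rw [P.level_of_mem h, abs_of_pos (slope_pos h)]
    exact (hC _ h).trans (le_max_left _ _)
  · rw [P.level_of_notMem h, abs_of_neg P.neg_one_div_γ_neg, neg_div, neg_neg]
    exact le_max_right _ _

theorem locallyIntegrable_level : LocallyIntegrable (P.level : Eu d → ℝ) volume := by
  obtain ⟨C, hC⟩ := P.exists_abs_level_le
  exact (locallyIntegrable_const C).mono P.measurable_level.aestronglyMeasurable
    (Eventually.of_forall fun x => (hC x).trans (le_abs_self C))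

/-- No path reaches the ball at a lower cost than the radial ones. -/
theorem time_le_runningCost (y : StoppedPath (Metric.closedBall (0 : Eu d) P.R))
    (hy : ‖y.pos 0‖ ≤ P.ρ) : P.time ‖y.pos 0‖ ≤ runningCost P.level y 0 := by
  have hf : LipschitzWith 1 fun t : ℝ => ‖y.pos t.toNNReal‖ := by
    have h := lipschitzWith_one_norm.comp (y.lipschitz.comp Real.lipschitzWith_toNNReal)
    simpa [Function.comp_def] using h
  have hend : ‖y.pos (y.hit : ℝ).toNNReal‖ ≤ P.R := by
    have := y.pos_hit_mem
    rw [Metric.isClosed_closedBall.closure_eq, mem_closedBall_zero_iff] at this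
    rwa [Real.toNNReal_coe]
  -- The slope is cut off at the shell because a competing path may leave it, and then runs free of
  -- cost.
  have hm : Measurable ((Set.Icc P.R P.ρ).indicator fun r => ENNReal.ofReal (P.slope r)) := by
    refine Measurable.indicator ?_ measurableSet_Icc
    have := P.measurable_den
    unfold slope
    fun_prop
  have key := lintegral_le_lintegral_comp_of_lipschitz hf (a := P.R) (b := ‖y.pos 0‖) (T := y.hit)
    y.hit.coe_nonneg (by simp) hend hm
  rw [P.time_eq_slope hy, runningCost]
  refine le_trans (le_of_eq ?_) (key.trans ?_)
  · refine setLIntegral_congr_fun measurableSet_Ioc fun r hr => ?_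
    rw [Set.indicator_of_mem (show r ∈ Set.Icc P.R P.ρ from ⟨hr.1.le, hr.2.trans hy⟩)]
  · rw [NNReal.coe_zero]
    refine lintegral_mono fun t => ?_
    by_cases h : ‖y.pos t.toNNReal‖ ∈ Set.Icc P.R P.ρ
    · rw [Set.indicator_of_mem h, P.level_of_mem h]
    · rw [Set.indicator_of_notMem h]
      exact zero_le

/-- The path of the radial equilibrium. -/
noncomputable def path (ω : Metric.sphere (0 : Eu d) 1) (s : ℝ) :
    StoppedPath (Metric.closedBall (0 : Eu d) P.R) := StoppedPath.radial P.R_pos.le ω s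

theorem path_pos (ω : Metric.sphere (0 : Eu d) 1) (s : ℝ) (t : ℝ≥0) :
    (P.path ω s).pos t = max (s - t) P.R • (ω : Eu d) := rfl

theorem norm_path_pos (ω : Metric.sphere (0 : Eu d) 1) (s : ℝ) (t : ℝ≥0) :
    ‖(P.path ω s).pos t‖ = max (s - t) P.R := by
  rw [path_pos, norm_smul, mem_sphere_zero_iff_norm.1 ω.2, mul_one,
    Real.norm_of_nonneg (P.R_pos.le.trans (le_max_right _ _))]

theorem path_hit (ω : Metric.sphere (0 : Eu d) 1) (s : ℝ) :
    (P.path ω s).hit = (s - P.R).toNNReal := StoppedPath.radial_hit _ _ _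

theorem continuous_path : Continuous fun p : Metric.sphere (0 : Eu d) 1 × ℝ => P.path p.1 p.2 :=
  StoppedPath.continuous_radial _

/-- At unit speed, time and radius are exchanged by `z ↦ s - z`. The path at time `r` is at radius
`s - r`, and its remaining cost is the arrival time of that radius. -/
theorem runningCost_path (ω : Metric.sphere (0 : Eu d) 1) {s : ℝ} (hs : s ∈ Set.Icc P.R P.ρ)
    (r : ℝ≥0) :
    runningCost P.level (P.path ω s) r = P.time (s - r) := by
  have h0 : 0 ≤ s - P.R := sub_nonneg.2 hs.1
  rw [runningCost, P.path_hit, Real.coe_toNNReal _ h0, P.time_eq_slope (by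
    have := r.coe_nonneg; linarith [hs.2])]
  have h1 : ∫⁻ z in Set.Icc (r : ℝ) (s - P.R),
      ENNReal.ofReal (P.level ((P.path ω s).pos z.toNNReal)) =
      ∫⁻ z in Set.Icc (r : ℝ) (s - P.R), ENNReal.ofReal (P.slope (s - z)) := by
    refine setLIntegral_congr_fun measurableSet_Icc fun z hz => ?_
    have hz0 : 0 ≤ z := r.coe_nonneg.trans hz.1
    have hn : ‖(P.path ω s).pos z.toNNReal‖ = s - z := by
      rw [norm_path_pos, Real.coe_toNNReal _ hz0, max_eq_left (by linarith [hz.2])]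
    have hmem : ‖(P.path ω s).pos z.toNNReal‖ ∈ Set.Icc P.R P.ρ := by
      rw [hn]; exact ⟨by linarith [hz.2], by linarith [hs.2]⟩
    rw [P.level_of_mem hmem, hn]
  rw [h1, ← lintegral_indicator measurableSet_Icc,
    ← lintegral_sub_left_eq_self (μ := (volume : Measure ℝ)) _ s,
    ← lintegral_indicator measurableSet_Ioc]
  have hae : (Set.Icc P.R (s - r) : Set ℝ) =ᵐ[volume] (Set.Ioc P.R (s - r) : Set ℝ) :=
    Ioc_ae_eq_Icc.symm
  rw [lintegral_indicator measurableSet_Ioc, ← Measure.restrict_congr_set hae,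
    ← lintegral_indicator measurableSet_Icc]
  refine lintegral_congr fun z => ?_
  have : s - z ∈ Set.Icc (r : ℝ) (s - P.R) ↔ z ∈ Set.Icc P.R (s - r) := by
    simp only [Set.mem_Icc]
    constructor <;> rintro ⟨h, h'⟩ <;> constructor <;> linarith
  by_cases hz : z ∈ Set.Icc P.R (s - r)
  · rw [Set.indicator_of_mem (this.2 hz), Set.indicator_of_mem hz, sub_sub_cancel]
  · rw [Set.indicator_of_notMem fun h => hz (this.1 h), Set.indicator_of_notMem hz]

end RadialProfile

/-! ### The law of the particles and its marginals. -/

namespace RadialProfile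

variable {d : ℕ} (P : RadialProfile d)

theorem nontrivial (P : RadialProfile d) : Nontrivial (Eu d) := by
  have : Nonempty (Fin d) := ⟨⟨0, by have := P.two_le; omega⟩⟩
  infer_instance

theorem norm_sphere_smul (ω : Metric.sphere (0 : Eu d) 1) {r : ℝ} (hr : 0 ≤ r) :
    ‖r • (ω : Eu d)‖ = r := by
  rw [norm_smul, mem_sphere_zero_iff_norm.1 ω.2, mul_one, Real.norm_of_nonneg hr]

/-- The space swept by the paths. -/
def shell (P : RadialProfile d) : Set (Eu d) := {x | P.R < ‖x‖ ∧ ‖x‖ ≤ P.ρ}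

theorem measurableSet_shell : MeasurableSet P.shell :=
  (measurableSet_lt measurable_const measurable_norm).inter
    (measurableSet_le measurable_norm measurable_const)

/-- The measure on the shell with the density `h` per unit of radius and of solid angle. -/
noncomputable def shellMeasure (h : ℝ → ℝ≥0∞) : Measure (Eu d) :=
  (volume.restrict P.shell).withDensity fun x => h ‖x‖ / ENNReal.ofReal (‖x‖ ^ (d - 1))

/-- The weight `‖x‖ ^ (d - 1)` in the density cancels the Jacobian of polar coordinates. -/
theorem lintegral_shellMeasure {h : ℝ → ℝ≥0∞} (hh : Measurable h) {f : Eu d → ℝ≥0∞}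
    (hf : Measurable f) :
    ∫⁻ x, f x ∂P.shellMeasure h =
      ∫⁻ ω, (∫⁻ r in Set.Ioc P.R P.ρ, h r * f (r • (ω : Eu d))) ∂(volume : Measure (Eu d)).toSphere := by
  have := P.nontrivial
  have hw : Measurable fun x : Eu d => h ‖x‖ / ENNReal.ofReal (‖x‖ ^ (d - 1)) := by fun_prop
  rw [shellMeasure, lintegral_withDensity_eq_lintegral_mul _ hw hf,
    ← lintegral_indicator P.measurableSet_shell,
    lintegral_polar ((hw.mul hf).indicator P.measurableSet_shell), finrank_euclideanSpace_fin]
  refine lintegral_congr fun ω => ?_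
  rw [← lintegral_indicator measurableSet_Ioi, ← lintegral_indicator measurableSet_Ioc]
  refine lintegral_congr fun r => ?_
  by_cases hr : r ∈ Set.Ioc P.R P.ρ
  · have hr0 : 0 < r := P.R_pos.trans hr.1
    have hn := norm_sphere_smul ω hr0.le
    have hmem : r • (ω : Eu d) ∈ P.shell := by
      rw [shell, Set.mem_ofPred_eq, hn]; exact hr
    have hp : ENNReal.ofReal (r ^ (d - 1)) ≠ 0 := by simpa using pow_pos hr0 _
    rw [Set.indicator_of_mem (show r ∈ Set.Ioi 0 from hr0), Set.indicator_of_mem hr,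
      Set.indicator_of_mem hmem, Pi.mul_apply, hn, ← mul_assoc,
      ENNReal.mul_div_cancel hp ENNReal.ofReal_ne_top]
  · rw [Set.indicator_of_notMem hr]
    by_cases hr0 : 0 < r
    · have hn := norm_sphere_smul ω hr0.le
      have hmem : r • (ω : Eu d) ∉ P.shell := by
        rw [shell, Set.mem_ofPred_eq, hn]; exact hr
      rw [Set.indicator_of_mem (show r ∈ Set.Ioi 0 from hr0), Set.indicator_of_notMem hmem,
        mul_zero]
    · rw [Set.indicator_of_notMem (show r ∉ Set.Ioi 0 from hr0)]

/-- The path and the killing time of a particle with direction `ω`, starting radius `s` and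
life time `τ`. -/
noncomputable def particle (z : (Metric.sphere (0 : Eu d) 1 × ℝ) × ℝ) :
    KilledPath (Metric.closedBall (0 : Eu d) P.R) :=
  (P.path z.1.1 z.1.2, min (z.1.2 - P.R).toNNReal z.2.toNNReal)

theorem measurable_particle : Measurable P.particle := by
  refine (P.continuous_path.measurable.comp measurable_fst).prodMk ?_
  fun_prop

/-- The law of the particles, with the total mass `κ`. -/
noncomputable def law : Measure (KilledPath (Metric.closedBall (0 : Eu d) P.R)) :=
  (((volume : Measure (Eu d)).toSphere.prod P.startLaw).prod (killingLaw P.q)).map P.particle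

theorem lintegral_law {f : KilledPath (Metric.closedBall (0 : Eu d) P.R) → ℝ≥0∞}
    (hf : Measurable f) :
    ∫⁻ p, f p ∂P.law = ∫⁻ ω, (∫⁻ s, (∫⁻ τ, f (P.particle ((ω, s), τ)) ∂killingLaw P.q)
      ∂P.startLaw) ∂(volume : Measure (Eu d)).toSphere := by
  have := isProbabilityMeasure_killingLaw P.q_pos
  have hm := hf.comp P.measurable_particle
  rw [law, lintegral_map hf P.measurable_particle]
  exact (lintegral_prod _ hm.aemeasurable).trans
    (lintegral_prod _ (Measurable.lintegral_prod_right' hm).aemeasurable)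

theorem law_univ : P.law Set.univ =
    (volume : Measure (Eu d)).toSphere Set.univ * P.startLaw Set.univ := by
  have := isProbabilityMeasure_killingLaw P.q_pos
  rw [← lintegral_one, P.lintegral_law measurable_const]
  simp [mul_comm]

instance : IsFiniteMeasure P.law :=
  ⟨by rw [P.law_univ]; exact ENNReal.mul_lt_top (measure_lt_top _ _) (measure_lt_top _ _)⟩

theorem law_univ_ne_zero : P.law Set.univ ≠ 0 := by
  have := P.nontrivial
  rw [P.law_univ]
  refine mul_ne_zero ?_ P.startLaw_univ_pos.ne'
  rw [Measure.measure_univ_ne_zero]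
  exact Measure.toSphere_ne_zero _

/-- The radial equilibrium. -/
noncomputable def equilibrium : Triplet (Metric.closedBall (0 : Eu d) P.R) where
  κ := (P.law Set.univ).toNNReal
  Q := (P.law Set.univ).toNNReal⁻¹ • P.law
  L := P.level

theorem κ_pos : 0 < P.equilibrium.κ :=
  ENNReal.toNNReal_pos P.law_univ_ne_zero (measure_ne_top _ _)

/-- The equation and the energies involve `κ` and `Q` only through this product, so they can be
computed with the unnormalized law. -/
theorem κ_smul_Q : P.equilibrium.κ • P.equilibrium.Q = P.law := by
  have h : (P.law Set.univ).toNNReal ≠ 0 := P.κ_pos.ne'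
  simp only [equilibrium]
  rw [smul_smul, mul_inv_cancel₀ h, one_smul]

theorem Q_absolutelyContinuous : P.equilibrium.Q ≪ P.law := Measure.smul_absolutelyContinuous

theorem isProbabilityMeasure_Q : IsProbabilityMeasure P.equilibrium.Q := by
  constructor
  have h : (P.equilibrium.κ : ℝ≥0∞) * P.equilibrium.Q Set.univ = P.equilibrium.κ := by
    rw [← smul_eq_mul, ← ENNReal.smul_def, ← Measure.smul_apply, P.κ_smul_Q]
    exact (ENNReal.coe_toNNReal (measure_ne_top _ _)).symm
  have h0 : (P.equilibrium.κ : ℝ≥0∞) ≠ 0 := by exact_mod_cast P.κ_pos.ne'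
  exact ((ENNReal.mul_right_inj h0 ENNReal.coe_ne_top).1 (h.trans (mul_one _).symm))

/-- The particles follow the radial paths. -/
theorem ae_law : ∀ᵐ p ∂P.law, ∃ ω, ∃ s ∈ Set.Ioc P.R P.ρ, p.1 = P.path ω s ∧ p.2 ≤ p.1.hit := by
  -- To transfer the property through the push-forward, it is encoded by a measurable set: the paths
  -- started in the closed shell form a compact set, and a positive hitting time excludes the
  -- starting radius `R`.
  set K := (fun p : Metric.sphere (0 : Eu d) 1 × ℝ => P.path p.1 p.2) ''
    (Set.univ ×ˢ Set.Icc P.R P.ρ) with hK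
  have hKc : IsCompact K := (isCompact_univ.prod isCompact_Icc).image P.continuous_path
  have hhit : Measurable fun p : KilledPath (Metric.closedBall (0 : Eu d) P.R) => p.1.hit :=
    StoppedPath.continuous_hit.measurable.comp measurable_fst
  have hm : MeasurableSet {p : KilledPath (Metric.closedBall (0 : Eu d) P.R) |
      p.1 ∈ K ∧ p.2 ≤ p.1.hit ∧ 0 < p.1.hit} :=
    (measurable_fst hKc.isClosed.measurableSet).inter
      ((measurableSet_le (f := fun p : KilledPath (Metric.closedBall (0 : Eu d) P.R) => p.2)
        (g := fun p => p.1.hit) measurable_snd hhit).inter (hhit measurableSet_Ioi))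
  have h : ∀ᵐ p ∂P.law, p.1 ∈ K ∧ p.2 ≤ p.1.hit ∧ 0 < p.1.hit := by
    rw [law, ae_map_iff P.measurable_particle.aemeasurable hm]
    have h1 : ∀ᵐ z ∂((volume : Measure (Eu d)).toSphere.prod P.startLaw),
        z.2 ∈ Set.Ioc P.R P.ρ :=
      Measure.quasiMeasurePreserving_snd.ae P.ae_startLaw
    have h2 : ∀ᵐ z ∂(((volume : Measure (Eu d)).toSphere.prod P.startLaw).prod (killingLaw P.q)),
        z.1.2 ∈ Set.Ioc P.R P.ρ := Measure.quasiMeasurePreserving_fst.ae h1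
    filter_upwards [h2] with z hz
    refine ⟨⟨z.1, ⟨Set.mem_univ _, hz.1.le, hz.2⟩, rfl⟩, ?_⟩
    simp only [particle]
    rw [P.path_hit]
    exact ⟨min_le_left _ _, Real.toNNReal_pos.2 (sub_pos.2 hz.1)⟩
  filter_upwards [h] with p hp
  obtain ⟨⟨z, hz, hzp⟩, hp2, hp3⟩ := hp
  refine ⟨z.1, z.2, ⟨?_, hz.2.2⟩, hzp.symm, hp2⟩
  rw [← hzp, P.path_hit, Real.toNNReal_pos] at hp3
  exact sub_pos.1 hp3

theorem ae_Q : ∀ᵐ p ∂P.equilibrium.Q,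
    ∃ ω, ∃ s ∈ Set.Ioc P.R P.ρ, p.1 = P.path ω s ∧ p.2 ≤ p.1.hit :=
  P.Q_absolutelyContinuous.ae_le P.ae_law

/-- The law of the initial positions. -/
theorem law_map_start : P.law.map (fun p => p.1.pos 0) =
    P.shellMeasure (fun s => ENNReal.ofReal (P.source s)) +
      ENNReal.ofReal (P.flux P.ρ) • (volume : Measure (Eu d)).toSphere.map
        (fun ω : Metric.sphere (0 : Eu d) 1 => P.ρ • (ω : Eu d)) := by
  have := isProbabilityMeasure_killingLaw P.q_pos
  have hpos : Measurable fun p : KilledPath (Metric.closedBall (0 : Eu d) P.R) => p.1.pos 0 :=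
    StoppedPath.continuous_pos.measurable.comp (measurable_fst.prodMk measurable_const)
  have hsrc : Measurable fun s => ENNReal.ofReal (P.source s) := P.measurable_source.ennreal_ofReal
  refine Measure.ext_of_lintegral _ fun f hf => ?_
  have hm1 : Measurable fun ω : Metric.sphere (0 : Eu d) 1 => P.ρ • (ω : Eu d) := by fun_prop
  have hm3 : Measurable fun ω : Metric.sphere (0 : Eu d) 1 =>
      ENNReal.ofReal (P.flux P.ρ) * f (P.ρ • (ω : Eu d)) := (hf.comp hm1).const_mul _
  rw [lintegral_map hf hpos, P.lintegral_law (f := fun p => f (p.1.pos 0)) (hf.comp hpos), lintegral_add_measure,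
    lintegral_smul_measure, lintegral_map hf hm1, P.lintegral_shellMeasure hsrc hf, smul_eq_mul,
    ← lintegral_const_mul' _ _ ENNReal.ofReal_ne_top, ← lintegral_add_right _ hm3]
  refine lintegral_congr fun ω => ?_
  have h1 : ∀ s, ∫⁻ τ, f ((P.particle ((ω, s), τ)).1.pos 0) ∂killingLaw P.q =
      f (max s P.R • (ω : Eu d)) := by
    intro s
    have : ∀ τ, (P.particle ((ω, s), τ)).1.pos 0 = max s P.R • (ω : Eu d) := by
      intro τ
      rw [particle, P.path_pos]
      simp
    simp_rw [this]
    simp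
  have hm2 : Measurable fun s : ℝ => f (max s P.R • (ω : Eu d)) := hf.comp (by fun_prop)
  simp_rw [h1]
  rw [startLaw, lintegral_add_measure, lintegral_smul_measure, lintegral_dirac' _ hm2,
    lintegral_withDensity_eq_lintegral_mul _ hsrc hm2, max_eq_left P.R_lt.le, smul_eq_mul]
  congr 1
  refine setLIntegral_congr_fun measurableSet_Ioc fun s hs => ?_
  simp only [Pi.mul_apply]
  rw [max_eq_left hs.1.le]

/-- The terminal energy of the particles that are not killed. -/
theorem law_map_terminal : (P.law.restrict {p | p.2 = p.1.hit}).map (fun p => p.1.pos p.1.hit) =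
    ENNReal.ofReal P.a₀ • (volume : Measure (Eu d)).toSphere.map
        (fun ω : Metric.sphere (0 : Eu d) 1 => P.R • (ω : Eu d)) := by
  have hhit : Measurable fun p : KilledPath (Metric.closedBall (0 : Eu d) P.R) => p.1.hit :=
    StoppedPath.continuous_hit.measurable.comp measurable_fst
  have hpos : Measurable fun p : KilledPath (Metric.closedBall (0 : Eu d) P.R) =>
      p.1.pos p.1.hit :=
    StoppedPath.continuous_pos.measurable.comp (measurable_fst.prodMk hhit)
  have hset : MeasurableSet {p : KilledPath (Metric.closedBall (0 : Eu d) P.R) | p.2 = p.1.hit} :=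
    measurableSet_eq_fun measurable_snd hhit
  refine Measure.ext_of_lintegral _ fun f hf => ?_
  have hm1 : Measurable fun ω : Metric.sphere (0 : Eu d) 1 => P.R • (ω : Eu d) := by fun_prop
  rw [lintegral_map hf hpos, ← lintegral_indicator hset,
    P.lintegral_law (f := {p : KilledPath (Metric.closedBall (0 : Eu d) P.R) |
      p.2 = p.1.hit}.indicator fun p => f (p.1.pos p.1.hit)) ((hf.comp hpos).indicator hset),
    lintegral_smul_measure, lintegral_map hf hm1,
    smul_eq_mul, ← lintegral_const_mul' _ _ ENNReal.ofReal_ne_top]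
  refine lintegral_congr fun ω => ?_
  -- The particle survives exactly when its life time is at least the travel time `s - R`, and it
  -- always ends at radius `R`.
  have h1 : ∀ s ∈ Set.Ioc P.R P.ρ, ∫⁻ τ, {p : KilledPath (Metric.closedBall (0 : Eu d) P.R) |
        p.2 = p.1.hit}.indicator (fun p => f (p.1.pos p.1.hit)) (P.particle ((ω, s), τ))
          ∂killingLaw P.q =
      ENNReal.ofReal (Real.exp (-P.q * (s - P.R))) * f (P.R • (ω : Eu d)) := by
    intro s hs
    have h0 : 0 ≤ s - P.R := sub_nonneg.2 hs.1.le
    rw [← killingLaw_Ici P.q_pos h0, mul_comm, ← lintegral_indicator_const measurableSet_Ici]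
    refine lintegral_congr fun τ => ?_
    have hiff : P.particle ((ω, s), τ) ∈ {p : KilledPath (Metric.closedBall (0 : Eu d) P.R) |
        p.2 = p.1.hit} ↔ τ ∈ Set.Ici (s - P.R) := by
      rw [particle, Set.mem_ofPred_eq, P.path_hit, min_eq_left_iff, Set.mem_Ici]
      rcases lt_or_ge τ 0 with h | h
      · rw [Real.toNNReal_of_nonpos h.le]
        have := hs.1
        constructor
        · intro h'
          rw [le_zero_iff, Real.toNNReal_eq_zero] at h'
          linarith
        · intro h'; linarith
      · exact Real.toNNReal_le_toNNReal_iff h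
    by_cases hτ : τ ∈ Set.Ici (s - P.R)
    · rw [Set.indicator_of_mem (hiff.2 hτ), Set.indicator_of_mem hτ, particle, P.path_hit,
        P.path_pos, Real.coe_toNNReal _ h0, sub_sub_cancel, max_self]
    · rw [Set.indicator_of_notMem fun h => hτ (hiff.1 h), Set.indicator_of_notMem hτ]
  rw [lintegral_congr_ae (P.ae_startLaw.mono h1), lintegral_mul_const _ (by fun_prop)]
  congr 1
  have h2 := P.lintegral_startLaw_exp (Set.left_mem_Icc.2 P.R_lt.le)
  rw [P.flux_R] at h2
  rw [← h2, ← lintegral_indicator measurableSet_Ici]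
  refine lintegral_congr_ae (P.ae_startLaw.mono fun s hs => ?_)
  exact (Set.indicator_of_mem (show s ∈ Set.Ici P.R from hs.1.le)
    (fun s => ENNReal.ofReal (Real.exp (-P.q * (s - P.R))))).symm

theorem lintegral_Icc_sub_left (f : ℝ → ℝ≥0∞) (s R : ℝ) :
    ∫⁻ t in Set.Icc 0 (s - R), f (s - t) = ∫⁻ r in Set.Ioc R s, f r := by
  have h : (Set.Icc R s : Set ℝ) =ᵐ[volume] (Set.Ioc R s : Set ℝ) := Ioc_ae_eq_Icc.symm
  rw [← Measure.restrict_congr_set h, ← lintegral_indicator measurableSet_Icc,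
    ← lintegral_indicator measurableSet_Icc,
    ← lintegral_sub_left_eq_self (μ := (volume : Measure ℝ)) ((Set.Icc R s).indicator f) s]
  refine lintegral_congr fun t => ?_
  have : t ∈ Set.Icc 0 (s - R) ↔ s - t ∈ Set.Icc R s := by
    simp only [Set.mem_Icc]
    constructor <;> rintro ⟨h, h'⟩ <;> constructor <;> linarith
  by_cases ht : t ∈ Set.Icc 0 (s - R)
  · rw [Set.indicator_of_mem ht, Set.indicator_of_mem (this.1 ht)]
  · rw [Set.indicator_of_notMem ht, Set.indicator_of_notMem fun h => ht (this.2 h)]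

/-- The balance of the rays, integrated over the directions. -/
theorem lintegral_occupation {f : Eu d → ℝ≥0∞} (hf : Measurable f) :
    ∫⁻ ω, (∫⁻ s, (∫⁻ t in Set.Icc 0 (s - P.R), ENNReal.ofReal (Real.exp (-P.q * t)) *
      f ((s - t) • (ω : Eu d))) ∂P.startLaw) ∂(volume : Measure (Eu d)).toSphere =
    ∫⁻ x, f x ∂P.shellMeasure (fun r => ENNReal.ofReal (P.flux r)) := by
  rw [P.lintegral_shellMeasure P.measurable_flux.ennreal_ofReal hf]
  refine lintegral_congr fun ω => ?_
  rw [← P.lintegral_startLaw_occupation (f := fun r => f (r • (ω : Eu d))) (hf.comp (by fun_prop))]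
  refine lintegral_congr fun s => ?_
  rw [← lintegral_Icc_sub_left (fun r => ENNReal.ofReal (Real.exp (-P.q * (s - r))) *
    f (r • (ω : Eu d))) s P.R]
  refine lintegral_congr fun t => ?_
  rw [sub_sub_cancel]

/-- The law of the positions at which particles are killed, outside of the ball. -/
theorem law_map_killed_restrict : (P.law.map (fun p => p.1.pos p.2)).restrict P.shell =
    ENNReal.ofReal P.q • P.shellMeasure (fun r => ENNReal.ofReal (P.flux r)) := by
  have hpos : Measurable fun p : KilledPath (Metric.closedBall (0 : Eu d) P.R) => p.1.pos p.2 :=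
    StoppedPath.continuous_pos.measurable
  refine Measure.ext_of_lintegral _ fun f hf => ?_
  have hfi := hf.indicator P.measurableSet_shell
  have hsf : ∫⁻ x, f x ∂P.shellMeasure (fun r => ENNReal.ofReal (P.flux r)) =
      ∫⁻ x, P.shell.indicator f x ∂P.shellMeasure (fun r => ENNReal.ofReal (P.flux r)) := by
    rw [lintegral_indicator P.measurableSet_shell, shellMeasure,
      restrict_withDensity P.measurableSet_shell, Measure.restrict_restrict P.measurableSet_shell,
      Set.inter_self]
  rw [← lintegral_indicator P.measurableSet_shell, lintegral_map hfi hpos,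
    P.lintegral_law (f := fun p => P.shell.indicator f (p.1.pos p.2)) (hfi.comp hpos), lintegral_smul_measure, hsf, ← P.lintegral_occupation hfi,
    smul_eq_mul]
  set F := P.shell.indicator f
  have hF : Measurable F := hfi
  have h1 : ∀ ω : Metric.sphere (0 : Eu d) 1, ∀ s ∈ Set.Ioc P.R P.ρ,
      ∫⁻ τ, F ((P.particle ((ω, s), τ)).1.pos (P.particle ((ω, s), τ)).2) ∂killingLaw P.q =
      ENNReal.ofReal P.q * ∫⁻ t in Set.Icc 0 (s - P.R), ENNReal.ofReal (Real.exp (-P.q * t)) *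
        F ((s - t) • (ω : Eu d)) := by
    intro ω s hs
    have h0 : 0 ≤ s - P.R := sub_nonneg.2 hs.1.le
    have hm : Measurable fun τ : ℝ => F ((P.particle ((ω, s), τ)).1.pos (P.particle ((ω, s), τ)).2) :=
      (hF.comp hpos).comp (P.measurable_particle.comp (by fun_prop))
    have hm2 : Measurable fun t : ℝ => ENNReal.ofReal (Real.exp (-P.q * t)) *
        F ((s - t) • (ω : Eu d)) := Measurable.mul (by fun_prop) (hF.comp (by fun_prop))
    rw [killingLaw, lintegral_withDensity_eq_lintegral_mul _ (by fun_prop) hm,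
      ← lintegral_const_mul _ hm2]
    have hae : (Set.Ioi 0 : Set ℝ) =ᵐ[volume] (Set.Ici 0 : Set ℝ) := Ioi_ae_eq_Ici
    rw [Measure.restrict_congr_set hae, ← lintegral_indicator measurableSet_Ici,
      ← lintegral_indicator measurableSet_Icc]
    refine lintegral_congr fun t => ?_
    by_cases ht : 0 ≤ t
    · rw [Set.indicator_of_mem (show t ∈ Set.Ici 0 from ht), Pi.mul_apply]
      have hval : (P.particle ((ω, s), t)).1.pos (P.particle ((ω, s), t)).2 =
          (s - min (s - P.R) t) • (ω : Eu d) := by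
        simp only [particle]
        rw [P.path_pos, NNReal.coe_min, Real.coe_toNNReal _ h0, Real.coe_toNNReal _ ht, max_eq_left]
        linarith [min_le_left (s - P.R) t]
      rw [hval]
      by_cases ht2 : t ≤ s - P.R
      · rw [Set.indicator_of_mem (show t ∈ Set.Icc 0 (s - P.R) from ⟨ht, ht2⟩), min_eq_right ht2,
          ENNReal.ofReal_mul P.q_pos.le, mul_assoc]
      -- Surviving particles end on the inner sphere, which the half-open shell excludes; only
      -- killed ones count.
      · have hz : F (P.R • (ω : Eu d)) = 0 := by
          refine Set.indicator_of_notMem (fun h => ?_) _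
          have := h.1
          rw [norm_sphere_smul ω P.R_pos.le] at this
          exact lt_irrefl _ this
        rw [Set.indicator_of_notMem (show t ∉ Set.Icc 0 (s - P.R) from fun h => ht2 h.2),
          min_eq_left (not_le.1 ht2).le, sub_sub_cancel, hz, mul_zero]
    · rw [Set.indicator_of_notMem (show t ∉ Set.Ici 0 from ht),
        Set.indicator_of_notMem (show t ∉ Set.Icc 0 (s - P.R) from fun h => ht h.1)]
  rw [← lintegral_const_mul' _ _ ENNReal.ofReal_ne_top]
  refine lintegral_congr fun ω => ?_
  rw [← lintegral_const_mul' _ _ ENNReal.ofReal_ne_top]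
  exact lintegral_congr_ae (P.ae_startLaw.mono (h1 ω))

/-- The occupation measure of the particles. -/
theorem lintegral_law_occupation {f : Eu d → ℝ≥0∞} (hf : Measurable f) :
    ∫⁻ p, (∫⁻ t in Set.Icc (0 : ℝ) p.2, f (p.1.pos t.toNNReal)) ∂P.law =
      ∫⁻ x, f x ∂P.shellMeasure (fun r => ENNReal.ofReal (P.flux r)) := by
  have := isProbabilityMeasure_killingLaw P.q_pos
  have hpos : Measurable fun z : KilledPath (Metric.closedBall (0 : Eu d) P.R) × ℝ =>
      z.1.1.pos z.2.toNNReal :=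
    StoppedPath.continuous_pos.measurable.comp
      ((measurable_fst.comp measurable_fst).prodMk (measurable_real_toNNReal.comp measurable_snd))
  have hS : MeasurableSet {z : KilledPath (Metric.closedBall (0 : Eu d) P.R) × ℝ |
      0 ≤ z.2 ∧ z.2 ≤ z.1.2} :=
    (measurableSet_le measurable_const measurable_snd).inter
      (measurableSet_le (f := fun z : KilledPath (Metric.closedBall (0 : Eu d) P.R) × ℝ => z.2)
        (g := fun z => (z.1.2 : ℝ)) measurable_snd (by fun_prop))
  have hG : Measurable fun p : KilledPath (Metric.closedBall (0 : Eu d) P.R) =>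
      ∫⁻ t in Set.Icc (0 : ℝ) p.2, f (p.1.pos t.toNNReal) := by
    have h := ((hf.comp hpos).indicator hS).lintegral_prod_right' (ν := (volume : Measure ℝ))
    convert h using 2 with p
    rw [← lintegral_indicator measurableSet_Icc]
    rfl
  rw [P.lintegral_law hG, ← P.lintegral_occupation hf]
  refine lintegral_congr fun ω => lintegral_congr_ae (P.ae_startLaw.mono fun s hs => ?_)
  have h0 : 0 ≤ s - P.R := sub_nonneg.2 hs.1.le
  simp only
  -- Time `t` is counted when the life time is at least `t`. After Tonelli, the survival probability
  -- e^{-qt} replaces the random killing time.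
  have h1 : ∀ τ : ℝ, 0 < τ → ∫⁻ t in Set.Icc (0 : ℝ) (P.particle ((ω, s), τ)).2,
      f ((P.particle ((ω, s), τ)).1.pos t.toNNReal) =
      ∫⁻ t in Set.Icc 0 (s - P.R), (Set.Ici t).indicator (fun _ => f ((s - t) • (ω : Eu d))) τ := by
    intro τ hτ
    have hβ : ((P.particle ((ω, s), τ)).2 : ℝ) = min (s - P.R) τ := by
      simp only [particle]
      rw [NNReal.coe_min, Real.coe_toNNReal _ h0, Real.coe_toNNReal _ hτ.le]
    rw [hβ, ← lintegral_indicator measurableSet_Icc, ← lintegral_indicator measurableSet_Icc]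
    refine lintegral_congr fun t => ?_
    by_cases ht : t ∈ Set.Icc 0 (s - P.R)
    · rw [Set.indicator_of_mem ht]
      by_cases ht2 : t ≤ τ
      · rw [Set.indicator_of_mem (show t ∈ Set.Icc 0 (min (s - P.R) τ) from
          ⟨ht.1, le_min ht.2 ht2⟩), Set.indicator_of_mem (show τ ∈ Set.Ici t from ht2)]
        simp only [particle]
        rw [P.path_pos, Real.coe_toNNReal _ ht.1, max_eq_left (by linarith [ht.2])]
      · rw [Set.indicator_of_notMem (show τ ∉ Set.Ici t from ht2), Set.indicator_of_notMem]
        exact fun h => ht2 (h.2.trans (min_le_right _ _))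
    · rw [Set.indicator_of_notMem ht, Set.indicator_of_notMem]
      exact fun h => ht ⟨h.1, h.2.trans (min_le_left _ _)⟩
  have hτ : ∀ᵐ τ ∂killingLaw P.q, 0 < τ := by
    have h2 : killingLaw P.q ≪ volume.restrict (Set.Ioi 0) := withDensity_absolutelyContinuous _ _
    exact h2.ae_le (ae_restrict_mem measurableSet_Ioi)
  rw [lintegral_congr_ae (hτ.mono h1)]
  have hmeas : Measurable (Function.uncurry fun τ t : ℝ =>
      (Set.Ici t).indicator (fun _ => f ((s - t) • (ω : Eu d))) τ) := by
    have h3 : (Function.uncurry fun τ t : ℝ =>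
        (Set.Ici t).indicator (fun _ => f ((s - t) • (ω : Eu d))) τ) =
        {p : ℝ × ℝ | p.2 ≤ p.1}.indicator (fun p => f ((s - p.2) • (ω : Eu d))) := by
      ext ⟨τ, t⟩
      by_cases h : t ≤ τ <;> simp [Function.uncurry, Set.indicator, h]
    rw [h3]
    exact Measurable.indicator (hf.comp (by fun_prop)) (measurableSet_le measurable_snd measurable_fst)
  rw [lintegral_lintegral_swap hmeas.aemeasurable]
  refine setLIntegral_congr_fun measurableSet_Icc fun t ht => ?_
  rw [lintegral_indicator_const measurableSet_Ici, killingLaw_Ici P.q_pos ht.1, mul_comm]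

end RadialProfile

/-! ### Verification of the equilibrium conditions. -/

namespace RadialProfile

variable {d : ℕ} (P : RadialProfile d)

theorem measurable_start {Γ : Set (Eu d)} : Measurable fun p : KilledPath Γ => p.1.pos 0 :=
  StoppedPath.continuous_pos.measurable.comp (measurable_fst.prodMk measurable_const)

theorem measurable_pos_prod {Γ : Set (Eu d)} :
    Measurable fun z : KilledPath Γ × ℝ => z.1.1.pos z.2.toNNReal :=
  StoppedPath.continuous_pos.measurable.comp
    ((measurable_fst.comp measurable_fst).prodMk (measurable_real_toNNReal.comp measurable_snd))

theorem measurableSet_alive {Γ : Set (Eu d)} :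
    MeasurableSet {z : KilledPath Γ × ℝ | 0 ≤ z.2 ∧ z.2 ≤ z.1.2} :=
  (measurableSet_le measurable_const measurable_snd).inter
    (measurableSet_le (f := fun z : KilledPath Γ × ℝ => z.2)
      (g := fun z => (z.1.2 : ℝ)) measurable_snd (by fun_prop))

/-- The cost of the radial law is the expected arrival time of the initial position, which depends
on the initial law alone. For any competitor it is a lower bound path by path, since its starting
points lie in the closed ball of radius `ρ` too. -/
theorem Q_minimal (Q' : Measure (KilledPath (Metric.closedBall (0 : Eu d) P.R)))
    (h : Q'.map (fun p => p.1.pos 0) = P.equilibrium.Q.map (fun p => p.1.pos 0)) :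
    ∫⁻ p, runningCost P.level p.1 0 ∂P.equilibrium.Q ≤ ∫⁻ p, runningCost P.level p.1 0 ∂Q' := by
  have hW : Measurable fun x : Eu d => P.time ‖x‖ := P.time_mono.measurable.comp measurable_norm
  have hball : MeasurableSet {x : Eu d | ‖x‖ ≤ P.ρ} :=
    measurableSet_le measurable_norm measurable_const
  have h1 : ∫⁻ p, runningCost P.level p.1 0 ∂P.equilibrium.Q =
      ∫⁻ p, P.time ‖p.1.pos 0‖ ∂P.equilibrium.Q := by
    refine lintegral_congr_ae (P.ae_Q.mono ?_)
    rintro p ⟨ω, s, hs, hp, -⟩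
    simp only
    rw [hp, P.runningCost_path ω ⟨hs.1.le, hs.2⟩, P.norm_path_pos, NNReal.coe_zero, sub_zero,
      max_eq_left hs.1.le]
  have h2 : ∀ᵐ p ∂Q', ‖p.1.pos 0‖ ≤ P.ρ := by
    refine ae_of_ae_map measurable_start.aemeasurable (p := fun x : Eu d => ‖x‖ ≤ P.ρ) ?_
    rw [h, ae_map_iff measurable_start.aemeasurable hball]
    refine P.ae_Q.mono ?_
    rintro p ⟨ω, s, hs, hp, -⟩
    rw [hp, P.norm_path_pos, NNReal.coe_zero, sub_zero, max_eq_left hs.1.le]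
    exact hs.2
  rw [h1, ← lintegral_map hW measurable_start, ← h, lintegral_map hW measurable_start]
  exact lintegral_mono_ae (h2.mono fun p hp => P.time_le_runningCost p.1 hp)

/-- The occupation measure of the particles, as a push-forward. -/
theorem occupation_eq : ((P.law.prod (volume : Measure ℝ)).restrict
      {z | 0 ≤ z.2 ∧ z.2 ≤ z.1.2}).map (fun z => z.1.1.pos z.2.toNNReal) =
    P.shellMeasure fun r => ENNReal.ofReal (P.flux r) := by
  refine Measure.ext_of_lintegral _ fun f hf => ?_
  rw [← P.lintegral_law_occupation hf, lintegral_map hf measurable_pos_prod,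
    ← lintegral_indicator measurableSet_alive,
    lintegral_prod (({z : KilledPath (Metric.closedBall (0 : Eu d) P.R) × ℝ |
      0 ≤ z.2 ∧ z.2 ≤ z.1.2}).indicator fun z => f (z.1.1.pos z.2.toNNReal))
      ((hf.comp measurable_pos_prod).indicator measurableSet_alive).aemeasurable]
  refine lintegral_congr fun p => ?_
  rw [← lintegral_indicator measurableSet_Icc]
  rfl

instance : IsFiniteMeasure (P.shellMeasure fun r => ENNReal.ofReal (P.flux r)) := by
  constructor
  rw [← lintegral_one, ← P.lintegral_law_occupation measurable_const]
  have h : ∀ᵐ p ∂P.law, ∫⁻ _ in Set.Icc (0 : ℝ) p.2, 1 ≤ ENNReal.ofReal P.ρ := by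
    refine P.ae_law.mono ?_
    rintro p ⟨ω, s, hs, hp, hp2⟩
    rw [setLIntegral_one, Real.volume_Icc, sub_zero]
    refine ENNReal.ofReal_le_ofReal ?_
    rw [hp, P.path_hit] at hp2
    have h1 : (p.2 : ℝ) ≤ ((s - P.R).toNNReal : ℝ) := by exact_mod_cast hp2
    rw [Real.coe_toNNReal _ (sub_nonneg.2 hs.1.le)] at h1
    linarith [hs.2, P.R_pos]
  refine (lintegral_mono_ae h).trans_lt ?_
  rw [lintegral_const]
  exact ENNReal.mul_lt_top ENNReal.ofReal_lt_top (measure_lt_top _ _)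

theorem shell_mem_Icc {x : Eu d} (hx : x ∈ P.shell) : ‖x‖ ∈ Set.Icc P.R P.ρ := ⟨hx.1.le, hx.2⟩

/-- On the shell this is `slope_mul_flux`; outside, the value -1/γ makes 1 + γL vanish. -/
theorem integral_shellMeasure {φ : Eu d → ℝ} :
    ∫ x, φ x * max (P.level x) 0 ∂P.shellMeasure (fun r => ENNReal.ofReal (P.flux r)) =
      ∫ x, φ x * (1 + P.γ * P.level x) := by
  have := P.nontrivial
  have hm : Measurable fun x : Eu d => ENNReal.ofReal (P.flux ‖x‖) / ENNReal.ofReal (‖x‖ ^ (d - 1)) := by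
    have := P.measurable_flux
    fun_prop
  have hfin : ∀ᵐ x ∂(volume : Measure (Eu d)).restrict P.shell,
      ENNReal.ofReal (P.flux ‖x‖) / ENNReal.ofReal (‖x‖ ^ (d - 1)) < ⊤ := by
    filter_upwards [ae_restrict_mem P.measurableSet_shell] with x hx
    refine ENNReal.div_lt_top ENNReal.ofReal_ne_top ?_
    exact (ENNReal.ofReal_pos.2 (pow_pos_of_mem (P.shell_mem_Icc hx))).ne'
  rw [shellMeasure, integral_withDensity_eq_integral_toReal_smul hm hfin]
  have h1 : ∫ x in P.shell, (ENNReal.ofReal (P.flux ‖x‖) / ENNReal.ofReal (‖x‖ ^ (d - 1))).toReal •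
      (φ x * max (P.level x) 0) = ∫ x in P.shell, φ x * (1 + P.γ * P.level x) := by
    refine setIntegral_congr_fun P.measurableSet_shell fun x hx => ?_
    have hx' := P.shell_mem_Icc hx
    rw [P.level_of_mem hx', max_eq_left (slope_pos hx').le, ← slope_mul_flux hx',
      ENNReal.toReal_div, ENNReal.toReal_ofReal (flux_pos hx').le,
      ENNReal.toReal_ofReal (pow_pos_of_mem hx').le, smul_eq_mul]
    ring
  rw [h1]
  refine setIntegral_eq_integral_of_ae_compl_eq_zero ?_
  -- The inner sphere carries a positive level but is not in the half-open shell; it is a null set.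
  have hs : ∀ᵐ x : Eu d, x ∉ Metric.sphere (0 : Eu d) P.R :=
    measure_eq_zero_iff_ae_notMem.1 (Measure.addHaar_sphere volume (0 : Eu d) P.R)
  filter_upwards [hs] with x hx hxs
  have hx' : ‖x‖ ∉ Set.Icc P.R P.ρ := fun h => hxs
    ⟨lt_of_le_of_ne h.1 fun h' => hx (mem_sphere_zero_iff_norm.2 h'.symm), h.2⟩
  have hγ := P.γ_pos.ne'
  rw [P.level_of_notMem hx', show 1 + P.γ * (-1 / P.γ) = 0 by field_simp; ring, mul_zero]

/-- The fixed-point equation of the equilibrium. -/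
theorem fixedPoint {φ : Eu d → ℝ} (hφ : Continuous φ) (hc : HasCompactSupport φ) :
    Integrable (fun p : KilledPath (Metric.closedBall (0 : Eu d) P.R) => ∫ t in (0 : ℝ)..p.2,
      φ (p.1.pos t.toNNReal) * max (P.level (p.1.pos t.toNNReal)) 0) P.law ∧
    ∫ p, (∫ t in (0 : ℝ)..p.2,
      φ (p.1.pos t.toNNReal) * max (P.level (p.1.pos t.toNNReal)) 0) ∂P.law =
      ∫ x, φ x * (1 + P.γ * P.level x) := by
  set G : Eu d → ℝ := fun x => φ x * max (P.level x) 0 with hG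
  have hGm : Measurable G := hφ.measurable.mul (P.measurable_level.max measurable_const)
  obtain ⟨C, hC⟩ := P.exists_abs_level_le (d := d)
  obtain ⟨D, hD⟩ := hc.exists_bound_of_continuous hφ
  have hGb : ∀ x, ‖G x‖ ≤ D * C := by
    intro x
    rw [hG, norm_mul]
    have h1 : ‖max (P.level x) 0‖ ≤ C := by
      rw [Real.norm_of_nonneg (le_max_right _ _)]
      exact max_le ((le_abs_self _).trans (hC x)) ((abs_nonneg _).trans (hC x))
    exact mul_le_mul (hD x) h1 (norm_nonneg _) ((norm_nonneg _).trans (hD x))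
  have hGi : Integrable G (P.shellMeasure fun r => ENNReal.ofReal (P.flux r)) :=
    Integrable.of_bound hGm.aestronglyMeasurable (D * C) (Eventually.of_forall hGb)
  have hint := hGi
  rw [← P.occupation_eq, integrable_map_measure hGm.aestronglyMeasurable
    measurable_pos_prod.aemeasurable, ← IntegrableOn, ← integrable_indicator_iff
    measurableSet_alive] at hint
  have hslice : ∀ p : KilledPath (Metric.closedBall (0 : Eu d) P.R),
      ∫ t, {z : KilledPath (Metric.closedBall (0 : Eu d) P.R) × ℝ | 0 ≤ z.2 ∧ z.2 ≤ z.1.2}.indicator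
        (G ∘ fun z => z.1.1.pos z.2.toNNReal) (p, t) = ∫ t in (0 : ℝ)..p.2, G (p.1.pos t.toNNReal) := by
    intro p
    rw [intervalIntegral.integral_of_le p.2.coe_nonneg, ← integral_Icc_eq_integral_Ioc,
      ← integral_indicator measurableSet_Icc]
    rfl
  refine ⟨?_, ?_⟩
  · have := hint.integral_prod_left
    simp_rw [hslice] at this
    exact this
  · have h1 := integral_prod _ hint
    simp_rw [hslice] at h1
    rw [← h1, integral_indicator measurableSet_alive, ← P.integral_shellMeasure, ← P.occupation_eq,
      integral_map measurable_pos_prod.aemeasurable hGm.aestronglyMeasurable]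
    rfl

/-- No particle pays more than the arrival time at `ρ`; the added one just makes the cap evidently
positive. -/
theorem isEquilibrium : IsEquilibrium P.γ ((P.time P.ρ).toReal + 1) P.equilibrium where
  κ_pos := P.κ_pos
  isProbabilityMeasure := P.isProbabilityMeasure_Q
  upperSemicontinuous := P.upperSemicontinuous_level
  L_ne_zero := P.level_ne_zero
  optimal Q' _ h := P.Q_minimal Q' h
  capped := by
    refine P.ae_Q.mono ?_
    rintro p ⟨ω, s, hs, hp, hp2⟩
    refine ⟨?_, hp2⟩
    change runningCost P.level p.1 0 ≤ _
    rw [hp, P.runningCost_path ω ⟨hs.1.le, hs.2⟩, NNReal.coe_zero, sub_zero]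
    refine (P.time_mono hs.2).trans ?_
    rw [← ENNReal.ofReal_toReal (P.time_lt_top le_rfl).ne]
    exact ENNReal.ofReal_le_ofReal (by simp)
  terminal := by
    refine P.ae_Q.mono ?_
    rintro p ⟨ω, s, hs, hp, hp2⟩ -
    rw [mtBoundary_closedBall P.R_pos, mem_sphere_zero_iff_norm, hp, P.norm_path_pos, P.path_hit,
      Real.coe_toNNReal _ (sub_nonneg.2 hs.1.le), sub_sub_cancel, max_self]
  locallyIntegrable := P.locallyIntegrable_level
  fixedPoint φ hφ hc := by
    obtain ⟨h1, h2⟩ := P.fixedPoint hφ.continuous hc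
    refine ⟨h1.smul_measure_nnreal, ?_⟩
    rw [← P.κ_smul_Q, integral_smul_nnreal_measure] at h2
    exact h2
  negPart φ hφ _ := by
    have hm : Measurable fun x : Eu d => ‖φ x‖ₑ * ENNReal.ofReal (-P.level x) := by
      have h1 := hφ.continuous.measurable
      have h2 := P.measurable_level (d := d)
      fun_prop
    have h := P.lintegral_law_occupation hm
    have h0 : ∫⁻ x, ‖φ x‖ₑ * ENNReal.ofReal (-P.level x)
        ∂P.shellMeasure (fun r => ENNReal.ofReal (P.flux r)) = 0 := by
      rw [lintegral_eq_zero_iff hm]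
      refine (withDensity_absolutelyContinuous _ _).ae_le ?_
      filter_upwards [ae_restrict_mem P.measurableSet_shell] with x hx
      have hx' := P.shell_mem_Icc hx
      rw [P.level_of_mem hx', ENNReal.ofReal_of_nonpos (neg_nonpos.2 (slope_pos hx').le), mul_zero]
      rfl
    rw [h0, ← P.κ_smul_Q, lintegral_smul_measure, ENNReal.smul_def, smul_eq_mul, mul_eq_zero] at h
    exact h.resolve_left (by exact_mod_cast P.κ_pos.ne')

end RadialProfile

/-! ### Arrival time and energy loss of the radial equilibrium. -/

namespace RadialProfile

variable {d : ℕ} (P : RadialProfile d)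

theorem shellMeasure_pos {U : Set (Eu d)} (hU : IsOpen U) (hne : U.Nonempty) (hUs : U ⊆ P.shell) :
    0 < P.shellMeasure (fun r => ENNReal.ofReal (P.flux r)) U := by
  have hac : (volume : Measure (Eu d)).restrict P.shell ≪
      P.shellMeasure (fun r => ENNReal.ofReal (P.flux r)) := by
    refine withDensity_absolutelyContinuous' (by have := P.measurable_flux; fun_prop) ?_
    filter_upwards [ae_restrict_mem P.measurableSet_shell] with x hx
    exact ENNReal.div_ne_zero.2 ⟨(ENNReal.ofReal_pos.2 (flux_pos (P.shell_mem_Icc hx))).ne',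
      ENNReal.ofReal_ne_top⟩
  refine pos_iff_ne_zero.2 fun h => ?_
  have h1 := hac h
  rw [Measure.restrict_apply hU.measurableSet, Set.inter_eq_left.2 hUs] at h1
  exact (hU.measure_pos volume hne).ne' h1

theorem Q_prod_absolutelyContinuous :
    P.law.prod (volume : Measure ℝ) ≪ P.equilibrium.Q.prod volume := by
  have h : P.law ≪ P.equilibrium.Q := by
    rw [← P.κ_smul_Q]
    exact Measure.smul_absolutelyContinuous
  have := P.isProbabilityMeasure_Q
  exact h.prod Measure.AbsolutelyContinuous.rfl

theorem ae_Q_prod : ∀ᵐ z ∂P.equilibrium.Q.prod (volume : Measure ℝ),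
    ∃ ω, ∃ s ∈ Set.Ioc P.R P.ρ, z.1.1 = P.path ω s ∧ z.1.2 ≤ z.1.1.hit := by
  have := P.isProbabilityMeasure_Q
  exact Measure.quasiMeasurePreserving_fst.ae P.ae_Q

/-- Near `x` there are open sets of points strictly closer to the origin, and living particles spend
time there. Their remaining cost is at most `P.time ‖x‖ < t`, so they have already passed the entry
time. -/
theorem mem_support_occupation {x : Eu d} (hx : x ∈ P.shell) {t : ℝ≥0} (ht : P.time ‖x‖ < t) :
    x ∈ (P.equilibrium.occupation t).support := by
  rw [Measure.mem_support_iff_forall]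
  intro A hA
  obtain ⟨U, hUA, hUo, hxU⟩ := mem_nhds_iff.1 hA
  refine lt_of_lt_of_le ?_ (measure_mono hUA)
  set U' := U ∩ {y : Eu d | P.R < ‖y‖ ∧ ‖y‖ < ‖x‖} with hU'
  have hU'o : IsOpen U' := hUo.inter
    ((isOpen_lt continuous_const continuous_norm).inter
      (isOpen_lt continuous_norm continuous_const))
  have hx0 : 0 < ‖x‖ := P.R_pos.trans hx.1
  have hne : U'.Nonempty := by
    have hc : Tendsto (fun c : ℝ => c • x) (𝓝[<] 1) (𝓝 x) := by
      have : Continuous fun c : ℝ => c • x := by fun_prop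
      have h := this.tendsto 1
      rw [one_smul] at h
      exact h.mono_left nhdsWithin_le_nhds
    have h1 : ∀ᶠ c in 𝓝[<] (1 : ℝ), c • x ∈ U := hc (hUo.mem_nhds hxU)
    have h2 : ∀ᶠ c in 𝓝[<] (1 : ℝ), c ∈ Set.Ioo (P.R / ‖x‖) 1 :=
      Ioo_mem_nhdsLT ((div_lt_one hx0).2 hx.1)
    obtain ⟨c, hc1, hc2⟩ := (h1.and h2).exists
    have hc0 : 0 < c := (div_pos P.R_pos hx0).trans hc2.1
    refine ⟨c • x, hc1, ?_⟩
    rw [Set.mem_ofPred_eq, norm_smul, Real.norm_of_nonneg hc0.le]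
    exact ⟨(div_lt_iff₀ hx0).1 hc2.1, by nlinarith [hc2.2]⟩
  have hpos := P.shellMeasure_pos hU'o hne fun y hy => ⟨hy.2.1, hy.2.2.le.trans hx.2⟩
  rw [← P.occupation_eq, Measure.map_apply measurable_pos_prod hU'o.measurableSet,
    Measure.restrict_apply (measurable_pos_prod hU'o.measurableSet)] at hpos
  have hpos' : 0 < (P.equilibrium.Q.prod (volume : Measure ℝ))
      ((fun z => z.1.1.pos z.2.toNNReal) ⁻¹' U' ∩ {z | 0 ≤ z.2 ∧ z.2 ≤ z.1.2}) :=
    pos_iff_ne_zero.2 fun h => hpos.ne' (P.Q_prod_absolutelyContinuous h)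
  refine hpos'.trans_le ?_
  rw [Triplet.occupation, Measure.map_apply measurable_pos_prod hUo.measurableSet,
    Measure.restrict_apply (measurable_pos_prod hUo.measurableSet)]
  refine measure_mono_ae ?_
  filter_upwards [P.ae_Q_prod]
  rintro z ⟨ω, s, hs, hp, hp2⟩ ⟨hzU, hz0, hzβ⟩
  refine ⟨hzU.1, hz0, ?_, hzβ⟩
  have hle : z.2.toNNReal ≤ z.1.1.hit := (Real.toNNReal_le_iff_le_coe.2 hzβ).trans hp2
  -- The current time itself is admissible in the infimum defining the entry time.
  refine iInf₂_le_of_le z.2.toNNReal ⟨hle, ?_⟩ le_rfl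
  have hn : ‖z.1.1.pos z.2.toNNReal‖ < ‖x‖ := hzU.2.2
  change runningCost P.level z.1.1 z.2.toNNReal < t
  rw [hp, P.norm_path_pos] at hn
  rw [hp, P.runningCost_path ω ⟨hs.1.le, hs.2⟩]
  exact (P.time_mono ((le_max_left _ _).trans hn.le)).trans_lt ht

/-- Beyond radius `r` the remaining cost is at least the arrival time of `r`. If this exceeds `t`,
the entry time lies in the future; if `ρ ≤ r`, there are no particles at all. -/
theorem occupation_eq_zero {t : ℝ≥0} {r : ℝ} (hr : P.R ≤ r) (ht : (t : ℝ≥0∞) < P.time r ∨ P.ρ ≤ r) :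
    P.equilibrium.occupation t {x : Eu d | r < ‖x‖} = 0 := by
  have hm : MeasurableSet {x : Eu d | r < ‖x‖} := measurableSet_lt measurable_const measurable_norm
  rw [Triplet.occupation, Measure.map_apply measurable_pos_prod hm,
    Measure.restrict_apply (measurable_pos_prod hm)]
  refine measure_eq_zero_iff_ae_notMem.2 ?_
  filter_upwards [P.ae_Q_prod]
  rintro z ⟨ω, s, hs, hp, hp2⟩ ⟨hzr, hz0, hze, hzβ⟩
  change r < ‖z.1.1.pos z.2.toNNReal‖ at hzr
  rw [hp, P.norm_path_pos, Real.coe_toNNReal _ hz0, lt_max_iff, or_iff_left hr.not_gt] at hzr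
  rcases ht with ht | ht
  · have hsr : 0 ≤ s - r := by linarith
    have hlt : ENNReal.ofReal z.2 < ENNReal.ofReal (s - r) :=
      (ENNReal.ofReal_lt_ofReal_iff_of_nonneg hz0).2 (by linarith)
    have hlt2 := lt_of_le_of_lt hze hlt
    rw [Triplet.entry] at hlt2
    simp only [iInf_lt_iff] at hlt2
    obtain ⟨r', ⟨-, hcost⟩, hr'⟩ := hlt2
    change runningCost P.level z.1.1 r' < t at hcost
    rw [hp, P.runningCost_path ω ⟨hs.1.le, hs.2⟩] at hcost
    have h1 : (r' : ℝ) < s - r := by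
      rw [ENNReal.ofReal, ENNReal.coe_lt_coe, Real.lt_toNNReal_iff_coe_lt] at hr'
      exact hr'
    have h2 := P.time_mono (show r ≤ s - r' by linarith)
    exact absurd (h2.trans_lt hcost) ht.not_gt
  · linarith [hs.2]

/-- The arrival time function of the radial equilibrium. -/
theorem arrival_of_le {x : Eu d} (hx : ‖x‖ ≤ P.R) : P.equilibrium.arrival x = 0 := by
  refine le_antisymm (iInf₂_le_of_le 0 (Or.inl ?_) (by simp)) zero_le
  rwa [mem_closedBall_zero_iff]

theorem notMem_support_occupation {t : ℝ≥0} {r : ℝ} (hr : P.R ≤ r)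
    (ht : (t : ℝ≥0∞) < P.time r ∨ P.ρ ≤ r) {x : Eu d} (hx : r < ‖x‖) :
    x ∉ (P.equilibrium.occupation t).support := by
  rw [Measure.notMem_support_iff_exists]
  exact ⟨_, (isOpen_lt continuous_const continuous_norm).mem_nhds hx, P.occupation_eq_zero hr ht⟩

/-- The upper bound lets `t` decrease to the arrival time. For the lower bound, the support can be
excluded only strictly outside a smaller radius, whence the left continuity `time_le_of_forall_lt`.
-/
theorem arrival_of_mem {x : Eu d} (hx : x ∈ P.shell) :
    P.equilibrium.arrival x = P.time ‖x‖ := by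
  refine le_antisymm ?_ ?_
  · refine le_of_forall_gt fun c hc => ?_
    obtain ⟨t, ht1, ht2⟩ := ENNReal.lt_iff_exists_nnreal_btwn.1 hc
    exact lt_of_le_of_lt (iInf₂_le t (Or.inr (P.mem_support_occupation hx ht1))) ht2
  · refine le_iInf₂ fun t ht => ?_
    refine P.time_le_of_forall_lt hx.1 hx.2 fun r hr1 hr2 => ?_
    by_contra hlt
    rcases ht with ht | ht
    · rw [mem_closedBall_zero_iff] at ht
      exact absurd hx.1 ht.not_gt
    · exact P.notMem_support_occupation hr1.le (Or.inl (not_le.1 hlt)) hr2 ht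

theorem arrival_of_lt {x : Eu d} (hx : P.ρ < ‖x‖) : P.equilibrium.arrival x = ⊤ := by
  refine iInf₂_eq_top.2 fun t ht => ?_
  exfalso
  rcases ht with ht | ht
  · rw [mem_closedBall_zero_iff] at ht
    linarith [P.R_lt]
  · exact P.notMem_support_occupation P.R_lt.le (Or.inr le_rfl) hx ht

theorem newRegion_eq : P.equilibrium.newRegion = P.shell := by
  ext x
  rw [Triplet.newRegion, Metric.isClosed_closedBall.closure_eq, Set.mem_sdiff, Set.mem_ofPred_eq,
    mem_closedBall_zero_iff, not_le]
  constructor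
  · rintro ⟨h1, h2⟩
    refine ⟨h2, le_of_not_gt fun h => ?_⟩
    rw [P.arrival_of_lt h] at h1
    exact lt_irrefl _ h1
  · intro hx
    rw [P.arrival_of_mem hx]
    exact ⟨P.time_lt_top hx.2, hx.1⟩

/-- The energy that is lost on the outer sphere. -/
noncomputable def outerLoss : Measure (Eu d) :=
  ENNReal.ofReal (P.flux P.ρ) • (volume : Measure (Eu d)).toSphere.map
    (fun ω : Metric.sphere (0 : Eu d) 1 => P.ρ • (ω : Eu d))

theorem outerLoss_eq_zero {A : Set (Eu d)} (hA : ∀ x ∈ A, ‖x‖ ≠ P.ρ) : P.outerLoss A = 0 := by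
  have hm : MeasurableSet (Metric.sphere (0 : Eu d) P.ρ)ᶜ :=
    Metric.isClosed_sphere.measurableSet.compl
  refine measure_mono_null (t := (Metric.sphere (0 : Eu d) P.ρ)ᶜ)
    (fun x hx h => hA x hx (mem_sphere_zero_iff_norm.1 h)) ?_
  have he : (fun ω : Metric.sphere (0 : Eu d) 1 => P.ρ • (ω : Eu d)) ⁻¹'
      (Metric.sphere (0 : Eu d) P.ρ)ᶜ = ∅ := by
    ext ω
    simp only [Set.mem_preimage, Set.mem_compl_iff, mem_sphere_zero_iff_norm,
      norm_sphere_smul ω P.ρ_pos.le, not_true_eq_false, Set.mem_empty_iff_false]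
  rw [outerLoss, Measure.smul_apply, Measure.map_apply (by fun_prop) hm, he, measure_empty,
    smul_zero]

/-- This is source = g + q·flux divided by `r ^ (d - 1)`. Moving the negative part of `1 + u` to the
other side makes it an identity of non-negative measures, without subtraction. -/
theorem shellMeasure_source {u : ℝ → ℝ}
    (hg : ∀ r ∈ Set.Icc P.R P.ρ, P.g r = (1 + u r) * r ^ (d - 1)) :
    P.shellMeasure (fun s => ENNReal.ofReal (P.source s)) +
      ((volume : Measure (Eu d)).withDensity fun x =>
        ENNReal.ofReal (-(1 + u ‖x‖))).restrict P.shell =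
    ENNReal.ofReal P.q • P.shellMeasure (fun r => ENNReal.ofReal (P.flux r)) +
      ((volume : Measure (Eu d)).withDensity fun x =>
        ENNReal.ofReal (1 + u ‖x‖)).restrict P.shell := by
  have hf := P.measurable_flux
  have hs := P.measurable_source
  rw [restrict_withDensity P.measurableSet_shell, restrict_withDensity P.measurableSet_shell,
    shellMeasure, shellMeasure, ← withDensity_smul _ (by fun_prop),
    ← withDensity_add_left (by fun_prop), ← withDensity_add_left (by fun_prop)]
  refine withDensity_congr_ae ?_
  filter_upwards [ae_restrict_mem P.measurableSet_shell] with x hx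
  have hx' := P.shell_mem_Icc hx
  have hp := pow_pos_of_mem hx'
  have hfl := (flux_pos hx').le
  simp only [Pi.add_apply, Pi.smul_apply, smul_eq_mul]
  rw [← ENNReal.ofReal_div_of_pos hp, ← ENNReal.ofReal_div_of_pos hp,
    ← ENNReal.ofReal_mul P.q_pos.le]
  have hA : P.source ‖x‖ / ‖x‖ ^ (d - 1) =
      (1 + u ‖x‖) + P.q * (P.flux ‖x‖ / ‖x‖ ^ (d - 1)) := by
    rw [source, hg _ hx']
    field_simp
  have hB : 0 ≤ P.q * (P.flux ‖x‖ / ‖x‖ ^ (d - 1)) :=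
    mul_nonneg P.q_pos.le (div_nonneg hfl hp.le)
  have hA0 : 0 ≤ P.source ‖x‖ / ‖x‖ ^ (d - 1) := div_nonneg (P.source_nonneg _ hx') hp.le
  rw [hA] at hA0 ⊢
  rcases le_total 0 (1 + u ‖x‖) with h | h
  · rw [ENNReal.ofReal_of_nonpos (neg_nonpos.2 h), add_zero, add_comm (1 + u ‖x‖),
      ENNReal.ofReal_add hB h]
  · rw [ENNReal.ofReal_of_nonpos h, add_zero, ← ENNReal.ofReal_add hA0 (neg_nonneg.2 h)]
    congr 1
    ring

/-- All the energy loss of the radial equilibrium occurs on the outer sphere. -/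
theorem excessPos_eq {u : ℝ → ℝ}
    (hg : ∀ r ∈ Set.Icc P.R P.ρ, P.g r = (1 + u r) * r ^ (d - 1)) :
    P.equilibrium.excessPos (fun x => u ‖x‖) =
      P.equilibrium.excessNeg (fun x => u ‖x‖) + P.outerLoss := by
  have h0 : P.equilibrium.κ • (P.equilibrium.Q.restrict {p | p.1.hit = 0}).map
      (fun p => p.1.pos 0) = 0 := by
    have : P.equilibrium.Q {p | p.1.hit = 0} = 0 := by
      refine measure_eq_zero_iff_ae_notMem.2 (P.ae_Q.mono ?_)
      rintro p ⟨ω, s, hs, hp, -⟩ h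
      change p.1.hit = 0 at h
      rw [hp, P.path_hit, Real.toNNReal_eq_zero] at h
      linarith [hs.1]
    rw [Measure.restrict_eq_zero.2 this, Measure.map_zero, smul_zero]
  have h1 : ((P.law.map fun p => p.1.pos 0)).restrict P.shell = P.law.map fun p => p.1.pos 0 := by
    refine Measure.restrict_eq_self_of_ae_mem ?_
    refine (ae_map_iff measurable_start.aemeasurable P.measurableSet_shell).2 (P.ae_law.mono ?_)
    rintro p ⟨ω, s, hs, hp, -⟩
    rw [hp, P.norm_path_pos, NNReal.coe_zero, sub_zero, max_eq_left hs.1.le]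
    exact hs
  rw [Triplet.excessPos, Triplet.excessNeg, P.newRegion_eq, h0, zero_add, ← Measure.map_smul,
    ← Measure.map_smul, P.κ_smul_Q, Measure.restrict_add, Measure.restrict_add, h1,
    P.law_map_killed_restrict, P.law_map_start, ← P.shellMeasure_source hg, outerLoss]
  abel

theorem admissible {u : ℝ → ℝ}
    (hg : ∀ r ∈ Set.Icc P.R P.ρ, P.g r = (1 + u r) * r ^ (d - 1)) :
    P.equilibrium.Admissible (fun x => u ‖x‖) := by
  rw [Triplet.Admissible, P.excessPos_eq hg]
  exact Measure.le_add_right le_rfl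

/-- The loss lives on the outer sphere, which is not reached by time `t`. -/
theorem cumulativeLoss_eq_zero {u : ℝ → ℝ}
    (hg : ∀ r ∈ Set.Icc P.R P.ρ, P.g r = (1 + u r) * r ^ (d - 1)) {t : ℝ}
    (ht : ENNReal.ofReal t < P.time P.ρ) :
    P.equilibrium.cumulativeLoss (fun x => u ‖x‖) t = 0 := by
  rw [Triplet.cumulativeLoss, P.excessPos_eq hg, Measure.add_apply, P.outerLoss_eq_zero,
    add_zero, sub_self]
  intro x hx h
  have hs : x ∈ P.shell := ⟨by rw [h]; exact P.R_lt, h.le⟩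
  rw [Set.mem_ofPred_eq, P.arrival_of_mem hs, h] at hx
  exact absurd ht hx.not_gt

/-- The boundary energy of the radial equilibrium. -/
theorem boundaryEnergy_eq {V : ℝ} (hV : P.a₀ = (P.γ + V) * P.R ^ (d - 1)) (hV0 : 0 ≤ P.γ + V) :
    P.equilibrium.boundaryEnergy =
      initialEnergy P.γ (Metric.closedBall (0 : Eu d) P.R) (fun _ => V) := by
  have := P.nontrivial
  have h := euclideanHausdorffMeasure_restrict_sphere (E := Eu d) P.R_pos
  rw [finrank_euclideanSpace_fin] at h
  rw [Triplet.boundaryEnergy, ← Measure.map_smul, ← Measure.restrict_smul, P.κ_smul_Q,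
    P.law_map_terminal, initialEnergy, mtBoundary_closedBall P.R_pos, h, withDensity_const,
    smul_smul, ← ENNReal.ofReal_mul hV0, hV]

end RadialProfile

/-! ### Non-negative losses, and the arrival time of the growing ball. -/

/-- The cumulative loss of an admissible triplet is non-negative. -/
theorem Triplet.cumulativeLoss_nonneg {d : ℕ} {Γ : Set (Eu d)} {u : Eu d → ℝ} {q : Triplet Γ}
    (hQ : IsFiniteMeasure q.Q) (hΓ : IsClosed Γ)
    (hu : IntegrableOn (fun x => max (-(1 + u x)) 0) Γᶜ volume) (hq : q.Admissible u) (t : ℝ) :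
    0 ≤ q.cumulativeLoss u t := by
  have hfin : q.excessPos u Set.univ < ⊤ := by
    have h1 : (volume.withDensity fun x => ENNReal.ofReal (-(1 + u x))) q.newRegion < ⊤ := by
      refine (measure_mono (t := Γᶜ) fun x hx => ?_).trans_lt ?_
      · rw [← hΓ.closure_eq]; exact hx.2
      · rw [withDensity_apply _ hΓ.measurableSet.compl]
        have := hu.lintegral_lt_top
        simpa only [ENNReal.ofReal_max, ENNReal.ofReal_zero, max_eq_left zero_le] using this
    have h2 : ∀ (μ : Measure (KilledPath Γ)) [IsFiniteMeasure μ] (A : Set (Eu d)),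
        (q.κ • μ.map fun p => p.1.pos 0) A < ⊤ := by
      intro μ _ A
      rw [Measure.smul_apply]
      exact ENNReal.mul_lt_top ENNReal.coe_lt_top (measure_lt_top _ _)
    rw [Triplet.excessPos, Measure.add_apply, Measure.restrict_apply_univ, Measure.add_apply]
    exact ENNReal.add_lt_top.2 ⟨h2 _ _, ENNReal.add_lt_top.2 ⟨h2 _ _, h1⟩⟩
  rw [Triplet.cumulativeLoss, sub_nonneg]
  exact ENNReal.toReal_mono (measure_lt_top_of_subset (Set.subset_univ _) hfin.ne).ne (hq _)

/-- The radial integral defining the arrival time of the growing ball. -/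
noncomputable def ballTime (d : ℕ) (γ R₀ V : ℝ) (u : ℝ → ℝ) (r : ℝ) : ℝ≥0∞ :=
  ∫⁻ z in Set.Ioc R₀ r, ENNReal.ofReal (z ^ (d - 1)) / ENNReal.ofReal (ballEnergy d γ R₀ V u z)

theorem ballTime_mono (d : ℕ) (γ R₀ V : ℝ) (u : ℝ → ℝ) : Monotone (ballTime d γ R₀ V u) :=
  fun _ _ h => lintegral_mono_set (Set.Ioc_subset_Ioc_right h)

section Ball

variable {d : ℕ} {γ R₀ : ℝ} {u : ℝ → ℝ} {M : ℝ}

theorem intervalIntegrable_one_add_mul_pow (hu : Measurable u) (hM : ∀ r, |u r| ≤ M) (a b : ℝ) :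
    IntervalIntegrable (fun z => (1 + u z) * z ^ (d - 1)) volume a b := by
  have hc : Continuous fun z : ℝ => (1 + M) * z ^ (d - 1) := by fun_prop
  refine (hc.intervalIntegrable a b).mono_fun (by fun_prop) (Eventually.of_forall fun z => ?_)
  have h0 : 0 ≤ M := (abs_nonneg _).trans (hM 0)
  beta_reduce
  rw [norm_mul, norm_mul]
  gcongr
  rw [Real.norm_eq_abs, Real.norm_eq_abs, abs_of_nonneg (by positivity : 0 ≤ 1 + M)]
  exact (abs_add_le _ _).trans (by rw [abs_one]; gcongr; exact hM z)

theorem continuous_ballEnergy (hu : Measurable u) (hM : ∀ r, |u r| ≤ M) (V : ℝ) :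
    Continuous (ballEnergy d γ R₀ V u) := by
  have := intervalIntegral.continuous_primitive
    (intervalIntegrable_one_add_mul_pow (d := d) hu hM) R₀
  unfold ballEnergy
  fun_prop

theorem ballEnergy_self (V : ℝ) : ballEnergy d γ R₀ V u R₀ = V * R₀ ^ (d - 1) := by
  rw [ballEnergy, intervalIntegral.integral_same]
  ring

/-- The energy is Lipschitz continuous on bounded intervals. -/
theorem exists_ballEnergy_le (hγ : 0 < γ) (hR₀ : 0 < R₀) (hu : Measurable u)
    (hM : ∀ r, |u r| ≤ M) (V Z : ℝ) : ∃ C > 0, ∀ r ∈ Set.Icc R₀ Z,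
      ballEnergy d γ R₀ V u r ≤ ballEnergy d γ R₀ V u Z + C * (Z - r) := by
  have h0 : 0 ≤ M := (abs_nonneg _).trans (hM 0)
  -- The summands bound the derivatives of the integral and of `γ * r ^ (d - 1)` on the interval;
  -- the final one guarantees positivity.
  refine ⟨(1 + M) * |Z| ^ (d - 1) + γ * ((d - 1 : ℕ) * |Z| ^ (d - 1 - 1)) + 1, by positivity,
    fun r hr => ?_⟩
  have hr0 : 0 < r := hR₀.trans_le hr.1
  have hZ0 : 0 < Z := hr0.trans_le hr.2
  have hI := intervalIntegrable_one_add_mul_pow (d := d) hu hM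
  have h1 : ∫ z in r..Z, (1 + u z) * z ^ (d - 1) ≤ (1 + M) * |Z| ^ (d - 1) * (Z - r) := by
    have := intervalIntegral.norm_integral_le_of_norm_le_const (a := r) (b := Z)
      (f := fun z => (1 + u z) * z ^ (d - 1)) (C := (1 + M) * |Z| ^ (d - 1)) fun z hz => by
        rw [Set.uIoc_of_le hr.2] at hz
        rw [norm_mul, norm_pow, Real.norm_eq_abs, Real.norm_eq_abs]
        have hz0 : 0 < z := hr0.trans hz.1
        gcongr
        · exact (abs_add_le _ _).trans (by rw [abs_one]; gcongr; exact hM z)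
        · exact hz.2
    rw [abs_of_nonneg (sub_nonneg.2 hr.2)] at this
    exact (Real.le_norm_self _).trans this
  have h2 : Z ^ (d - 1) - r ^ (d - 1) ≤ (Z - r) * ((d - 1 : ℕ) * |Z| ^ (d - 1 - 1)) := by
    have := (le_abs_self _).trans (abs_pow_sub_pow_le (α := ℝ) Z r (d - 1))
    rwa [abs_of_nonneg (sub_nonneg.2 hr.2), max_eq_left (by gcongr; exact hr.2), mul_assoc] at this
  have h3 := intervalIntegral.integral_add_adjacent_intervals (hI R₀ r) (hI r Z)
  have h4 := mul_le_mul_of_nonneg_left h2 hγ.le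
  have h5 := sub_nonneg.2 hr.2
  rw [ballEnergy, ballEnergy]
  nlinarith

/-- If the integral of the negative part of `1 + u` is finite, the energy becomes negative. -/
theorem exists_ballEnergy_neg (hd : 2 ≤ d) (hγ : 0 < γ) (hR₀ : 0 < R₀) (hu : Measurable u)
    (hM : ∀ r, |u r| ≤ M) (hu_int : IntegrableOn (fun x : Eu d => max (-(1 + u ‖x‖)) 0)
      (Metric.closedBall (0 : Eu d) R₀)ᶜ volume) (V : ℝ) :
    ∃ r > R₀, ballEnergy d γ R₀ V u r < 0 := by
  have : Nontrivial (Eu d) := by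
    have : NeZero d := ⟨by omega⟩
    infer_instance
  set f : ℝ → ℝ≥0∞ := fun r => ENNReal.ofReal (r ^ (d - 1)) * ENNReal.ofReal (-(1 + u r)) with hf
  -- In polar coordinates the integral over space is this one times the area of the unit sphere,
  -- which is positive; finiteness therefore passes to the radial integral.
  have hfin : ∫⁻ r in Set.Ioi R₀, f r < ⊤ := by
    have h1 := hu_int.lintegral_lt_top
    simp only [ENNReal.ofReal_max, ENNReal.ofReal_zero, max_eq_left zero_le] at h1
    rw [← lintegral_indicator Metric.isClosed_closedBall.measurableSet.compl, lintegral_polar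
      (Measurable.indicator (by fun_prop) Metric.isClosed_closedBall.measurableSet.compl)] at h1
    have h2 : ∀ ω : Metric.sphere (0 : Eu d) 1, ∫⁻ r in Set.Ioi (0 : ℝ),
        ENNReal.ofReal (r ^ (Module.finrank ℝ (Eu d) - 1)) *
          (Metric.closedBall (0 : Eu d) R₀)ᶜ.indicator
            (fun x => ENNReal.ofReal (-(1 + u ‖x‖))) (r • (ω : Eu d)) =
        ∫⁻ r in Set.Ioi R₀, f r := by
      intro ω
      rw [← lintegral_indicator measurableSet_Ioi, ← lintegral_indicator measurableSet_Ioi]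
      refine lintegral_congr fun r => ?_
      by_cases hr : R₀ < r
      · have hr0 : 0 < r := hR₀.trans hr
        have hn : ‖r • (ω : Eu d)‖ = r := RadialProfile.norm_sphere_smul ω hr0.le
        rw [Set.indicator_of_mem (show r ∈ Set.Ioi (0 : ℝ) from hr0),
          Set.indicator_of_mem (show r ∈ Set.Ioi R₀ from hr), Set.indicator_of_mem (by
            rw [Set.mem_compl_iff, mem_closedBall_zero_iff, hn, not_le]; exact hr), hn,
          finrank_euclideanSpace_fin]
      · rw [Set.indicator_of_notMem (show r ∉ Set.Ioi R₀ from hr)]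
        by_cases hr0 : 0 < r
        · have hn : ‖r • (ω : Eu d)‖ = r := RadialProfile.norm_sphere_smul ω hr0.le
          rw [Set.indicator_of_mem (show r ∈ Set.Ioi (0 : ℝ) from hr0), Set.indicator_of_notMem (by
            rw [Set.notMem_compl_iff, mem_closedBall_zero_iff, hn]; exact not_lt.1 hr), mul_zero]
        · rw [Set.indicator_of_notMem (show r ∉ Set.Ioi (0 : ℝ) from hr0)]
    simp_rw [h2] at h1
    rw [lintegral_const] at h1
    refine lt_top_iff_ne_top.2 fun h => ?_
    rw [h, ENNReal.top_mul] at h1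
    · exact lt_irrefl _ h1
    · exact (Measure.measure_univ_pos.2 (volume : Measure (Eu d)).toSphere_ne_zero).ne'
  have hlow : ∀ r, R₀ ≤ r → -(∫⁻ r in Set.Ioi R₀, f r).toReal ≤
      ∫ z in R₀..r, (1 + u z) * z ^ (d - 1) := by
    intro r hr
    have hI := (intervalIntegrable_iff_integrableOn_Ioc_of_le hr).1
      (intervalIntegrable_one_add_mul_pow (d := d) hu hM R₀ r)
    rw [intervalIntegral.integral_of_le hr, integral_eq_lintegral_pos_part_sub_lintegral_neg_part hI]
    have h1 : ∫⁻ z in Set.Ioc R₀ r, ENNReal.ofReal (-((1 + u z) * z ^ (d - 1))) ≤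
        ∫⁻ r in Set.Ioi R₀, f r := by
      refine (setLIntegral_mono' measurableSet_Ioc fun z hz => ?_).trans
        (lintegral_mono_set Set.Ioc_subset_Ioi_self)
      have : 0 < z := hR₀.trans hz.1
      rw [hf]
      beta_reduce
      rw [← ENNReal.ofReal_mul (by positivity)]
      exact ENNReal.ofReal_le_ofReal (by linarith)
    have h2 := ENNReal.toReal_mono hfin.ne h1
    have h3 : 0 ≤ (∫⁻ z in Set.Ioc R₀ r, ENNReal.ofReal ((1 + u z) * z ^ (d - 1))).toReal :=
      ENNReal.toReal_nonneg
    linarith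
  -- The surface term grows because `d - 1` is positive, whereas the bulk integral is bounded below
  -- by `hlow`.
  have hlim : Tendsto (fun r : ℝ => γ * r ^ (d - 1)) atTop atTop :=
    (tendsto_pow_atTop (by omega)).const_mul_atTop hγ
  obtain ⟨r, h1, h2⟩ := ((hlim.eventually_gt_atTop
    ((γ + V) * R₀ ^ (d - 1) + (∫⁻ r in Set.Ioi R₀, f r).toReal)).and
      (eventually_gt_atTop R₀)).exists
  refine ⟨r, h2, ?_⟩
  have := hlow r h2.le
  rw [ballEnergy]
  linarith

/-- The arrival time diverges at the first zero of the energy. -/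
theorem exists_le_ballTime (hd : 2 ≤ d) (hγ : 0 < γ) (hR₀ : 0 < R₀) (hu : Measurable u)
    (hM : ∀ r, |u r| ≤ M) (hu_int : IntegrableOn (fun x : Eu d => max (-(1 + u ‖x‖)) 0)
      (Metric.closedBall (0 : Eu d) R₀)ᶜ volume) {V : ℝ} (hV : 0 < V) {N : ℝ≥0∞} (hN : N < ⊤) :
    ∃ ρ > R₀, (∀ r ∈ Set.Icc R₀ ρ, 0 < ballEnergy d γ R₀ V u r) ∧ N < ballTime d γ R₀ V u ρ := by
  have hcont : Continuous (ballEnergy d γ R₀ V u) := continuous_ballEnergy hu hM V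
  obtain ⟨b, hb, hneg⟩ := exists_ballEnergy_neg hd hγ hR₀ hu hM hu_int V
  -- Here `V > 0` enters: for `V = 0` the energy would already vanish at `R₀`.
  have hpos : 0 < ballEnergy d γ R₀ V u R₀ := by rw [ballEnergy_self]; positivity
  have hne : (Set.Icc R₀ b ∩ ballEnergy d γ R₀ V u ⁻¹' {0}).Nonempty := by
    obtain ⟨z, hz, h⟩ := intermediate_value_Icc' hb.le hcont.continuousOn ⟨hneg.le, hpos.le⟩
    exact ⟨z, hz, h⟩
  obtain ⟨Z, ⟨hZ, hZ0⟩, hZmin⟩ :=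
    (isCompact_Icc.inter_right (isClosed_singleton.preimage hcont)).exists_isLeast hne
  have hZ0 : ballEnergy d γ R₀ V u Z = 0 := hZ0
  have hRZ : R₀ < Z := lt_of_le_of_ne hZ.1 fun h => hpos.ne' (h ▸ hZ0)
  have hposZ : ∀ r, R₀ ≤ r → r < Z → 0 < ballEnergy d γ R₀ V u r := by
    intro r hr hrZ
    by_contra! hle
    obtain ⟨z, hz, h⟩ := intermediate_value_Icc' hr hcont.continuousOn ⟨hle, hpos.le⟩
    exact absurd (hZmin ⟨⟨hz.1, hz.2.trans (hrZ.le.trans hZ.2)⟩, h⟩) (hz.2.trans_lt hrZ).not_ge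
  -- The energy vanishes at `Z` at most linearly, so the integrand dominates a multiple of 1/(Z-z),
  -- which is not integrable up to `Z`.
  have hdiv : ∫⁻ z in Set.Ioo R₀ Z,
      ENNReal.ofReal (z ^ (d - 1)) / ENNReal.ofReal (ballEnergy d γ R₀ V u z) = ⊤ := by
    obtain ⟨C, hC, hle⟩ := exists_ballEnergy_le (d := d) hγ hR₀ hu hM V Z
    set c := R₀ ^ (d - 1) / C with hc
    have hc0 : 0 < c := by positivity
    have h1 : ∫⁻ z in Set.Ioo R₀ Z, ENNReal.ofReal (c * ‖(z - Z)⁻¹‖) = ⊤ := by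
      by_contra hfin
      have h2 : IntegrableOn (fun z => c * ‖(z - Z)⁻¹‖) (Set.Ioo R₀ Z) := by
        refine ⟨by fun_prop, ?_⟩
        rw [hasFiniteIntegral_iff_ofReal (Eventually.of_forall fun z => by positivity)]
        exact lt_top_iff_ne_top.2 hfin
      have h3 : IntegrableOn (fun z => ‖(z - Z)⁻¹‖) (Set.Ioo R₀ Z) := by
        refine (h2.const_mul c⁻¹).congr (Eventually.of_forall fun z => ?_)
        field_simp
      have h4 : IntegrableOn (fun z => (z - Z)⁻¹) (Set.Ioo R₀ Z) :=
        (integrable_norm_iff (by fun_prop)).1 h3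
      have h5 : IntervalIntegrable (fun z => (z - Z)⁻¹) volume R₀ Z :=
        (intervalIntegrable_iff_integrableOn_Ioo_of_le hRZ.le).2 h4
      rcases intervalIntegrable_sub_inv_iff.1 h5 with h | h
      · exact hRZ.ne h
      · exact h Set.right_mem_uIcc
    refine top_le_iff.1 (h1.ge.trans (setLIntegral_mono' measurableSet_Ioo fun z hz => ?_))
    have hz0 := hposZ z hz.1.le hz.2
    rw [← ENNReal.ofReal_div_of_pos hz0]
    refine ENNReal.ofReal_le_ofReal ?_
    have h2 := hle z ⟨hz.1.le, hz.2.le⟩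
    have h3 : 0 < Z - z := sub_pos.2 hz.2
    rw [hZ0, zero_add] at h2
    rw [norm_inv, Real.norm_eq_abs, abs_sub_comm, abs_of_pos h3, hc]
    calc R₀ ^ (d - 1) / C * (Z - z)⁻¹ = R₀ ^ (d - 1) / (C * (Z - z)) := by field_simp
      _ ≤ z ^ (d - 1) / ballEnergy d γ R₀ V u z := by gcongr; exacts [pow_nonneg (hR₀.trans hz.1).le _, hz.1.le]
  obtain ⟨v, hvm, hv, hvl⟩ := exists_seq_strictMono_tendsto' hRZ
  have hU : Set.Ioo R₀ Z ⊆ ⋃ n, Set.Ioc R₀ (v n) := by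
    intro z hz
    obtain ⟨n, hn⟩ := (hvl.eventually (lt_mem_nhds hz.2)).exists
    exact Set.mem_iUnion.2 ⟨n, hz.1, hn.le⟩
  have hsup : ⨆ n, ballTime d γ R₀ V u (v n) = ⊤ := by
    refine top_le_iff.1 (hdiv.ge.trans ((lintegral_mono_set hU).trans_eq ?_))
    exact setLIntegral_iUnion_of_directed _ (directed_of_isDirected_le fun m n h =>
      Set.Ioc_subset_Ioc_right (hvm.monotone h))
  obtain ⟨n, hn⟩ := lt_iSup_iff.1 (hN.trans_eq hsup.symm)
  exact ⟨v n, (hv n).1, fun r hr => hposZ r hr.1 (hr.2.trans_lt (hv n).2), hn⟩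

end Ball

/-! ### Radial equilibria approximating the growing ball. -/

theorem RadialProfile.arrival_eq {d : ℕ} (P : RadialProfile d) (x : Eu d) :
    P.equilibrium.arrival x = if ‖x‖ ≤ P.ρ then P.time ‖x‖ else ⊤ := by
  split_ifs with h
  · rcases le_or_gt ‖x‖ P.R with h' | h'
    · rw [P.arrival_of_le h', P.time_of_le h']
    · exact P.arrival_of_mem ⟨h', h⟩
  · exact P.arrival_of_lt (not_le.1 h)

theorem RadialProfile.measurable_arrival {d : ℕ} (P : RadialProfile d) :
    Measurable P.equilibrium.arrival := by
  rw [funext P.arrival_eq]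
  exact Measurable.ite (measurableSet_le measurable_norm measurable_const)
    (P.time_mono.measurable.comp measurable_norm) measurable_const

section Ball

variable {d : ℕ} {γ R₀ : ℝ} {u : ℝ → ℝ} {M : ℝ}

/-- For positive initial velocities, there are radial equilibria whose excess energy loss occurs
arbitrarily late. -/
theorem exists_radial_equilibrium (hd : 2 ≤ d) (hγ : 0 < γ) (hR₀ : 0 < R₀) (hu : Measurable u)
    (hM : ∀ r, |u r| ≤ M) (hu_int : IntegrableOn (fun x : Eu d => max (-(1 + u ‖x‖)) 0)
      (Metric.closedBall (0 : Eu d) R₀)ᶜ volume) {V : ℝ} (hV : 0 < V) {N : ℝ≥0∞} (hN : N < ⊤) :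
    ∃ q : Triplet (Metric.closedBall (0 : Eu d) R₀), (∃ T : ℝ, 0 < T ∧ IsEquilibrium γ T q) ∧
      q.boundaryEnergy = initialEnergy γ (Metric.closedBall (0 : Eu d) R₀) (fun _ => V) ∧
      q.Admissible (fun x => u ‖x‖) ∧
      (∀ t : ℝ, ENNReal.ofReal t ≤ N → q.cumulativeLoss (fun x => u ‖x‖) t = 0) ∧
      Measurable q.arrival ∧
      ∀ x, min (q.arrival x) N = min (ballTime d γ R₀ V u ‖x‖) N := by
  obtain ⟨ρ, hρ, hpos, hNρ⟩ := exists_le_ballTime hd hγ hR₀ hu hM hu_int hV hN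
  have h0 : 0 ≤ M := (abs_nonneg _).trans (hM 0)
  have hflux : ∀ r ∈ Set.Icc R₀ ρ,
      γ * r ^ (d - 1) < (γ + V) * R₀ ^ (d - 1) - ∫ z in R₀..r, (1 + u z) * z ^ (d - 1) := by
    intro r hr
    have := hpos r hr
    rw [ballEnergy] at this
    linarith
  obtain ⟨P, hPγ, hPR, hPa, hPρ, hPg⟩ : ∃ P : RadialProfile d, P.γ = γ ∧ P.R = R₀ ∧
      P.a₀ = (γ + V) * R₀ ^ (d - 1) ∧ P.ρ = ρ ∧ P.g = fun z => (1 + u z) * z ^ (d - 1) :=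
    ⟨{  γ := γ
        R := R₀
        ρ := ρ
        a₀ := (γ + V) * R₀ ^ (d - 1)
        -- Since the flux exceeds `γ * r ^ (d - 1)`, this rate gives q·flux ≥ (1 + M) r^{d-1}, which
        -- outweighs a negative `(1 + u r) * r ^ (d - 1)`.
        q := (1 + M) / γ
        g := fun z => (1 + u z) * z ^ (d - 1)
        two_le := hd
        γ_pos := hγ
        R_pos := hR₀
        R_lt := hρ
        q_pos := by positivity
        g_meas := by fun_prop
        g_int := intervalIntegrable_one_add_mul_pow hu hM
        lt_flux := hflux
        source_nonneg := by
          intro r hr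
          have h1 : 0 < r ^ (d - 1) := pow_pos (hR₀.trans_le hr.1) _
          have h2 := mul_le_mul_of_nonneg_left (hflux r hr).le
            (show 0 ≤ (1 + M) / γ by positivity)
          have h3 : (1 + M) / γ * (γ * r ^ (d - 1)) = (1 + M) * r ^ (d - 1) := by field_simp
          have h4 := mul_nonneg (by linarith [(abs_le.1 (hM r)).1] : 0 ≤ M + u r) h1.le
          nlinarith }, rfl, rfl, rfl, rfl, rfl⟩
  subst hPγ hPR hPρ
  have htime : P.time = ballTime d P.γ P.R V u := by
    funext r
    refine lintegral_congr fun z => ?_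
    rw [RadialProfile.den, RadialProfile.flux, hPa, hPg, ballEnergy]
  have hg : ∀ r ∈ Set.Icc P.R P.ρ, P.g r = (1 + u r) * r ^ (d - 1) := fun r _ => by rw [hPg]
  refine ⟨P.equilibrium, ⟨_, by positivity, P.isEquilibrium⟩, P.boundaryEnergy_eq hPa
    (by positivity), P.admissible hg, fun t ht => P.cumulativeLoss_eq_zero hg ?_,
    P.measurable_arrival, fun x => ?_⟩
  · rw [htime]
    exact ht.trans_lt hNρ
  · rw [P.arrival_eq, htime]
    split_ifs with h
    · rfl
    -- Outside the shell the arrival time is infinite, but there the radial integral also exceeds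
    -- `N`; truncation at `N` hides the difference.
    · rw [min_eq_right le_top, min_eq_right]
      exact hNρ.le.trans (ballTime_mono _ _ _ _ _ (not_le.1 h).le)

/-- The arrival time of the growing ball is infinite beyond the maximal radius. -/
theorem ballArrival_eq (hR₀ : 0 < R₀) (hu : Measurable u) (hM : ∀ r, |u r| ≤ M) (V : ℝ)
    (x : Eu d) : ballArrival d γ R₀ V u x = ballTime d γ R₀ V u ‖x‖ := by
  rw [ballArrival]
  split_ifs with h1 h2
  · rw [ballTime, Set.Ioc_eq_empty_of_le h1, Measure.restrict_empty, lintegral_zero_measure]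
  · rfl
  · have hc : Continuous (ballEnergy d γ R₀ V u) := continuous_ballEnergy hu hM V
    rw [not_le, ballMaxRadius] at h2
    simp only [iInf_lt_iff] at h2
    obtain ⟨r, ⟨hr1, hr2⟩, hr3⟩ := h2
    have hr4 : r < ‖x‖ := (ENNReal.ofReal_lt_ofReal_iff_of_nonneg (hR₀.trans hr1).le).1 hr3
    have hneg : ballEnergy d γ R₀ V u r < 0 := by rw [ballEnergy]; linarith
    -- Beyond the maximal radius the energy is negative on a non-empty open set. There
    -- `ENNReal.ofReal` turns the denominator into zero and the integrand into infinity, so the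
    -- integral agrees with the prescribed value.
    have hU : IsOpen (Set.Ioo R₀ ‖x‖ ∩ {z | ballEnergy d γ R₀ V u z < 0}) :=
      isOpen_Ioo.inter (isOpen_lt hc continuous_const)
    refine (lintegral_eq_top_of_measure_eq_top_ne_zero
      (by have := hc.measurable; fun_prop) fun h0 => ?_).symm
    rw [Measure.restrict_apply' measurableSet_Ioc] at h0
    refine (hU.measure_pos volume ⟨r, ⟨hr1, hr4⟩, hneg⟩).ne' (measure_mono_null ?_ h0)
    rintro z ⟨hz, hz0⟩
    refine ⟨?_, hz.1, hz.2.le⟩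
    change ENNReal.ofReal (z ^ (d - 1)) / ENNReal.ofReal (ballEnergy d γ R₀ V u z) = ⊤
    rw [ENNReal.ofReal_of_nonpos (le_of_lt hz0), ENNReal.div_zero]
    exact (ENNReal.ofReal_pos.2 (pow_pos (hR₀.trans hz.1) _)).ne'

/-- As the velocity decreases to `V`, the energy decreases and the integrand increases, also where
the energy is not positive. Monotone convergence in `[0, ∞]` needs no integrability. -/
theorem tendsto_ballTime (hR₀ : 0 < R₀) (hu : Measurable u) (hM : ∀ r, |u r| ≤ M) (V r : ℝ) :
    Tendsto (fun n : ℕ => ballTime d γ R₀ (V + 1 / ((n : ℝ) + 1)) u r) atTop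
      (𝓝 (ballTime d γ R₀ V u r)) := by
  refine lintegral_tendsto_of_tendsto_of_monotone (fun n => ?_) ?_ ?_
  · have := (continuous_ballEnergy (d := d) (γ := γ) (R₀ := R₀) hu hM
      (V + 1 / ((n : ℝ) + 1))).measurable
    fun_prop
  · refine Eventually.of_forall fun z m n hmn => ?_
    beta_reduce
    gcongr
    rw [ballEnergy, ballEnergy]
    gcongr
  · refine Eventually.of_forall fun z => ENNReal.Tendsto.const_div ?_ (Or.inr ENNReal.ofReal_ne_top)
    refine ENNReal.tendsto_ofReal ?_
    have h : Tendsto (fun n : ℕ => V + 1 / ((n : ℝ) + 1)) atTop (𝓝 (V + 0)) :=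
      tendsto_one_div_add_atTop_nhds_zero_nat.const_add V
    rw [add_zero] at h
    exact (((h.const_add γ).mul_const _).sub_const _).sub_const _

end Ball

/-! ### Local convergence of the arrival times and the conclusion. -/

theorem locallyIntegrable_truncate {d : ℕ} {w : Eu d → ℝ≥0∞} (hw : Measurable w) (T : ℝ) :
    LocallyIntegrable (truncate w T) volume := by
  refine (locallyIntegrable_const (max T 0)).mono
    (hw.min measurable_const).ennreal_toReal.aestronglyMeasurable (Eventually.of_forall fun x => ?_)
  rw [truncate, Real.norm_of_nonneg ENNReal.toReal_nonneg,
    Real.norm_of_nonneg (le_max_right _ _), ← Real.coe_toNNReal', ← ENNReal.coe_toReal]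
  exact ENNReal.toReal_mono ENNReal.ofReal_ne_top (min_le_right _ _)

/-- Pointwise convergence of measurable functions implies the convergence of their truncations in
`L¹_loc`. -/
theorem tendstoL1Loc_truncate {d : ℕ} {f : ℕ → Eu d → ℝ≥0∞} {w : Eu d → ℝ≥0∞} {T : ℝ}
    (hf : ∀ n, Measurable (f n)) (hw : Measurable w)
    (h : ∀ x, Tendsto (fun n => truncate (f n) T x) atTop (𝓝 (truncate w T x))) :
    TendstoL1Loc (fun n => truncate (f n) T) (truncate w T) := by
  refine ⟨fun n => locallyIntegrable_truncate (hf n) T, locallyIntegrable_truncate hw T,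
    fun K hK => ?_⟩
  have hm : ∀ {g : Eu d → ℝ≥0∞}, Measurable g → Measurable (truncate g T) := by
    intro g hg
    unfold truncate
    fun_prop
  have hb : ∀ (g : Eu d → ℝ≥0∞) x, ‖truncate g T x‖ₑ ≤ ENNReal.ofReal T := by
    intro g x
    rw [truncate, Real.enorm_of_nonneg ENNReal.toReal_nonneg]
    exact ENNReal.ofReal_toReal_le.trans (min_le_right _ _)
  simp only [eLpNorm_one_eq_lintegral_enorm]
  have := tendsto_lintegral_of_dominated_convergence (μ := volume.restrict K)
    (F := fun n x => ‖(truncate (f n) T - truncate w T) x‖ₑ) (f := fun _ => 0)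
    (fun _ => ENNReal.ofReal T + ENNReal.ofReal T)
    (fun n => ((hm (hf n)).sub (hm hw)).enorm)
    (fun n => Eventually.of_forall fun x => (enorm_sub_le).trans (add_le_add (hb _ _) (hb _ _)))
    (by
      rw [lintegral_const, Measure.restrict_apply_univ]
      exact ENNReal.mul_ne_top (by finiteness) hK.measure_lt_top.ne)
    (Eventually.of_forall fun x => by
      have h1 := ((h x).sub_const (truncate w T x)).enorm
      rwa [sub_self, enorm_zero] at h1)
  rwa [lintegral_zero] at this

/-- The initial energy for a constant initial velocity. -/
theorem initialEnergy_apply {d : ℕ} (γ V : ℝ) (Γ : Set (Eu d)) (A : Set (Eu d)) :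
    initialEnergy γ Γ (fun _ => V) A = ENNReal.ofReal (γ + V) *
      ((Measure.euclideanHausdorffMeasure (d - 1) : Measure (Eu d)).restrict (mtBoundary Γ)) A := by
  rw [initialEnergy, withDensity_const, Measure.smul_apply, smul_eq_mul]

theorem euclideanHausdorffMeasure_mtBoundary_closedBall_lt_top {d : ℕ} (hd : 2 ≤ d) {R : ℝ}
    (hR : 0 < R) : (Measure.euclideanHausdorffMeasure (d - 1) : Measure (Eu d))
      (mtBoundary (Metric.closedBall (0 : Eu d) R)) < ⊤ := by
  have : Nontrivial (Eu d) := by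
    have : NeZero d := ⟨by omega⟩
    infer_instance
  have h := euclideanHausdorffMeasure_restrict_sphere (E := Eu d) hR
  rw [finrank_euclideanSpace_fin] at h
  rw [mtBoundary_closedBall hR, ← Measure.restrict_apply_univ, h, Measure.smul_apply, smul_eq_mul]
  exact ENNReal.mul_lt_top ENNReal.ofReal_lt_top (measure_lt_top _ _)

/-- The growing ball is a minimal solution if the profile is measurable and bounded. -/
theorem isMinimalSolution_ballArrival {d : ℕ} (hd : 2 ≤ d) {γ R₀ V₀ : ℝ} (hγ : 0 < γ)
    (hR₀ : 0 < R₀) (hV₀ : 0 ≤ V₀) {u : ℝ → ℝ} {M : ℝ} (hu : Measurable u) (hM : ∀ r, |u r| ≤ M)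
    (hu_int : IntegrableOn (fun x : Eu d => max (-(1 + u ‖x‖)) 0)
      (Metric.closedBall (0 : Eu d) R₀)ᶜ volume) :
    IsMinimalSolution γ (fun x : Eu d => u ‖x‖) (Metric.closedBall (0 : Eu d) R₀) (fun _ => V₀)
      (ballArrival d γ R₀ V₀ u) := by
  have hε : ∀ n : ℕ, (0 : ℝ) < 1 / ((n : ℝ) + 1) := fun n => by positivity
  -- The excess velocity `1 / (n + 1)` gives strict domination and a positive energy at `R₀`; the
  -- time horizon `n` pushes the loss off to infinity.
  choose q hqE hqB hqA hqL hqm hqt using fun n : ℕ =>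
    exists_radial_equilibrium hd hγ hR₀ hu hM hu_int (add_pos_of_nonneg_of_pos hV₀ (hε n))
      (ENNReal.natCast_lt_top n)
  have hH := euclideanHausdorffMeasure_mtBoundary_closedBall_lt_top hd hR₀
  refine ⟨q, hqE, fun T hT => ⟨⟨fun n A hA hpos => ?_, hqA, ?_, ?_⟩, ?_⟩⟩
  · rw [hqB, initialEnergy_apply] at hpos ⊢
    rw [initialEnergy_apply]
    refine ENNReal.mul_lt_mul_left (right_ne_zero_of_mul hpos.ne') ?_ ?_
    · exact ((measure_mono (Set.subset_univ _)).trans_lt (by rwa [Measure.restrict_apply_univ])).ne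
    · exact (ENNReal.ofReal_lt_ofReal_iff (by have := hε n; positivity)).2 (by linarith [hε n])
  · have hball : ballArrival d γ R₀ V₀ u = fun x => ballTime d γ R₀ V₀ u ‖x‖ :=
      funext fun x => ballArrival_eq hR₀ hu hM V₀ x
    refine tendstoL1Loc_truncate hqm ?_ fun x => ?_
    · rw [hball]
      exact (ballTime_mono _ _ _ _ _).measurable.comp measurable_norm
    · rw [hball]
      have h1 : Tendsto (fun n : ℕ => truncate
          (fun x : Eu d => ballTime d γ R₀ (V₀ + 1 / ((n : ℝ) + 1)) u ‖x‖) T x) atTop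
          (𝓝 (truncate (fun x : Eu d => ballTime d γ R₀ V₀ u ‖x‖) T x)) :=
        (ENNReal.tendsto_toReal (min_lt_of_right_lt ENNReal.ofReal_lt_top).ne).comp
          ((tendsto_ballTime hR₀ hu hM V₀ ‖x‖).min tendsto_const_nhds)
      refine h1.congr' ?_
      obtain ⟨N, hN⟩ := exists_nat_ge T
      filter_upwards [eventually_ge_atTop N] with n hn
      have h2 : ENNReal.ofReal T ≤ n := by
        rw [← ENNReal.ofReal_natCast]
        exact ENNReal.ofReal_le_ofReal (hN.trans (by exact_mod_cast hn))
      -- Once `T ≤ n`, truncating at `T` can be preceded by truncating at `n`, where both functions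
      -- agree.
      rw [truncate, truncate, ← min_eq_right h2, ← min_assoc, ← min_assoc, hqt]
  · have h1 : ∀ n, ((q n).κ : ℝ≥0∞) * (q n).Q {p | p.2 = p.1.hit} =
        ENNReal.ofReal (γ + (V₀ + 1 / ((n : ℝ) + 1))) *
          (Measure.euclideanHausdorffMeasure (d - 1) : Measure (Eu d))
            (mtBoundary (Metric.closedBall (0 : Eu d) R₀)) := by
      intro n
      have h2 := congrArg (fun μ => μ Set.univ) (hqB n)
      rw [initialEnergy_apply, Measure.restrict_apply_univ] at h2
      rw [← h2, Triplet.boundaryEnergy, Measure.smul_apply, Measure.map_apply _ .univ,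
        Set.preimage_univ, Measure.restrict_apply_univ]
      · rfl
      · exact (StoppedPath.continuous_pos.comp (continuous_fst.prodMk
          (StoppedPath.continuous_hit.comp continuous_fst))).measurable
    simp_rw [h1]
    rw [lintegral_const, Measure.restrict_apply_univ]
    refine ENNReal.Tendsto.mul_const ?_ (Or.inr hH.ne)
    refine ENNReal.tendsto_ofReal ?_
    have h := (tendsto_one_div_add_atTop_nhds_zero_nat (𝕜 := ℝ)).const_add V₀
    rw [add_zero] at h
    exact h.const_add γ
  -- For `n ≥ r` the loss of the approximating equilibrium at time `r` is zero, and that of an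
  -- admissible competitor is non-negative.
  · intro q' hq'E _ hq'A _ r t hr hrt htT
    refine le_liminf_of_le (by isBoundedDefault) ?_
    obtain ⟨N, hN⟩ := exists_nat_ge r
    filter_upwards [eventually_ge_atTop N] with n hn
    have h2 : ENNReal.ofReal r ≤ n := by
      rw [← ENNReal.ofReal_natCast]
      exact ENNReal.ofReal_le_ofReal (hN.trans (by exact_mod_cast hn))
    obtain ⟨T', -, hE⟩ := hq'E n
    have := hE.isProbabilityMeasure
    rw [hqL n r h2, sub_zero]
    exact_mod_cast Triplet.cumulativeLoss_nonneg inferInstance Metric.isClosed_closedBall hu_int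
      (hq'A n) t

/-! ### From Borel profiles to almost everywhere measurable ones. -/

/-- The definition of a minimal solution only depends on the almost everywhere class of `u`. -/
theorem isMinimalSolution_congr_ae {d : ℕ} {γ : ℝ} {u u' : Eu d → ℝ} (h : u =ᵐ[volume] u')
    {Γ : Set (Eu d)} {V₀ : Eu d → ℝ} {w : Eu d → ℝ≥0∞} (hw : IsMinimalSolution γ u Γ V₀ w) :
    IsMinimalSolution γ u' Γ V₀ w := by
  have h1 : ∀ q : Triplet Γ, q.excessPos u' = q.excessPos u := by
    intro q
    rw [Triplet.excessPos, Triplet.excessPos]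
    congr 3
    exact withDensity_congr_ae (h.mono fun x hx => by beta_reduce; rw [hx])
  have h2 : ∀ q : Triplet Γ, q.excessNeg u' = q.excessNeg u := by
    intro q
    rw [Triplet.excessNeg, Triplet.excessNeg]
    congr 2
    exact withDensity_congr_ae (h.mono fun x hx => by beta_reduce; rw [hx])
  simpa only [IsMinimalSolution, Triplet.Admissible, Triplet.cumulativeLoss, h1, h2] using hw

/-- The norm of almost every point is in a given set of full measure in `[0, ∞)`. -/
theorem ae_norm_of_ae_Ici {d : ℕ} (hd : 2 ≤ d) {p : ℝ → Prop}
    (h : ∀ᵐ r ∂volume.restrict (Set.Ici (0 : ℝ)), p r) : ∀ᵐ x : Eu d, p ‖x‖ := by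
  have : Nontrivial (Eu d) := by
    have : NeZero d := ⟨by omega⟩
    infer_instance
  obtain ⟨s, hs, hsm, hs0⟩ := exists_measurable_superset_of_null (ae_iff.1 h)
  have h1 : volume ((fun x : Eu d => ‖x‖) ⁻¹' s) = 0 := by
    have hm : MeasurableSet ((fun x : Eu d => ‖x‖) ⁻¹' s) := measurable_norm hsm
    rw [← lintegral_indicator_one hm, lintegral_polar (measurable_one.indicator hm)]
    refine (lintegral_congr fun ω => ?_).trans lintegral_zero
    refine (lintegral_eq_zero_iff (by
      have : Measurable (((fun x : Eu d => ‖x‖) ⁻¹' s).indicator (1 : Eu d → ℝ≥0∞)) :=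
        measurable_one.indicator hm
      fun_prop)).2 ?_
    have h2 : ∀ᵐ r ∂volume.restrict (Set.Ioi (0 : ℝ)), r ∉ s :=
      ae_restrict_of_ae_restrict_of_subset Set.Ioi_subset_Ici_self
        (measure_eq_zero_iff_ae_notMem.1 hs0)
    filter_upwards [h2, ae_restrict_mem measurableSet_Ioi] with r hr hr0
    rw [Set.indicator_of_notMem, mul_zero, Pi.zero_apply]
    rwa [Set.mem_preimage, RadialProfile.norm_sphere_smul ω (le_of_lt hr0)]
  exact ae_iff.2 (measure_mono_null (fun x hx => hs hx) h1)

theorem proposition5p3 (d : ℕ) (hd : 2 ≤ d) (γ R₀ V₀ : ℝ) (hγ : 0 < γ) (hR₀ : 0 < R₀)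
    (hV₀ : 0 ≤ V₀) (u : ℝ → ℝ)
    (hu_meas : AEMeasurable u (volume.restrict (Set.Ici 0)))
    (hu_bdd : ∃ M : ℝ, ∀ r : ℝ, 0 ≤ r → |u r| ≤ M)
    (hu_int : IntegrableOn (fun x : Eu d => max (-(1 + u ‖x‖)) 0)
      (Metric.closedBall (0 : Eu d) R₀)ᶜ volume) :
    IsMinimalSolution γ (fun x : Eu d => u ‖x‖) (Metric.closedBall (0 : Eu d) R₀) (fun _ => V₀)
      (ballArrival d γ R₀ V₀ u) := by
  obtain ⟨M, hM⟩ := hu_bdd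
  have hM0 : 0 ≤ M := (abs_nonneg _).trans (hM 0 le_rfl)
  obtain ⟨v, hv, hvM, huv⟩ : ∃ v : ℝ → ℝ, Measurable v ∧ (∀ r, |v r| ≤ M) ∧
      u =ᵐ[volume.restrict (Set.Ici 0)] v := by
    -- Clipping the Borel representative to `[-M, M]` makes the bound hold everywhere, also for
    -- negative arguments, without changing it almost everywhere on `[0, ∞)`.
    refine ⟨fun r => max (-M) (min M (hu_meas.mk u r)), ?_, fun r => ?_, ?_⟩
    · have := hu_meas.measurable_mk
      fun_prop
    · exact abs_le.2 ⟨le_max_left _ _, max_le (by linarith) (min_le_left _ _)⟩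
    · filter_upwards [hu_meas.ae_eq_mk, ae_restrict_mem measurableSet_Ici] with r hr hr0
      have := abs_le.1 (hM r hr0)
      rw [← hr, min_eq_right this.2, max_eq_right this.1]
  have hae : (fun x : Eu d => v ‖x‖) =ᵐ[volume] fun x => u ‖x‖ :=
    (ae_norm_of_ae_Ici hd huv).mono fun x hx => hx.symm
  have hI : ∀ r, R₀ ≤ r →
      ∫ z in R₀..r, (1 + u z) * z ^ (d - 1) = ∫ z in R₀..r, (1 + v z) * z ^ (d - 1) := by
    intro r hr
    refine intervalIntegral.integral_congr_ae_restrict ?_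
    rw [Set.uIoc_of_le hr]
    have h1 : Set.Ioc R₀ r ⊆ Set.Ici 0 := fun z hz => (hR₀.trans hz.1).le
    filter_upwards [ae_restrict_of_ae_restrict_of_subset h1 huv] with z hz
    rw [hz]
  have hball : ballArrival d γ R₀ V₀ u = ballArrival d γ R₀ V₀ v := by
    have hR : ballMaxRadius d γ R₀ V₀ u = ballMaxRadius d γ R₀ V₀ v := by
      refine iInf_congr fun r => iInf_congr_Prop ?_ fun _ => rfl
      exact and_congr_right fun hr => by rw [hI r hr.le]
    funext x
    rw [ballArrival, ballArrival, hR, setLIntegral_congr_fun measurableSet_Ioc fun z hz => ?_]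
    rw [ballEnergy, ballEnergy, hI z hz.1.le]
  rw [hball]
  refine isMinimalSolution_congr_ae hae (isMinimalSolution_ballArrival hd hγ hR₀ hV₀ hv hvM ?_)
  refine hu_int.congr (ae_restrict_of_ae (hae.mono fun x hx => ?_))
  beta_reduce at hx ⊢
  rw [hx]
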